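/- Let $G$ be a finite simple undirected graph. A set $U\subseteq V(G)$ is a *connected vertex cover* of $G$ if every edge of $G$ has an endpoint in $U$ and the induced subgraph $G[U]$ is connected (the empty set counts as connected). There is a deterministic algorithm which, given a graph $G$ on $n$ vertices (by its adjacency matrix) and an integer $k\ge 0$, decides whether $G$ has a connected vertex cover of size at most $k$, in time $O(1.7088^n+\log (k+1))$ and in space polynomial in $n+\log (k+1)$. In particular, for $k\le n$ the running time is $O(1.7088^n)$ and the space is polynomial in $n$. Time and space are measured on a random access machine over the natural numbers (operations $+$, truncated subtraction, $\times$, integer division, indirect addressing, tests for zero) with logarithmic cost: a step costs one plus the total bit length of the numbers it handles, and the space is the largest number of bits needed to write down a memory configuration (addresses and contents of nonzero cells) during the run, input included. -/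

import Mathlib

/-! ### Connected vertex covers -/

/-- `U` is a connected vertex cover of `G`: every edge has an endpoint in `U`, and `G[U]` is
connected, i.e. any two vertices of `U` are joined by a path inside `U`. The empty set counts as
connected, so `∅` is a connected vertex cover of an edgeless graph. -/
def IsConnectedVertexCover {V : Type*} (G : SimpleGraph V) (U : Set V) : Prop :=
  G.IsVertexCover U ∧ (G.induce U).Preconnected

/-- `G` has a connected vertex cover of size at most `k`. -/
def HasConnectedVertexCover {V : Type*} (G : SimpleGraph V) (k : ℕ) : Prop :=
  ∃ U : Finset V, IsConnectedVertexCover G (U : Set V) ∧ U.card ≤ k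

/-! ### Deterministic random access machines with logarithmic cost -/

namespace RAM

/-- A memory configuration: registers (a program names registers by constants, hence uses only
finitely many of them) and an addressable memory. All cells hold natural numbers, and all but
finitely many hold `0`. -/
structure State where
  reg : ℕ →₀ ℕ
  mem : ℕ →₀ ℕ

/-- Length of the binary representation of `x`, plus one (so that `0` also has a positive
length). -/
def len (x : ℕ) : ℕ := Nat.size x + 1

/-- The space taken by a configuration: the total number of bits needed to write down the contents
of the nonzero registers, and the addresses and contents of the nonzero memory cells. -/
def State.space (s : State) : ℕ :=
  s.reg.sum (fun _ v => len v) + s.mem.sum (fun a v => len a + len v)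

/-- The arithmetic operations: addition, truncated subtraction, multiplication, and integer
division (with `x / 0 = 0`). -/
inductive Op where
  | add
  | sub
  | mul
  | div

/-- The result of an arithmetic operation. -/
def Op.eval : Op → ℕ → ℕ → ℕ
  | .add, x, y => x + y
  | .sub, x, y => x - y
  | .mul, x, y => x * y
  | .div, x, y => x / y

/-- The elementary instructions, where `R` stands for the registers and `M` for the memory. -/
inductive Instr where
  /-- `R[d] := c` -/
  | const (d c : ℕ)
  /-- `R[d] := R[a] o R[b]` -/
  | arith (o : Op) (d a b : ℕ)
  /-- `R[d] := M[R[a]]` -/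
  | load (d a : ℕ)
  /-- `M[R[a]] := R[b]` -/
  | store (a b : ℕ)

/-- The effect of an instruction. -/
noncomputable def Instr.exec : Instr → State → State
  | .const d c, s => { s with reg := s.reg.update d c }
  | .arith o d a b, s => { s with reg := s.reg.update d (o.eval (s.reg a) (s.reg b)) }
  | .load d a, s => { s with reg := s.reg.update d (s.mem (s.reg a)) }
  | .store a b, s => { s with mem := s.mem.update (s.reg a) (s.reg b) }

/-- The logarithmic cost of an instruction: one plus the lengths of all numbers it handles
(operands, memory address, result). -/
def Instr.cost : Instr → State → ℕ
  | .const _ c, _ => 1 + len c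
  | .arith o _ a b, s =>
      1 + len (s.reg a) + len (s.reg b) + len (o.eval (s.reg a) (s.reg b))
  | .load _ a, s => 1 + len (s.reg a) + len (s.mem (s.reg a))
  | .store a b, s => 1 + len (s.reg a) + len (s.reg b)

/-- Programs. -/
inductive Prog where
  | skip
  | instr (c : Instr)
  | seq (p q : Prog)
  /-- if `R[a] ≠ 0` then `p` else `q` -/
  | ite (a : ℕ) (p q : Prog)
  /-- while `R[a] ≠ 0` do `p` -/
  | loop (a : ℕ) (p : Prog)

/-- `Runs p s t m s'`: program `p`, started in configuration `s`, halts in configuration `s'`,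
its running time (total cost of the instructions and tests executed) is `t`, and the largest
space of a configuration occurring in the run is `m`. -/
inductive Runs : Prog → State → ℕ → ℕ → State → Prop
  | skip (s : State) : Runs .skip s 1 s.space s
  | instr (c : Instr) (s : State) :
      Runs (.instr c) s (c.cost s) (max s.space (c.exec s).space) (c.exec s)
  | seq {p q : Prog} {s s' s'' : State} {t t' m m' : ℕ} :
      Runs p s t m s' → Runs q s' t' m' s'' → Runs (.seq p q) s (t + t') (max m m') s''
  | ite_true {a : ℕ} {p q : Prog} {s s' : State} {t m : ℕ} :
      s.reg a ≠ 0 → Runs p s t m s' → Runs (.ite a p q) s (1 + len (s.reg a) + t) m s'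
  | ite_false {a : ℕ} {p q : Prog} {s s' : State} {t m : ℕ} :
      s.reg a = 0 → Runs q s t m s' → Runs (.ite a p q) s (1 + len (s.reg a) + t) m s'
  | loop_true {a : ℕ} {p : Prog} {s s' s'' : State} {t t' m m' : ℕ} :
      s.reg a ≠ 0 → Runs p s t m s' → Runs (.loop a p) s' t' m' s'' →
      Runs (.loop a p) s (1 + len (s.reg a) + t + t') (max m m') s''
  | loop_false {a : ℕ} {p : Prog} {s : State} :
      s.reg a = 0 → Runs (.loop a p) s (1 + len (s.reg a)) s.space s

open Classical in
/-- The initial configuration for the instance `(G, k)`, where `G` is a graph with vertices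
`0, …, n - 1`: `R[0] = n`, `R[1] = k`, and the memory holds the adjacency matrix row by row,
`M[n * i + j] = 1` if `i` and `j` are adjacent. Everything else is `0`. -/
noncomputable def graphInput {n : ℕ} (G : SimpleGraph (Fin n)) (k : ℕ) : State where
  reg := Finsupp.single 0 n + Finsupp.single 1 k
  mem := ∑ i : Fin n, ∑ j : Fin n,
    Finsupp.single (n * (i : ℕ) + (j : ℕ)) (if G.Adj i j then 1 else 0)

end RAM

/-! Two cases are settled at once: without edges the empty set is a cover, and if edges lie in
different components there is no connected cover. Otherwise the vertices that have an edge are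
listed in a search order in which every vertex but the first has an earlier neighbour and a vertex
with a later neighbour is adjacent to the next vertex in the list (`ordGraph_ok`). The vertices
without later neighbours, the leaves, form an independent set. Let `N` be the number of listed
vertices; the two strategies are balanced at `N / 4` leaves.

Few leaves. Vertex covers are complements of independent sets, and these are enumerated. A vertex
that is not a leaf and its successor are not both out, which gives the Fibonacci recurrence, while a
leaf gives a factor 2; hence at most `1.2361 ^ l * 1.6181 ^ N` strings for `l` leaves
(`Ord.Ok.cnt_few`).

Many leaves. Let `Q` be the set of the vertices other than leaves that are out. The other vertices
that are not leaves, and the leaves with a neighbour in `Q`, are forced into the cover. The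
remaining leaves are optional, and some of them have to connect the components of the forced part.
Two optional leaves are linked if they touch a common component; the cover is connected if the
chosen leaves are connected by links and touch all components. Branching walks on the optional
leaves (images of rooted ordered trees) witness such choices: connected sets are exactly the node
sets of branching walks. The walks that touch all components are counted by inclusion and exclusion
over the set `X` of components that may be touched, since the walks touching only `X` are counted by
a polynomial recursion. A pair `(Q, X)` is the same as a colouring of the vertices other than leaves
by 0 (out), 1 (in, component in `X`) and 2 (in, component not in `X`) with no edge inside colour 0
and none between 1 and 2. Given the colour of its first neighbour a vertex has only two possible
colours, so there are at most `2 * 2 ^ (N - l)` candidates, and one signed sum over them performs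
both the choice of `Q` and the inclusion and exclusion (`Ord.Ok.sum_fiber`). For each `Q` the
outcome is a natural number, so different `Q` cannot cancel, and the signed sum is nonzero if and
only if a cover exists (`Ord.Ok.sum_signed`).

In both cases the fourth power of the number of rounds is at most `16 * 8.475 ^ N`
(`Ord.Ok.cnt_pow_le`). As `8.475 < 1.7063 ^ 4`, the gap up to 1.7088 absorbs the polynomial cost of
a round (`exists_time_bound`).

For the machine, colourings are numbered in a mixed radix system, so a colouring is recovered from
its number and only two running sums are kept between rounds. The computation is written in a small
language of bounded sums and tables whose values are clamped to `(n + 2) ^ (8 * (n + 2))`, a number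
with polynomially many bits. Compilation (`Exp.code_spec`, `Stmt.code_spec`, `exists_prog`) keeps
track of time and space, and separate estimates show that no clamp ever takes effect. The parameter
`k` is first replaced by `min k n`, so that its length enters the time only additively. -/

namespace RAM

/-! ### Resource-bounded runs -/

/-- All registers and memory cells hold numbers at most `V`, only registers below `R` and memory
cells below `M` are in use. -/
structure Bounded (V R M : ℕ) (s : State) : Prop where
  reg_le : ∀ r, s.reg r ≤ V
  reg_zero : ∀ r, R ≤ r → s.reg r = 0
  mem_le : ∀ a, s.mem a ≤ V
  mem_zero : ∀ a, M ≤ a → s.mem a = 0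

theorem len_mono {x y : ℕ} (h : x ≤ y) : len x ≤ len y := by
  have := Nat.size_le_size h
  unfold len; omega

theorem one_le_len (x : ℕ) : 1 ≤ len x := by unfold len; omega

/-- A bound for the space of bounded states. -/
def spaceBound (V R M : ℕ) : ℕ := R * len V + M * (len M + len V)

/-- The supports lie in `range R` and `range M`, and every address and content in use has length at
most `len M` and `len V`. -/
theorem Bounded.space_le {V R M : ℕ} {s : State} (h : Bounded V R M s) :
    s.space ≤ spaceBound V R M := by
  unfold State.space spaceBound
  have h1 : s.reg.sum (fun _ v => len v) ≤ R * len V := by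
    have hs : s.reg.support ⊆ Finset.range R := by
      intro r hr
      rw [Finset.mem_range]
      by_contra hlt
      exact (Finsupp.mem_support_iff.mp hr) (h.reg_zero r (by omega))
    calc s.reg.sum (fun _ v => len v) ≤ ∑ _r ∈ s.reg.support, len V :=
          Finset.sum_le_sum fun r _ => len_mono (h.reg_le r)
      _ ≤ ∑ _r ∈ Finset.range R, len V :=
          Finset.sum_le_sum_of_subset hs
      _ = R * len V := by simp
  have h2 : s.mem.sum (fun a v => len a + len v) ≤ M * (len M + len V) := by
    have hs : s.mem.support ⊆ Finset.range M := by
      intro r hr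
      rw [Finset.mem_range]
      by_contra hlt
      exact (Finsupp.mem_support_iff.mp hr) (h.mem_zero r (by omega))
    calc s.mem.sum (fun a v => len a + len v) ≤ ∑ _r ∈ s.mem.support, (len M + len V) := by
          refine Finset.sum_le_sum fun r hr => ?_
          have := Finset.mem_range.mp (hs hr)
          exact add_le_add (len_mono this.le) (len_mono (h.mem_le r))
      _ ≤ ∑ _r ∈ Finset.range M, (len M + len V) :=
          Finset.sum_le_sum_of_subset hs
      _ = M * (len M + len V) := by simp
  omega

/-- `p` takes `s` to `s'` in time at most `c` instructions on numbers up to `V`, within the space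
of bounded states. -/
def Exe (V R M : ℕ) (p : Prog) (s : State) (c : ℕ) (s' : State) : Prop :=
  ∃ t m, Runs p s t m s' ∧ t ≤ c * (4 * len V) ∧ m ≤ spaceBound V R M

variable {V R M : ℕ}

theorem Exe.mono {p : Prog} {s s' : State} {c c' : ℕ} (h : Exe V R M p s c s') (hc : c ≤ c') :
    Exe V R M p s c' s' := by
  obtain ⟨t, m, h1, h2, h3⟩ := h
  exact ⟨t, m, h1, h2.trans (Nat.mul_le_mul_right _ hc), h3⟩

theorem Exe.seq {p q : Prog} {s s' s'' : State} {c c' : ℕ} (h : Exe V R M p s c s')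
    (h' : Exe V R M q s' c' s'') : Exe V R M (.seq p q) s (c + c') s'' := by
  obtain ⟨t, m, h1, h2, h3⟩ := h
  obtain ⟨t', m', h1', h2', h3'⟩ := h'
  exact ⟨_, _, .seq h1 h1', by rw [add_mul]; omega, max_le h3 h3'⟩

theorem Exe.ite_true {p q : Prog} {s s' : State} {c a : ℕ} (hs : Bounded V R M s)
    (ha : s.reg a ≠ 0) (h : Exe V R M p s c s') : Exe V R M (.ite a p q) s (c + 1) s' := by
  obtain ⟨t, m, h1, h2, h3⟩ := h
  refine ⟨_, _, .ite_true ha h1, ?_, h3⟩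
  have := len_mono (hs.reg_le a)
  have := one_le_len V
  rw [add_mul]; omega

theorem Exe.ite_false {p q : Prog} {s s' : State} {c a : ℕ} (hs : Bounded V R M s)
    (ha : s.reg a = 0) (h : Exe V R M q s c s') : Exe V R M (.ite a p q) s (c + 1) s' := by
  obtain ⟨t, m, h1, h2, h3⟩ := h
  refine ⟨_, _, .ite_false ha h1, ?_, h3⟩
  have := len_mono (hs.reg_le a)
  have := one_le_len V
  rw [add_mul]; omega

theorem Exe.loop_false {p : Prog} {s : State} {a : ℕ} (hs : Bounded V R M s)
    (ha : s.reg a = 0) : Exe V R M (.loop a p) s 1 s := by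
  refine ⟨_, _, .loop_false ha, ?_, hs.space_le⟩
  have := len_mono (hs.reg_le a)
  have := one_le_len V
  omega

theorem Exe.loop_true {p : Prog} {s s' s'' : State} {a c c' : ℕ} (hs : Bounded V R M s)
    (ha : s.reg a ≠ 0) (h : Exe V R M p s c s') (h' : Exe V R M (.loop a p) s' c' s'') :
    Exe V R M (.loop a p) s (c + 1 + c') s'' := by
  obtain ⟨t, m, h1, h2, h3⟩ := h
  obtain ⟨t', m', h1', h2', h3'⟩ := h'
  refine ⟨_, _, .loop_true ha h1 h1', ?_, max_le h3 h3'⟩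
  have := len_mono (hs.reg_le a)
  have := one_le_len V
  rw [add_mul, add_mul]; omega

/-- A counting-down loop. -/
theorem Exe.loop {p : Prog} {a c L : ℕ} (J : ℕ → State → Prop)
    (hJb : ∀ i s, J i s → Bounded V R M s) (hJr : ∀ i s, J i s → s.reg a = L - i)
    (hstep : ∀ i < L, ∀ s, J i s → ∃ s', Exe V R M p s c s' ∧ J (i + 1) s')
    {s : State} (h0 : J 0 s) :
    ∃ s', Exe V R M (.loop a p) s (L * (c + 1) + 1) s' ∧ J L s' := by
  have key : ∀ d i, d + i = L → ∀ s, J i s →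
      ∃ s', Exe V R M (.loop a p) s (d * (c + 1) + 1) s' ∧ J L s' := by
    intro d
    induction d with
    | zero =>
      intro i hi s hs
      have : i = L := by omega
      subst this
      exact ⟨s, (Exe.loop_false (hJb _ _ hs) (by rw [hJr _ _ hs]; omega)).mono (by omega), hs⟩
    | succ d ih =>
      intro i hi s hs
      obtain ⟨s1, h1, h2⟩ := hstep i (by omega) s hs
      obtain ⟨s2, h3, h4⟩ := ih (i + 1) (by omega) s1 h2
      refine ⟨s2, (Exe.loop_true (hJb _ _ hs) (by rw [hJr _ _ hs]; omega) h1 h3).mono ?_, h4⟩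
      ring_nf; omega
  exact key L 0 (by omega) s h0

/-- Update of a register. -/
noncomputable def State.setReg (s : State) (r v : ℕ) : State := { s with reg := s.reg.update r v }

/-- Update of a memory cell. -/
noncomputable def State.setMem (s : State) (a v : ℕ) : State := { s with mem := s.mem.update a v }

@[simp] theorem setReg_reg (s : State) (r v x : ℕ) :
    (s.setReg r v).reg x = if x = r then v else s.reg x := by
  classical
  simp [State.setReg, Finsupp.update_apply]

@[simp] theorem setMem_mem (s : State) (r v x : ℕ) :
    (s.setMem r v).mem x = if x = r then v else s.mem x := by
  classical
  simp [State.setMem, Finsupp.update_apply]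

theorem Bounded.setReg {s : State} (h : Bounded V R M s) {r v : ℕ} (hr : r < R) (hv : v ≤ V) :
    Bounded V R M (s.setReg r v) where
  reg_le x := by rw [setReg_reg]; split_ifs <;> [exact hv; exact h.reg_le x]
  reg_zero x hx := by rw [setReg_reg, if_neg (by omega)]; exact h.reg_zero x hx
  mem_le := h.mem_le
  mem_zero := h.mem_zero

theorem Bounded.setMem {s : State} (h : Bounded V R M s) {r v : ℕ} (hr : r < M) (hv : v ≤ V) :
    Bounded V R M (s.setMem r v) where
  reg_le := h.reg_le
  reg_zero := h.reg_zero
  mem_le x := by rw [setMem_mem]; split_ifs <;> [exact hv; exact h.mem_le x]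
  mem_zero x hx := by rw [setMem_mem, if_neg (by omega)]; exact h.mem_zero x hx

theorem Exe.const {s : State} (h : Bounded V R M s) {d c : ℕ} (hd : d < R) (hc : c ≤ V) :
    Exe V R M (.instr (.const d c)) s 1 (s.setReg d c) := by
  refine ⟨_, _, .instr _ s, ?_, max_le h.space_le (h.setReg hd hc).space_le⟩
  have := len_mono hc
  have := one_le_len V
  simp only [Instr.cost]; omega

/-- The cost is one plus three lengths, and `1 ≤ len V`; hence the factor 4 in `Exe`. -/
theorem Exe.arith {s : State} (h : Bounded V R M s) {o : Op} {d a b : ℕ} (hd : d < R)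
    (hv : o.eval (s.reg a) (s.reg b) ≤ V) :
    Exe V R M (.instr (.arith o d a b)) s 1 (s.setReg d (o.eval (s.reg a) (s.reg b))) := by
  refine ⟨_, _, .instr _ s, ?_, max_le h.space_le (h.setReg hd hv).space_le⟩
  have := len_mono hv
  have := len_mono (h.reg_le a)
  have := len_mono (h.reg_le b)
  have := one_le_len V
  simp only [Instr.cost]; omega

theorem Exe.load {s : State} (h : Bounded V R M s) {d a : ℕ} (hd : d < R) :
    Exe V R M (.instr (.load d a)) s 1 (s.setReg d (s.mem (s.reg a))) := by
  refine ⟨_, _, .instr _ s, ?_, max_le h.space_le (h.setReg hd (h.mem_le _)).space_le⟩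
  have := len_mono (h.mem_le (s.reg a))
  have := len_mono (h.reg_le a)
  have := one_le_len V
  simp only [Instr.cost]; omega

theorem Exe.store {s : State} (h : Bounded V R M s) {a b : ℕ} (ha : s.reg a < M) :
    Exe V R M (.instr (.store a b)) s 1 (s.setMem (s.reg a) (s.reg b)) := by
  refine ⟨_, _, .instr _ s, ?_, max_le h.space_le (h.setMem ha (h.reg_le b)).space_le⟩
  have := len_mono (h.reg_le a)
  have := len_mono (h.reg_le b)
  have := one_le_len V
  simp only [Instr.cost]; omega

end RAM

namespace ArrayLang

open RAM

/-! ### A small language with bounded sums and two-dimensional arrays -/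

/-- Expressions. -/
inductive Exp where
  | lit (c : ℕ)
  | var (x : ℕ)
  | inp (e : Exp)
  | arr (a : ℕ) (e f : Exp)
  | bin (o : Op) (e f : Exp)
  | ite (c e f : Exp)
  | sum (x : ℕ) (l e : Exp)

/-- Values of the variables and of the arrays. -/
structure Env where
  v : ℕ → ℕ
  A : ℕ → ℕ → ℕ → ℕ

/-- The parameters of an evaluation: array indices are clamped to `W`, results of arithmetic
operations to `cap`, and addresses of the input to `n * n`. -/
structure Ctx where
  n : ℕ
  W : ℕ
  cap : ℕ
  inp : ℕ → ℕ

/-- Update of a variable. -/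
def Env.set (σ : Env) (x i : ℕ) : Env := { σ with v := fun y => if y = x then i else σ.v y }

/-- Update of an array cell. -/
def Env.setA (σ : Env) (a i j w : ℕ) : Env :=
  { σ with A := fun b k l => if b = a ∧ k = i ∧ l = j then w else σ.A b k l }

/-- The value of an expression. -/
def Exp.eval (Γ : Ctx) : Exp → Env → ℕ
  | lit c, _ => c
  | var x, σ => σ.v x
  | inp e, σ => Γ.inp (min (e.eval Γ σ) (Γ.n * Γ.n))
  | arr a e f, σ => σ.A a (min (e.eval Γ σ) Γ.W) (min (f.eval Γ σ) Γ.W)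
  | bin o e f, σ => min (o.eval (e.eval Γ σ) (f.eval Γ σ)) Γ.cap
  | ite c e f, σ => if c.eval Γ σ ≠ 0 then e.eval Γ σ else f.eval Γ σ
  | sum x l e, σ => min (∑ i ∈ Finset.range (min (l.eval Γ σ) Γ.W), e.eval Γ (σ.set x i)) Γ.cap

/-- Statements. -/
inductive Stmt where
  | store (a : ℕ) (e f g : Exp)
  | seq (s t : Stmt)
  | for (x : ℕ) (l : Exp) (s : Stmt)

/-- Iteration of a statement for `x = 0, …, L - 1`. -/
def iter (f : Env → Env) (x : ℕ) (σ : Env) : ℕ → Env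
  | 0 => σ
  | L + 1 => f ((iter f x σ L).set x L)

/-- The effect of a statement. -/
def Stmt.exec (Γ : Ctx) : Stmt → Env → Env
  | store a e f g, σ =>
      σ.setA a (min (e.eval Γ σ) Γ.W) (min (f.eval Γ σ) Γ.W) (g.eval Γ σ)
  | seq s t, σ => t.exec Γ (s.exec Γ σ)
  | .for x l s, σ => iter (s.exec Γ) x σ (min (l.eval Γ σ) Γ.W)

/-! ### Compilation

Registers `0, …, 31` hold the variables, registers `32, …, 39` constants, and the registers from
`40` on are used as a stack. -/

/-- Bound `R[r]` by `R[q]`, using `R[r + 1]`. -/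
def minCode (r q : ℕ) : Prog :=
  .seq (.instr (.arith .sub (r + 1) r q)) (.instr (.arith .sub r r (r + 1)))

/-- The address of an array cell whose clamped indices are `R[r]` and `R[r + 1]`, put in `R[r]`. -/
def addrCode (a r : ℕ) : Prog :=
  .seq (.instr (.arith .mul r r 39)) <| .seq (.instr (.arith .add r r (r + 1))) <|
  .seq (.instr (.arith .mul r r 38)) <| .seq (.instr (.arith .add r r 37)) <|
  .seq (.instr (.const (r + 1) a)) (.instr (.arith .add r r (r + 1)))

/-- Code that leaves the value of an expression in register `40 + d`. -/
def Exp.code : Exp → ℕ → Prog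
  | lit c, d => .instr (.const (40 + d) c)
  | var x, d => .instr (.arith .add (40 + d) x 32)
  | inp e, d => .seq (e.code d) <| .seq (minCode (40 + d) 36) (.instr (.load (40 + d) (40 + d)))
  | arr a e f, d => .seq (e.code d) <| .seq (minCode (40 + d) 35) <|
      .seq (f.code (d + 1)) <| .seq (minCode (40 + d + 1) 35) <|
      .seq (addrCode a (40 + d)) (.instr (.load (40 + d) (40 + d)))
  | bin o e f, d => .seq (e.code d) <| .seq (f.code (d + 1)) <|
      .seq (.instr (.arith o (40 + d) (40 + d) (40 + d + 1))) (minCode (40 + d) 34)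
  | ite c e f, d => .seq (c.code d) (.ite (40 + d) (e.code d) (f.code d))
  | sum x l e, d => .seq (l.code (d + 1)) <| .seq (minCode (40 + d + 1) 35) <|
      .seq (.instr (.arith .add (40 + d + 2) x 32)) <|
      .seq (.instr (.const (40 + d) 0)) <|
      .seq (.instr (.const x 0)) <|
      .seq (.loop (40 + d + 1) (
        .seq (e.code (d + 3)) <|
        .seq (.instr (.arith .add (40 + d) (40 + d) (40 + d + 3))) <|
        .seq (.instr (.arith .sub (40 + d + 3) (40 + d) 34)) <|
        .seq (.instr (.arith .sub (40 + d) (40 + d) (40 + d + 3))) <|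
        .seq (.instr (.arith .add x x 33)) (.instr (.arith .sub (40 + d + 1) (40 + d + 1) 33))))
      (.instr (.arith .add x (40 + d + 2) 32))

/-- The loop `for x = 0, …, R[40 + d] - 1`. -/
def forCode (x : ℕ) (p : Prog) (d : ℕ) : Prog :=
  .seq (.instr (.const (40 + d + 1) 0)) <|
    .loop (40 + d) (.seq (.instr (.arith .add x (40 + d + 1) 32)) <| .seq p <|
      .seq (.instr (.arith .add (40 + d + 1) (40 + d + 1) 33))
        (.instr (.arith .sub (40 + d) (40 + d) 33)))

/-- Code for a statement. -/
def Stmt.code : Stmt → ℕ → Prog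
  | store a e f g, d => .seq (g.code d) <| .seq (e.code (d + 1)) <| .seq (minCode (40 + d + 1) 35) <|
      .seq (f.code (d + 2)) <| .seq (minCode (40 + d + 2) 35) <|
      .seq (addrCode a (40 + d + 1)) (.instr (.store (40 + d + 1) (40 + d)))
  | seq s t, d => .seq (s.code d) (t.code d)
  | .for x l s, d => .seq (l.code d) <| .seq (minCode (40 + d) 35) (forCode x (s.code (d + 2)) d)

/-- Well-formed expressions: few variables, few arrays, small constants, small depth. -/
def Exp.wf : Exp → ℕ → Bool
  | lit c, d => decide (c ≤ 4) && decide (d < 80)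
  | var x, d => decide (x < 32) && decide (d < 80)
  | inp e, d => e.wf d && decide (d < 80)
  | arr a e f, d => decide (a < 32) && e.wf d && f.wf (d + 1) && decide (d < 80)
  | bin _ e f, d => e.wf d && f.wf (d + 1) && decide (d < 80)
  | ite c e f, d => c.wf d && e.wf d && f.wf d && decide (d < 80)
  | sum x l e, d => decide (x < 32) && l.wf (d + 1) && e.wf (d + 3) && decide (d < 80)

/-- Well-formed statements. -/
def Stmt.wf : Stmt → ℕ → Bool
  | store a e f g, d => decide (a < 32) && g.wf d && e.wf (d + 1) && f.wf (d + 2) && decide (d < 80)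
  | seq s t, d => s.wf d && t.wf d
  | .for x l s, d => decide (x < 32) && l.wf d && s.wf (d + 2) && decide (d < 80)

/-- A bound for the number of instructions executed for an expression. -/
def Exp.cost (W : ℕ) : Exp → ℕ
  | lit _ => 1
  | var _ => 1
  | inp e => e.cost W + 3
  | arr _ e f => e.cost W + f.cost W + 11
  | bin _ e f => e.cost W + f.cost W + 3
  | ite c e f => c.cost W + e.cost W + f.cost W + 1
  | sum _ l e => l.cost W + W * (e.cost W + 6) + 7

/-- A bound for the number of instructions executed for a statement. -/
def Stmt.cost (W : ℕ) : Stmt → ℕ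
  | store _ e f g => g.cost W + e.cost W + f.cost W + 11
  | seq s t => s.cost W + t.cost W
  | .for _ l s => l.cost W + W * (s.cost W + 4) + 4

/-! ### Correctness of the compilation -/

/-- Conditions on the parameters. -/
structure Ctx.Ok (Γ : Ctx) : Prop where
  four_le : 4 ≤ Γ.cap
  mem_le : Γ.n * Γ.n + 1 + 32 * ((Γ.W + 1) * (Γ.W + 1)) ≤ Γ.cap
  inp_le : ∀ m, Γ.inp m ≤ Γ.cap

/-- The bound for the numbers that occur. -/
def Ctx.V (Γ : Ctx) : ℕ := Γ.cap * Γ.cap + Γ.cap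

/-- The bound for the addresses that occur. -/
def Ctx.M (Γ : Ctx) : ℕ := Γ.n * Γ.n + 1 + 32 * ((Γ.W + 1) * (Γ.W + 1))

/-- The address of an array cell. -/
def Ctx.addr (Γ : Ctx) (a i j : ℕ) : ℕ := (i * (Γ.W + 1) + j) * 32 + (Γ.n * Γ.n + 1) + a

/-- Executions within the bounds given by the parameters. -/
abbrev Ctx.Exe (Γ : Ctx) (p : Prog) (s : State) (c : ℕ) (s' : State) : Prop :=
  RAM.Exe Γ.V 128 Γ.M p s c s'

/-- `s` represents the environment `σ`. -/
structure Rep (Γ : Ctx) (σ : Env) (s : State) : Prop where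
  bd : Bounded Γ.V 128 Γ.M s
  vars : ∀ x < 32, s.reg x = σ.v x
  vars_le : ∀ x < 32, σ.v x ≤ Γ.cap
  arrs_le : ∀ a < 32, ∀ i j, i ≤ Γ.W → j ≤ Γ.W → σ.A a i j ≤ Γ.cap
  r32 : s.reg 32 = 0
  r33 : s.reg 33 = 1
  r34 : s.reg 34 = Γ.cap
  r35 : s.reg 35 = Γ.W
  r36 : s.reg 36 = Γ.n * Γ.n
  r37 : s.reg 37 = Γ.n * Γ.n + 1
  r38 : s.reg 38 = 32
  r39 : s.reg 39 = Γ.W + 1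
  inp : ∀ m ≤ Γ.n * Γ.n, s.mem m = Γ.inp m
  arr : ∀ a < 32, ∀ i j, i ≤ Γ.W → j ≤ Γ.W → s.mem (Γ.addr a i j) = σ.A a i j

variable {Γ : Ctx}

/-- `s'` differs from `s` in registers from `r` on only. -/
structure Frame (Γ : Ctx) (r : ℕ) (s s' : State) : Prop where
  bd : Bounded Γ.V 128 Γ.M s'
  mem : s'.mem = s.mem
  reg : ∀ x < r, s'.reg x = s.reg x

theorem Frame.refl {s : State} (h : Bounded Γ.V 128 Γ.M s) (r : ℕ) : Frame Γ r s s :=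
  ⟨h, rfl, fun _ _ => rfl⟩

theorem Frame.trans {r r' : ℕ} {s s' s'' : State} (h : Frame Γ r s s') (h' : Frame Γ r' s' s'')
    (hr : r ≤ r') : Frame Γ r s s'' :=
  ⟨h'.bd, h'.mem.trans h.mem, fun x hx => (h'.reg x (by omega)).trans (h.reg x hx)⟩

theorem Frame.setReg {r : ℕ} {s s' : State} (h : Frame Γ r s s') {x v : ℕ} (hx : r ≤ x)
    (hx' : x < 128) (hv : v ≤ Γ.V) : Frame Γ r s (s'.setReg x v) :=
  ⟨h.bd.setReg hx' hv, h.mem, fun y hy => by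
    rw [setReg_reg, if_neg (by omega), h.reg y hy]⟩

theorem Rep.frame {σ : Env} {r : ℕ} {s s' : State} (h : Rep Γ σ s) (h' : Frame Γ r s s')
    (hr : 40 ≤ r) : Rep Γ σ s' where
  bd := h'.bd
  vars x hx := by rw [h'.reg x (by omega), h.vars x hx]
  vars_le := h.vars_le
  arrs_le := h.arrs_le
  r32 := by rw [h'.reg _ (by omega), h.r32]
  r33 := by rw [h'.reg _ (by omega), h.r33]
  r34 := by rw [h'.reg _ (by omega), h.r34]
  r35 := by rw [h'.reg _ (by omega), h.r35]
  r36 := by rw [h'.reg _ (by omega), h.r36]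
  r37 := by rw [h'.reg _ (by omega), h.r37]
  r38 := by rw [h'.reg _ (by omega), h.r38]
  r39 := by rw [h'.reg _ (by omega), h.r39]
  inp m hm := by rw [h'.mem, h.inp m hm]
  arr a ha i j hi hj := by rw [h'.mem, h.arr a ha i j hi hj]

theorem Rep.setVar {σ : Env} {s : State} (h : Rep Γ σ s) {x i : ℕ} (hx : x < 32)
    (hi : i ≤ Γ.cap) : Rep Γ (σ.set x i) (s.setReg x i) where
  bd := h.bd.setReg (by omega) (by unfold Ctx.V; omega)
  vars y hy := by simp only [setReg_reg, Env.set]; split_ifs <;> [rfl; exact h.vars y hy]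
  vars_le y hy := by simp only [Env.set]; split_ifs <;> [exact hi; exact h.vars_le y hy]
  arrs_le := h.arrs_le
  r32 := by rw [setReg_reg, if_neg (by omega), h.r32]
  r33 := by rw [setReg_reg, if_neg (by omega), h.r33]
  r34 := by rw [setReg_reg, if_neg (by omega), h.r34]
  r35 := by rw [setReg_reg, if_neg (by omega), h.r35]
  r36 := by rw [setReg_reg, if_neg (by omega), h.r36]
  r37 := by rw [setReg_reg, if_neg (by omega), h.r37]
  r38 := by rw [setReg_reg, if_neg (by omega), h.r38]
  r39 := by rw [setReg_reg, if_neg (by omega), h.r39]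
  inp := h.inp
  arr := h.arr

theorem le_V {x : ℕ} (h : x ≤ Γ.cap) : x ≤ Γ.V := by unfold Ctx.V; omega

/-- For truncated subtraction, `x - (x - y) = min x y`, so clamping needs no test. -/
theorem minCode_spec {r q : ℕ} {s : State} (hs : Bounded Γ.V 128 Γ.M s) (hr : r + 1 < 128)
    (_hq : q < r) :
    ∃ s', Γ.Exe (minCode r q) s 2 s' ∧ Frame Γ r s s' ∧ s'.reg r = min (s.reg r) (s.reg q) := by
  have b1 : s.reg r - s.reg q ≤ Γ.V := (Nat.sub_le _ _).trans (hs.reg_le r)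
  have e1 := Exe.arith (o := .sub) (d := r + 1) (a := r) (b := q) hs hr b1
  have f1 := (Frame.refl hs r).setReg (x := r + 1) (by omega) hr b1
  have b2 : Op.eval .sub ((s.setReg (r + 1) (s.reg r - s.reg q)).reg r)
      ((s.setReg (r + 1) (s.reg r - s.reg q)).reg (r + 1)) = min (s.reg r) (s.reg q) := by
    simp [Op.eval]; omega
  have b3 : min (s.reg r) (s.reg q) ≤ Γ.V := (min_le_left _ _).trans (hs.reg_le r)
  have e2 := Exe.arith (o := .sub) (d := r) (a := r) (b := r + 1) f1.bd (by omega) (b2 ▸ b3)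
  rw [b2] at e2
  exact ⟨_, e1.seq e2, f1.setReg le_rfl (by omega) b3, by simp⟩

theorem addr_lt {a i j : ℕ} (ha : a < 32) (hi : i ≤ Γ.W) (hj : j ≤ Γ.W) : Γ.addr a i j < Γ.M := by
  unfold Ctx.addr Ctx.M
  have : i * (Γ.W + 1) ≤ Γ.W * (Γ.W + 1) := Nat.mul_le_mul_right _ hi
  have : (Γ.W + 1) * (Γ.W + 1) = Γ.W * (Γ.W + 1) + Γ.W + 1 := by ring
  omega

/-- An address is a mixed radix number with last digit `a` to base 32 and next digit `j` to base `W
+ 1`, shifted past the input. -/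
theorem addr_inj {a i j a' i' j' : ℕ} (ha : a < 32) (hj : j ≤ Γ.W) (ha' : a' < 32)
    (hj' : j' ≤ Γ.W) (h : Γ.addr a i j = Γ.addr a' i' j') : a = a' ∧ i = i' ∧ j = j' := by
  unfold Ctx.addr at h
  have h1 : a = a' := by omega
  have h2 : i * (Γ.W + 1) + j = i' * (Γ.W + 1) + j' := by omega
  have h3 : i = i' := by
    have := congrArg (· / (Γ.W + 1)) h2
    simpa [Nat.add_div_of_dvd_right, Nat.mul_add_div, mul_comm _ (Γ.W + 1),
      Nat.div_eq_of_lt (Nat.lt_succ_of_le hj), Nat.div_eq_of_lt (Nat.lt_succ_of_le hj')] using this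
  subst h3
  exact ⟨h1, rfl, by omega⟩

theorem addrCode_spec (hΓ : Γ.Ok) {σ : Env} {a r i j : ℕ} {s : State} (hs : Rep Γ σ s)
    (hr : r + 1 < 128) (hr' : 40 ≤ r) (ha : a < 32) (h1 : s.reg r = i) (h2 : s.reg (r + 1) = j)
    (hi : i ≤ Γ.W) (hj : j ≤ Γ.W) :
    ∃ s', Γ.Exe (addrCode a r) s 6 s' ∧ Frame Γ r s s' ∧ s'.reg r = Γ.addr a i j := by
  have hV : Γ.addr a i j ≤ Γ.V := le_V ((addr_lt ha hi hj).le.trans hΓ.mem_le)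
  have hV' := hV
  unfold Ctx.addr at hV
  have e1 := Exe.arith (o := .mul) (d := r) (a := r) (b := 39) hs.bd (by omega)
    (by rw [h1, hs.r39]; simp only [Op.eval]; omega)
  have f1 := (Frame.refl hs.bd r).setReg (x := r) le_rfl (by omega)
    (v := i * (Γ.W + 1)) (by omega)
  rw [h1, hs.r39] at e1
  have e2 := Exe.arith (o := .add) (d := r) (a := r) (b := r + 1) f1.bd (by omega)
    (by simp [Op.eval, h2]; omega)
  have f2 := f1.setReg (x := r) le_rfl (by omega) (v := i * (Γ.W + 1) + j) (by omega)
  simp [Op.eval, h2] at e2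
  have e3 := Exe.arith (o := .mul) (d := r) (a := r) (b := 38) f2.bd (by omega)
    (by rw [f2.reg 38 (by omega), hs.r38]; simp [Op.eval]; omega)
  have f3 := f2.setReg (x := r) le_rfl (by omega) (v := (i * (Γ.W + 1) + j) * 32) (by omega)
  rw [f2.reg 38 (by omega), hs.r38] at e3
  simp [Op.eval] at e3
  have e4 := Exe.arith (o := .add) (d := r) (a := r) (b := 37) f3.bd (by omega)
    (by rw [f3.reg 37 (by omega), hs.r37]; simp [Op.eval]; omega)
  have f4 := f3.setReg (x := r) le_rfl (by omega)
    (v := (i * (Γ.W + 1) + j) * 32 + (Γ.n * Γ.n + 1)) (by omega)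
  rw [f3.reg 37 (by omega), hs.r37] at e4
  simp [Op.eval] at e4
  have e5 := Exe.const (d := r + 1) (c := a) f4.bd (by omega) (by omega)
  have f5 := f4.setReg (x := r + 1) (by omega) (by omega) (v := a) (by omega)
  have e6 := Exe.arith (o := .add) (d := r) (a := r) (b := r + 1) f5.bd (by omega)
    (by simp [Op.eval]; omega)
  have f6 := f5.setReg (x := r) le_rfl (by omega) (v := Γ.addr a i j) hV'
  simp [Op.eval] at e6
  refine ⟨_, e1.seq (e2.seq (e3.seq (e4.seq (e5.seq e6)))), f6, ?_⟩
  simp [Ctx.addr]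

theorem eval_le (hΓ : Γ.Ok) : ∀ (e : Exp) (d : ℕ) (σ : Env), e.wf d = true →
    (∀ x < 32, σ.v x ≤ Γ.cap) → (∀ a < 32, ∀ i j, i ≤ Γ.W → j ≤ Γ.W → σ.A a i j ≤ Γ.cap) →
    e.eval Γ σ ≤ Γ.cap
  | .lit c, d, σ, hw, _, _ => by
      simp [Exp.wf] at hw; have := hΓ.four_le; simp only [Exp.eval]; omega
  | .var x, d, σ, hw, hv, _ => by simp [Exp.wf] at hw; exact hv x hw.1
  | .inp e, d, σ, hw, hv, _ => hΓ.inp_le _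
  | .arr a e f, d, σ, hw, hv, hA => by
      simp [Exp.wf] at hw; exact hA a hw.1.1.1 _ _ (min_le_right _ _) (min_le_right _ _)
  | .bin o e f, d, σ, hw, hv, _ => min_le_right _ _
  | .ite c e f, d, σ, hw, hv, hA => by
      simp [Exp.wf] at hw
      simp only [Exp.eval]
      split_ifs
      · exact eval_le hΓ e d σ hw.1.1.2 hv hA
      · exact eval_le hΓ f d σ hw.1.2 hv hA
  | .sum x l e, d, σ, hw, hv, _ => min_le_right _ _

theorem Rep.eval_le (hΓ : Γ.Ok) {σ : Env} {s : State} (h : Rep Γ σ s) {e : Exp} {d : ℕ}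
    (hw : e.wf d = true) : e.eval Γ σ ≤ Γ.cap :=
  ArrayLang.eval_le hΓ e d σ hw h.vars_le h.arrs_le

/-- Results exist for a moment before they are clamped; `V` is chosen so that a sum or product of
two clamped numbers still fits. -/
theorem op_le {o : Op} {x y : ℕ} (hx : x ≤ Γ.cap) (hy : y ≤ Γ.cap) : o.eval x y ≤ Γ.V := by
  unfold Ctx.V
  cases o
  · have : Γ.cap = 0 ∨ Γ.cap ≤ Γ.cap * Γ.cap := by
      rcases Nat.eq_zero_or_pos Γ.cap with h | h
      · exact .inl h
      · exact .inr (Nat.le_mul_of_pos_left _ h)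
    simp only [Op.eval]; omega
  · simp only [Op.eval]; omega
  · have := Nat.mul_le_mul hx hy
    simp only [Op.eval]; omega
  · have := Nat.div_le_self x y
    simp only [Op.eval]; omega

/-- Structural induction with the depth `d` of the stack. `Frame` guarantees that the variables and
the partial results lower on the stack survive. A sum does overwrite its variable, but saves the old
value in register `40 + d + 2` and restores it at the end. -/
theorem Exp.code_spec (hΓ : Γ.Ok) : ∀ (e : Exp) (d : ℕ) (σ : Env) (s : State), e.wf d = true →
    Rep Γ σ s → ∃ s', Γ.Exe (e.code d) s (e.cost Γ.W) s' ∧ Frame Γ (40 + d) s s' ∧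
      s'.reg (40 + d) = e.eval Γ σ
  | .lit c, d, σ, s, hw, hs => by
      simp [Exp.wf] at hw
      have := hΓ.four_le
      have hc : c ≤ Γ.V := le_V (by omega)
      exact ⟨_, Exe.const hs.bd (by omega) hc, (Frame.refl hs.bd _).setReg le_rfl (by omega) hc,
        by simp [Exp.eval]⟩
  | .var x, d, σ, s, hw, hs => by
      simp [Exp.wf] at hw
      have e1 := Exe.arith (o := .add) (d := 40 + d) (a := x) (b := 32) hs.bd (by omega)
        (by rw [hs.r32]; exact hs.bd.reg_le x)
      exact ⟨_, e1, (Frame.refl hs.bd _).setReg le_rfl (by omega)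
        (by rw [hs.r32]; exact hs.bd.reg_le x), by simp [Exp.eval, Op.eval, hs.r32, hs.vars x hw.1]⟩
  | .inp e, d, σ, s, hw, hs => by
      simp [Exp.wf] at hw
      obtain ⟨s1, e1, f1, v1⟩ := e.code_spec hΓ d σ s hw.1 hs
      obtain ⟨s2, e2, f2, v2⟩ := minCode_spec (r := 40 + d) (q := 36) f1.bd (by omega) (by omega)
      have f := f1.trans f2 le_rfl
      have e3 := Exe.load (d := 40 + d) (a := 40 + d) f2.bd (by omega)
      refine ⟨_, (e1.seq (e2.seq e3)).mono (by simp only [Exp.cost]; omega),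
        f.setReg le_rfl (by omega) (f2.bd.mem_le _), ?_⟩
      rw [f1.reg 36 (by omega), hs.r36, v1] at v2
      simp only [setReg_reg, if_true, Exp.eval]
      rw [f.mem, v2, hs.inp _ (min_le_right _ _)]
  | .arr a e f, d, σ, s, hw, hs => by
      simp [Exp.wf] at hw
      obtain ⟨s1, e1, f1, v1⟩ := e.code_spec hΓ d σ s hw.1.1.2 hs
      obtain ⟨s2, e2, f2, v2⟩ := minCode_spec (r := 40 + d) (q := 35) f1.bd (by omega) (by omega)
      have g2 := f1.trans f2 le_rfl
      rw [f1.reg 35 (by omega), hs.r35, v1] at v2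
      obtain ⟨s3, e3, f3, v3⟩ := f.code_spec hΓ (d + 1) σ s2 hw.1.2 (hs.frame g2 (by omega))
      have g3 := g2.trans f3 (by omega)
      obtain ⟨s4, e4, f4, v4⟩ := minCode_spec (r := 40 + d + 1) (q := 35) f3.bd (by omega) (by omega)
      have g4 := g3.trans f4 (by omega)
      rw [g3.reg 35 (by omega), hs.r35, show 40 + d + 1 = 40 + (d + 1) by omega, v3] at v4
      obtain ⟨s5, e5, f5, v5⟩ := addrCode_spec hΓ (r := 40 + d) (hs.frame g4 (by omega)) (by omega)
        (by omega) hw.1.1.1 ((f4.reg _ (by omega)).trans ((f3.reg _ (by omega)).trans v2)) v4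
        (min_le_right _ _) (min_le_right _ _)
      have g5 := g4.trans f5 le_rfl
      have e6 := Exe.load (d := 40 + d) (a := 40 + d) f5.bd (by omega)
      refine ⟨_, (e1.seq (e2.seq (e3.seq (e4.seq (e5.seq e6))))).mono (by
        simp only [Exp.cost]; omega), g5.setReg le_rfl (by omega) (f5.bd.mem_le _), ?_⟩
      simp only [setReg_reg, if_true, Exp.eval]
      rw [g5.mem, v5, hs.arr a hw.1.1.1 _ _ (min_le_right _ _) (min_le_right _ _)]
  | .bin o e f, d, σ, s, hw, hs => by
      simp [Exp.wf] at hw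
      obtain ⟨s1, e1, f1, v1⟩ := e.code_spec hΓ d σ s hw.1.1 hs
      obtain ⟨s2, e2, f2, v2⟩ := f.code_spec hΓ (d + 1) σ s1 hw.1.2 (hs.frame f1 (by omega))
      have g2 := f1.trans f2 (by omega)
      have hv : o.eval (s2.reg (40 + d)) (s2.reg (40 + d + 1)) ≤ Γ.V := by
        rw [f2.reg _ (by omega), v1, show 40 + d + 1 = 40 + (d + 1) by omega, v2]
        exact op_le (hs.eval_le hΓ hw.1.1) (hs.eval_le hΓ hw.1.2)
      have e3 := Exe.arith (d := 40 + d) (a := 40 + d) (b := 40 + d + 1) f2.bd (by omega) hv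
      have g3 := g2.setReg (x := 40 + d) le_rfl (by omega) hv
      obtain ⟨s4, e4, f4, v4⟩ := minCode_spec (r := 40 + d) (q := 34) g3.bd (by omega) (by omega)
      refine ⟨_, (e1.seq (e2.seq (e3.seq e4))).mono (by simp only [Exp.cost]; omega),
        g3.trans f4 le_rfl, ?_⟩
      rw [v4, g3.reg 34 (by omega), hs.r34, setReg_reg, if_pos rfl, f2.reg _ (by omega), v1,
        show 40 + d + 1 = 40 + (d + 1) by omega, v2]
      rfl
  | .ite c e f, d, σ, s, hw, hs => by
      simp [Exp.wf] at hw
      obtain ⟨s1, e1, f1, v1⟩ := c.code_spec hΓ d σ s hw.1.1.1 hs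
      simp only [Exp.eval]
      split_ifs with h
      · obtain ⟨s2, e2, f2, v2⟩ := e.code_spec hΓ d σ s1 hw.1.1.2 (hs.frame f1 (by omega))
        exact ⟨_, (e1.seq (Exe.ite_true f1.bd (v1 ▸ h) e2)).mono (by simp only [Exp.cost]; omega),
          f1.trans f2 le_rfl, v2⟩
      · obtain ⟨s2, e2, f2, v2⟩ := f.code_spec hΓ d σ s1 hw.1.2 (hs.frame f1 (by omega))
        exact ⟨_, (e1.seq (Exe.ite_false f1.bd (v1 ▸ not_not.mp h) e2)).mono (by
          simp only [Exp.cost]; omega), f1.trans f2 le_rfl, v2⟩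
  | .sum x l e, d, σ, s, hw, hs => by
      simp [Exp.wf] at hw
      obtain ⟨⟨⟨hx, hl⟩, he⟩, hd⟩ := hw
      have hW : Γ.W ≤ Γ.cap := by
        have := hΓ.mem_le
        have : Γ.W + 1 ≤ (Γ.W + 1) * (Γ.W + 1) := Nat.le_mul_of_pos_left _ (by omega)
        omega
      set L := min (l.eval Γ σ) Γ.W with hL
      obtain ⟨s1, e1, f1, v1⟩ := l.code_spec hΓ (d + 1) σ s hl hs
      obtain ⟨s2, e2, f2, v2⟩ := minCode_spec (r := 40 + d + 1) (q := 35) f1.bd (by omega) (by omega)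
      have g2 := f1.trans f2 (by omega)
      rw [f1.reg 35 (by omega), hs.r35, show 40 + d + 1 = 40 + (d + 1) by omega, v1, ← hL] at v2
      have hs2 := hs.frame g2 (by omega)
      have e3 := Exe.arith (o := .add) (d := 40 + d + 2) (a := x) (b := 32) g2.bd (by omega)
        (by rw [hs2.r32]; exact g2.bd.reg_le x)
      have hx2 : Op.eval .add (s2.reg x) (s2.reg 32) = σ.v x := by
        rw [hs2.r32, hs2.vars x hx]; rfl
      rw [hx2] at e3
      have f3 := (Frame.refl g2.bd (40 + d)).setReg (x := 40 + d + 2) (by omega) (by omega)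
        (le_V (hs.vars_le x hx))
      have e4 := Exe.const (d := 40 + d) (c := 0) f3.bd (by omega) (by omega)
      have f4 := f3.setReg (x := 40 + d) (by omega) (by omega) (v := 0) (by omega)
      have hs4 := hs2.frame f4 (by omega)
      have e5 := Exe.const (d := x) (c := 0) f4.bd (by omega) (by omega)
      have hs5 := hs4.setVar (i := 0) hx (by omega)
      let S : ℕ → ℕ := fun i => min (∑ j ∈ Finset.range i, e.eval Γ (σ.set x j)) Γ.cap
      -- Loop invariant: the variable `x` is `i`, register `40 + d` holds the clamped partial sum,
      -- and the next two registers hold the remaining number of rounds and the saved value of `x`.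
      let J : ℕ → State → Prop := fun i t => Rep Γ (σ.set x i) t ∧ t.mem = s.mem ∧
        (∀ r < 40 + d, r ≠ x → t.reg r = s.reg r) ∧ t.reg (40 + d) = S i ∧
        t.reg (40 + d + 1) = L - i ∧ t.reg (40 + d + 2) = σ.v x
      have J0 : J 0 ((((s2.setReg (40 + d + 2) (σ.v x)).setReg (40 + d) 0)).setReg x 0) := by
        refine ⟨?_, ?_, ?_, ?_, ?_, ?_⟩
        · have h : (σ.set x 0) = (σ.set x 0) := rfl
          exact hs5
        · exact g2.mem
        · intro r hr hrx
          simp only [setReg_reg]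
          rw [if_neg hrx, if_neg (by omega), if_neg (by omega), g2.reg r (by omega)]
        · simp only [setReg_reg]
          rw [if_neg (by omega)]
          simp [S]
        · simp only [setReg_reg]
          rw [if_neg (by omega), if_neg (by omega), if_neg (by omega),
            show 40 + d + 1 = 40 + (d + 1) by omega, v2]
          rfl
        · simp only [setReg_reg]
          rw [if_neg (by omega), if_neg (by omega), if_pos trivial]
      obtain ⟨s6, e6, hR, hm, hr, hS, _, hsv⟩ := Exe.loop (V := Γ.V) (R := 128) (M := Γ.M)
        (p := .seq (e.code (d + 3)) <|
          .seq (.instr (.arith .add (40 + d) (40 + d) (40 + d + 3))) <|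
          .seq (.instr (.arith .sub (40 + d + 3) (40 + d) 34)) <|
          .seq (.instr (.arith .sub (40 + d) (40 + d) (40 + d + 3))) <|
          .seq (.instr (.arith .add x x 33)) (.instr (.arith .sub (40 + d + 1) (40 + d + 1) 33)))
        (a := 40 + d + 1) (c := e.cost Γ.W + 5) (L := L) J (fun i t h => h.1.bd)
        (fun i t h => h.2.2.2.2.1) (by
          rintro i hi t ⟨hR, hm, hr, hS, hc, hsv⟩
          obtain ⟨t1, a1, b1, w1⟩ := e.code_spec hΓ (d + 3) _ t he hR
          have hle := hR.eval_le hΓ he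
          have hSle : S i ≤ Γ.cap := min_le_right _ _
          have hS1 : t1.reg (40 + d) = S i := by rw [b1.reg _ (by omega), hS]
          have w1' : t1.reg (40 + d + 3) = e.eval Γ (σ.set x i) := by
            rw [show 40 + d + 3 = 40 + (d + 3) by omega, w1]
          have k2 : Op.eval .add (t1.reg (40 + d)) (t1.reg (40 + d + 3)) ≤ Γ.V := by
            rw [hS1, w1']; exact op_le hSle hle
          have a2 := Exe.arith (d := 40 + d) (a := 40 + d) (b := 40 + d + 3) b1.bd (by omega) k2
          have b2 := (b1.trans (Frame.refl b1.bd (40 + (d + 3))) le_rfl)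
          have hR1 := hR.frame b1 (by omega)
          have c2 := (Frame.refl b1.bd (40 + d)).setReg (x := 40 + d) (by omega) (by omega) k2
          rw [hS1, w1'] at a2 c2 k2
          set t2 := t1.setReg (40 + d) (Op.eval .add (S i) (e.eval Γ (σ.set x i))) with ht2
          have hR2 := hR1.frame c2 (by omega)
          have k3 : Op.eval .sub (t2.reg (40 + d)) (t2.reg 34) ≤ Γ.V :=
            (Nat.sub_le _ _).trans (c2.bd.reg_le _)
          have a3 := Exe.arith (o := .sub) (d := 40 + d + 3) (a := 40 + d) (b := 34) c2.bd (by omega) k3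
          have c3 := c2.setReg (x := 40 + d + 3) (by omega) (by omega) k3
          set t3 := t2.setReg (40 + d + 3) (Op.eval .sub (t2.reg (40 + d)) (t2.reg 34)) with ht3
          -- Clamping after every addition gives the same as clamping the whole sum, since the terms
          -- are nonnegative.
          have hv3 : Op.eval .sub (t3.reg (40 + d)) (t3.reg (40 + d + 3)) = S (i + 1) := by
            simp only [ht3, setReg_reg, if_true]
            rw [if_neg (by omega), hR2.r34]
            simp only [ht2, setReg_reg, if_true, Op.eval, S, Finset.sum_range_succ]
            omega
          have k4 : S (i + 1) ≤ Γ.V := le_V (min_le_right _ _)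
          have a4 := Exe.arith (o := .sub) (d := 40 + d) (a := 40 + d) (b := 40 + d + 3) c3.bd
            (by omega) (by rw [hv3]; exact k4)
          rw [hv3] at a4
          have c4 := c3.setReg (x := 40 + d) (by omega) (by omega) k4
          have hR4 := hR1.frame c4 (by omega)
          have hx4 : Op.eval .add ((t3.setReg (40 + d) (S (i + 1))).reg x)
              ((t3.setReg (40 + d) (S (i + 1))).reg 33) = i + 1 := by
            rw [hR4.vars x hx, hR4.r33]; simp [Env.set, Op.eval]
          have hi1 : i + 1 ≤ Γ.cap := by omega
          have a5 := Exe.arith (o := .add) (d := x) (a := x) (b := 33) c4.bd (by omega)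
            (by rw [hx4]; exact le_V hi1)
          rw [hx4] at a5
          have hR5 := hR4.setVar hx hi1
          set t5 := (t3.setReg (40 + d) (S (i + 1))).setReg x (i + 1) with ht5
          have hv6 : Op.eval .sub (t5.reg (40 + d + 1)) (t5.reg 33) = L - (i + 1) := by
            rw [hR5.r33]
            simp only [ht5, ht3, ht2, setReg_reg, Op.eval]
            rw [if_neg (by omega), if_neg (by omega), if_neg (by omega), if_neg (by omega),
              b1.reg _ (by omega), hc]
            omega
          have k6 : L - (i + 1) ≤ Γ.V := le_V (by omega)
          have a6 := Exe.arith (o := .sub) (d := 40 + d + 1) (a := 40 + d + 1) (b := 33) hR5.bd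
            (by omega) (by rw [hv6]; exact k6)
          rw [hv6] at a6
          have c6 := (Frame.refl hR5.bd (40 + d + 1)).setReg (x := 40 + d + 1) le_rfl (by omega) k6
          refine ⟨_, (a1.seq (a2.seq (a3.seq (a4.seq (a5.seq a6))))).mono (by omega),
            ?_, ?_, ?_, ?_, ?_, ?_⟩
          · have := hR5.frame c6 (by omega)
            have h : (σ.set x i).set x (i + 1) = σ.set x (i + 1) := by
              simp only [Env.set, Env.mk.injEq, and_true]
              funext y
              split_ifs <;> rfl
            rw [h] at this
            exact this
          · exact b1.mem.trans hm
          · intro r hr' hrx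
            simp only [ht5, ht3, ht2, setReg_reg]
            rw [if_neg (by omega), if_neg hrx, if_neg (by omega), if_neg (by omega),
              if_neg (by omega), b1.reg _ (by omega), hr r hr' hrx]
          · simp only [ht5, setReg_reg, if_true]
            rw [if_neg (by omega), if_neg (by omega)]
          · simp only [setReg_reg, if_true]
          · simp only [ht5, ht3, ht2, setReg_reg]
            rw [if_neg (by omega), if_neg (by omega), if_neg (by omega), if_neg (by omega),
              if_neg (by omega), b1.reg _ (by omega), hsv]) J0
      have hv7 : Op.eval .add (s6.reg (40 + d + 2)) (s6.reg 32) = σ.v x := by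
        rw [hsv, hR.r32]; rfl
      have e7 := Exe.arith (o := .add) (d := x) (a := 40 + d + 2) (b := 32) hR.bd (by omega)
        (by rw [hv7]; exact le_V (hs.vars_le x hx))
      rw [hv7] at e7
      refine ⟨_, (e1.seq (e2.seq (e3.seq (e4.seq (e5.seq (e6.seq e7)))))).mono ?_,
        ⟨hR.bd.setReg (by omega) (le_V (hs.vars_le x hx)), hm, ?_⟩, ?_⟩
      · have : L * (e.cost Γ.W + 5 + 1) ≤ Γ.W * (e.cost Γ.W + 6) :=
          Nat.mul_le_mul (min_le_right _ _) (by omega)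
        simp only [Exp.cost]; omega
      · intro r hr'
        simp only [setReg_reg]
        split_ifs with h
        · rw [h, hs.vars x hx]
        · exact hr r hr' h
      · simp only [setReg_reg]
        rw [if_neg (by omega), hS]
        rfl

theorem W_le_cap (hΓ : Γ.Ok) : Γ.W ≤ Γ.cap := by
  have := hΓ.mem_le
  have : Γ.W + 1 ≤ (Γ.W + 1) * (Γ.W + 1) := Nat.le_mul_of_pos_left _ (by omega)
  omega

/-- The registers `40, …, r - 1` agree. -/
def StackEq (r : ℕ) (s s' : State) : Prop := ∀ x, 40 ≤ x → x < r → s'.reg x = s.reg x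

theorem Frame.stackEq {r : ℕ} {s s' : State} (h : Frame Γ r s s') : StackEq r s s' :=
  fun x _ hx => h.reg x hx

theorem StackEq.trans {r r' : ℕ} {s s' s'' : State} (h : StackEq r s s') (h' : StackEq r' s' s'')
    (hr : r ≤ r') : StackEq r s s'' :=
  fun x hx hx' => (h' x hx (by omega)).trans (h x hx hx')

/-- The counter lives on the stack and is copied to `x` at the start of each round, so the body may
change `x`; it only has to respect the stack below `40 + d + 2`. The number `L` of rounds is limited
by `cap` and not by `W`, which allows exponentially long loops. -/
theorem forCode_spec (hΓ : Γ.Ok) {f : Env → Env} {p : Prog} {c d x L : ℕ} (hx : x < 32)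
    (hd : d < 80) (hL : L ≤ Γ.cap)
    (hp : ∀ σ s, Rep Γ σ s → ∃ s', Γ.Exe p s c s' ∧ Rep Γ (f σ) s' ∧ StackEq (40 + d + 2) s s')
    {σ : Env} {s : State} (hs : Rep Γ σ s) (hr : s.reg (40 + d) = L) :
    ∃ s', Γ.Exe (forCode x p d) s (L * (c + 4) + 2) s' ∧ Rep Γ (iter f x σ L) s' ∧
      StackEq (40 + d) s s' := by
  have := hΓ.four_le
  have e1 := Exe.const (d := 40 + d + 1) (c := 0) hs.bd (by omega) (by omega)
  have f1 := (Frame.refl hs.bd (40 + d)).setReg (x := 40 + d + 1) (by omega) (by omega)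
    (v := 0) (by omega)
  have hs1 := hs.frame f1 (by omega)
  let J : ℕ → State → Prop := fun i t => Rep Γ (iter f x σ i) t ∧ StackEq (40 + d) s t ∧
    t.reg (40 + d) = L - i ∧ t.reg (40 + d + 1) = i
  obtain ⟨s2, e2, hR, hst, -, -⟩ := Exe.loop (V := Γ.V) (R := 128) (M := Γ.M)
    (p := .seq (.instr (.arith .add x (40 + d + 1) 32)) <| .seq p <|
      .seq (.instr (.arith .add (40 + d + 1) (40 + d + 1) 33))
        (.instr (.arith .sub (40 + d) (40 + d) 33)))
    (a := 40 + d) (c := c + 3) (L := L) (s := s.setReg (40 + d + 1) 0) J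
    (fun i t h => h.1.bd) (fun i t h => h.2.2.1) (by
      rintro i hi t ⟨hR, hst, hc, hi'⟩
      have k1 : Op.eval .add (t.reg (40 + d + 1)) (t.reg 32) = i := by rw [hi', hR.r32]; rfl
      have a1 := Exe.arith (o := .add) (d := x) (a := 40 + d + 1) (b := 32) hR.bd (by omega)
        (by rw [k1]; exact le_V (by omega))
      rw [k1] at a1
      have hR1 := hR.setVar (i := i) hx (by omega)
      obtain ⟨t2, a2, hR2, st2⟩ := hp _ _ hR1
      have r2 : t2.reg (40 + d + 1) = i := by
        rw [st2 _ (by omega) (by omega), setReg_reg, if_neg (by omega), hi']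
      have r2' : t2.reg (40 + d) = L - i := by
        rw [st2 _ (by omega) (by omega), setReg_reg, if_neg (by omega), hc]
      have k3 : Op.eval .add (t2.reg (40 + d + 1)) (t2.reg 33) = i + 1 := by rw [r2, hR2.r33]; rfl
      have k3' : i + 1 ≤ Γ.V := le_V (by omega)
      have a3 := Exe.arith (o := .add) (d := 40 + d + 1) (a := 40 + d + 1) (b := 33) hR2.bd
        (by omega) (by rw [k3]; exact k3')
      rw [k3] at a3
      have f3 := (Frame.refl hR2.bd (40 + d)).setReg (x := 40 + d + 1) (by omega) (by omega) k3'
      have hR3 := hR2.frame f3 (by omega)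
      have k4 : Op.eval .sub ((t2.setReg (40 + d + 1) (i + 1)).reg (40 + d))
          ((t2.setReg (40 + d + 1) (i + 1)).reg 33) = L - (i + 1) := by
        rw [hR3.r33, setReg_reg, if_neg (by omega), r2']
        simp only [Op.eval]; omega
      have k4' : L - (i + 1) ≤ Γ.V := le_V (by omega)
      have a4 := Exe.arith (o := .sub) (d := 40 + d) (a := 40 + d) (b := 33) hR3.bd
        (by omega) (by rw [k4]; exact k4')
      rw [k4] at a4
      have f4 := f3.setReg (x := 40 + d) (by omega) (by omega) k4'
      refine ⟨_, (a1.seq (a2.seq (a3.seq a4))).mono (by omega), hR2.frame f4 (by omega), ?_, ?_, ?_⟩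
      · intro y hy hy'
        rw [f4.reg y hy', st2 y hy (by omega), setReg_reg, if_neg (by omega), hst y hy hy']
      · simp
      · simp only [setReg_reg]
        rw [if_neg (by omega), if_pos trivial])
    ⟨hs1, f1.stackEq, by simp only [setReg_reg]; rw [if_neg (by omega), hr]; rfl, by simp⟩
  exact ⟨s2, (e1.seq e2).mono (by
    rw [show c + 3 + 1 = c + 4 by omega]; omega), hR, hst⟩

theorem Rep.setArr {σ : Env} {s : State} (h : Rep Γ σ s) {a i j w : ℕ} (ha : a < 32)
    (hi : i ≤ Γ.W) (hj : j ≤ Γ.W) (hw : w ≤ Γ.cap) :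
    Rep Γ (σ.setA a i j w) (s.setMem (Γ.addr a i j) w) where
  bd := h.bd.setMem (addr_lt ha hi hj) (le_V hw)
  vars := h.vars
  vars_le := h.vars_le
  arrs_le b hb k l hk hl := by
    simp only [Env.setA]
    split_ifs
    · exact hw
    · exact h.arrs_le b hb k l hk hl
  r32 := h.r32
  r33 := h.r33
  r34 := h.r34
  r35 := h.r35
  r36 := h.r36
  r37 := h.r37
  r38 := h.r38
  r39 := h.r39
  inp m hm := by
    rw [setMem_mem, if_neg (by unfold Ctx.addr; omega), h.inp m hm]
  arr b hb k l hk hl := by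
    simp only [setMem_mem, Env.setA]
    by_cases hc : b = a ∧ k = i ∧ l = j
    · obtain ⟨rfl, rfl, rfl⟩ := hc
      simp
    · rw [if_neg hc, if_neg (fun he => hc (addr_inj hb hl ha hj he)), h.arr b hb k l hk hl]

/-- Statements change variables and memory, so only the stack below `40 + d` is preserved, in place
of the full `Frame` for expressions. -/
theorem Stmt.code_spec (hΓ : Γ.Ok) : ∀ (t : Stmt) (d : ℕ) (σ : Env) (s : State), t.wf d = true →
    Rep Γ σ s → ∃ s', Γ.Exe (t.code d) s (t.cost Γ.W) s' ∧ Rep Γ (t.exec Γ σ) s' ∧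
      StackEq (40 + d) s s'
  | .store a e f g, d, σ, s, hw, hs => by
      simp [Stmt.wf] at hw
      obtain ⟨⟨⟨⟨ha, hg⟩, he⟩, hf⟩, hd⟩ := hw
      obtain ⟨s1, e1, f1, v1⟩ := g.code_spec hΓ d σ s hg hs
      obtain ⟨s2, e2, f2, v2⟩ := e.code_spec hΓ (d + 1) σ s1 he (hs.frame f1 (by omega))
      have g2 := f1.trans f2 (by omega)
      obtain ⟨s3, e3, f3, v3⟩ := minCode_spec (r := 40 + d + 1) (q := 35) f2.bd (by omega) (by omega)
      have g3 := g2.trans f3 (by omega)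
      rw [g2.reg 35 (by omega), hs.r35, show 40 + d + 1 = 40 + (d + 1) by omega, v2] at v3
      obtain ⟨s4, e4, f4, v4⟩ := f.code_spec hΓ (d + 2) σ s3 hf (hs.frame g3 (by omega))
      have g4 := g3.trans f4 (by omega)
      obtain ⟨s5, e5, f5, v5⟩ := minCode_spec (r := 40 + d + 2) (q := 35) f4.bd (by omega) (by omega)
      have g5 := g4.trans f5 (by omega)
      rw [g4.reg 35 (by omega), hs.r35, show 40 + d + 2 = 40 + (d + 2) by omega, v4] at v5
      obtain ⟨s6, e6, f6, v6⟩ := addrCode_spec hΓ (r := 40 + d + 1) (hs.frame g5 (by omega))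
        (by omega) (by omega) ha ((f5.reg _ (by omega)).trans ((f4.reg _ (by omega)).trans v3)) v5
        (min_le_right _ _) (min_le_right _ _)
      have g6 := g5.trans f6 (by omega)
      have hR := hs.frame g6 (by omega)
      have v7 : s6.reg (40 + d) = g.eval Γ σ := by
        rw [f6.reg _ (by omega), f5.reg _ (by omega), f4.reg _ (by omega), f3.reg _ (by omega),
          f2.reg _ (by omega), v1]
      have e7 := Exe.store (a := 40 + d + 1) (b := 40 + d) hR.bd
        (by rw [v6]; exact addr_lt ha (min_le_right _ _) (min_le_right _ _))
      rw [v6, v7] at e7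
      refine ⟨_, (e1.seq (e2.seq (e3.seq (e4.seq (e5.seq (e6.seq e7)))))).mono (by
        simp only [Stmt.cost]; omega),
        hR.setArr ha (min_le_right _ _) (min_le_right _ _) (hs.eval_le hΓ hg), g6.stackEq⟩
  | .seq t u, d, σ, s, hw, hs => by
      simp [Stmt.wf] at hw
      obtain ⟨s1, e1, r1, k1⟩ := t.code_spec hΓ d σ s hw.1 hs
      obtain ⟨s2, e2, r2, k2⟩ := u.code_spec hΓ d _ s1 hw.2 r1
      exact ⟨s2, e1.seq e2, r2, k1.trans k2 le_rfl⟩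
  | .for x l t, d, σ, s, hw, hs => by
      simp [Stmt.wf] at hw
      obtain ⟨⟨⟨hx, hl⟩, ht⟩, hd⟩ := hw
      obtain ⟨s1, e1, f1, v1⟩ := l.code_spec hΓ d σ s hl hs
      obtain ⟨s2, e2, f2, v2⟩ := minCode_spec (r := 40 + d) (q := 35) f1.bd (by omega) (by omega)
      have g2 := f1.trans f2 le_rfl
      rw [f1.reg 35 (by omega), hs.r35, v1] at v2
      obtain ⟨s3, e3, r3, k3⟩ := forCode_spec hΓ (c := t.cost Γ.W) hx hd
        ((min_le_right _ _).trans (W_le_cap hΓ))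
        (fun σ s h => t.code_spec hΓ (d + 2) σ s ht h) (hs.frame g2 (by omega)) v2
      refine ⟨s3, (e1.seq (e2.seq e3)).mono ?_, r3, g2.stackEq.trans k3 le_rfl⟩
      have : min (l.eval Γ σ) Γ.W * (t.cost Γ.W + 4) ≤ Γ.W * (t.cost Γ.W + 4) :=
        Nat.mul_le_mul_right _ (min_le_right _ _)
      simp only [Stmt.cost]; omega

end ArrayLang

namespace ArrayLang

open RAM

/-! ### The input and the initialization -/

section Input

variable {n : ℕ} (G : SimpleGraph (Fin n)) (k : ℕ)

theorem graphInput_mem_apply (m : ℕ) :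
    (graphInput G k).mem m = ∑ i : Fin n, ∑ j : Fin n,
      (open Classical in if n * (i : ℕ) + (j : ℕ) = m then (if G.Adj i j then 1 else 0) else 0) := by
  classical
  simp only [graphInput, Finsupp.finsetSum_apply, Finsupp.single_apply]

theorem graphInput_mem_of_le {m : ℕ} (hm : n * n ≤ m) : (graphInput G k).mem m = 0 := by
  classical
  rw [graphInput_mem_apply]
  refine Finset.sum_eq_zero fun i _ => Finset.sum_eq_zero fun j _ => if_neg ?_
  have : n * (i : ℕ) + n ≤ n * n := by
    have := Nat.mul_le_mul_left n (Nat.succ_le_of_lt i.2)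
    rwa [Nat.mul_succ] at this
  omega

-- On pairs below `n` the map `(i, j) ↦ n * i + j` is injective, so a single term of the double sum
-- survives.
open Classical in
theorem graphInput_mem_adj (i j : Fin n) :
    (graphInput G k).mem (n * (i : ℕ) + (j : ℕ)) = if G.Adj i j then 1 else 0 := by
  rw [graphInput_mem_apply]
  have inj : ∀ i' j' : Fin n, n * (i' : ℕ) + (j' : ℕ) = n * (i : ℕ) + (j : ℕ) → i' = i ∧ j' = j := by
    intro i' j' h
    have hn : 0 < n := i.pos
    have h1 : (i' : ℕ) = i := by
      have := congrArg (· / n) h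
      simpa [Nat.mul_add_div hn, Nat.div_eq_of_lt i'.2, Nat.div_eq_of_lt j'.2,
        Nat.div_eq_of_lt j.2] using this
    rw [h1] at h
    exact ⟨Fin.ext h1, Fin.ext (by omega)⟩
  rw [Finset.sum_eq_single i, Finset.sum_eq_single j, if_pos rfl]
  · intro j' _ hj
    exact if_neg fun h => hj (inj _ _ h).2
  · simp
  · intro i' _ hi
    exact Finset.sum_eq_zero fun j' _ => if_neg fun h => hi (inj _ _ h).1
  · simp

theorem graphInput_mem_le (m : ℕ) : (graphInput G k).mem m ≤ 1 := by
  classical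
  by_cases hm : n * n ≤ m
  · rw [graphInput_mem_of_le G k hm]; omega
  · have hn : 0 < n := by
      rcases Nat.eq_zero_or_pos n with rfl | h
      · omega
      · exact h
    have h1 : m / n < n := Nat.div_lt_of_lt_mul (by omega)
    have := graphInput_mem_adj G k ⟨m / n, h1⟩ ⟨m % n, Nat.mod_lt _ hn⟩
    rw [show n * ((⟨m / n, h1⟩ : Fin n) : ℕ) + ((⟨m % n, Nat.mod_lt _ hn⟩ : Fin n) : ℕ) = m from
      Nat.div_add_mod m n] at this
    rw [this]
    split_ifs <;> omega

theorem graphInput_reg (r : ℕ) :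
    (graphInput G k).reg r = if r = 0 then n else if r = 1 then k else 0 := by
  simp only [graphInput, Finsupp.add_apply, Finsupp.single_apply]
  split_ifs <;> omega

/-- The parameters for an input graph. -/
noncomputable def ctx : Ctx where
  n := n
  W := n + 2
  cap := (n + 2) ^ (8 * (n + 2))
  inp m := (graphInput G k).mem m

/-- The environment at the beginning. -/
def initEnv (n k : ℕ) : Env where
  v x := if x = 0 then n else if x = 1 then min k n else 0
  A _ _ _ := 0

/-- The exponent `8 * (n + 2)` is at least 16 for every `n`. -/
theorem pow_le_cap {e : ℕ} (he : e ≤ 16) : (n + 2) ^ e ≤ (ctx G k).cap :=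
  Nat.pow_le_pow_right (by omega) (by omega)

theorem ctx_ok : (ctx G k).Ok where
  four_le := by
    refine le_trans ?_ (pow_le_cap G k (e := 2) (by omega))
    have : (n + 2) ^ 2 = n * n + 4 * n + 4 := by ring
    omega
  mem_le := by
    refine le_trans ?_ (pow_le_cap G k (e := 10) (by omega))
    simp only [ctx]
    have h2 : 2 ^ 8 ≤ (n + 2) ^ 8 := Nat.pow_le_pow_left (by omega) 8
    calc n * n + 1 + 32 * ((n + 2 + 1) * (n + 2 + 1)) ≤ 2 ^ 8 * (n + 2) ^ 2 := by nlinarith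
      _ ≤ (n + 2) ^ 8 * (n + 2) ^ 2 := Nat.mul_le_mul_right _ h2
      _ = (n + 2) ^ 10 := by ring
  inp_le m := (graphInput_mem_le G k m).trans ((pow_le_cap G k (e := 0) (by omega)).trans' (by simp))

end Input

/-- The code that reduces `k` to `min k n`. -/
def capCode : Prog :=
  .seq (.instr (.arith .sub 40 1 0)) <| .seq (.instr (.arith .sub 1 1 40)) (.instr (.const 40 0))

/-- The code that sets up the constants. -/
def initCode : Prog :=
  .seq (.instr (.const 33 1)) <| .seq (.instr (.const 40 2)) <|
  .seq (.instr (.arith .add 35 0 40)) <| .seq (.instr (.arith .add 39 35 33)) <|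
  .seq (.instr (.arith .mul 36 0 0)) <| .seq (.instr (.arith .add 37 36 33)) <|
  .seq (.instr (.const 38 32)) <| .seq (.instr (.arith .mul 40 35 35)) <|
  .seq (.instr (.arith .mul 40 40 40)) <| .seq (.instr (.arith .mul 40 40 40)) <|
  .seq (.instr (.const 34 1)) <| .seq (.instr (.arith .add 41 35 32)) <|
  .loop 41 (.seq (.instr (.arith .mul 34 34 40)) (.instr (.arith .sub 41 41 33)))

/-! ### Correctness of the initialization -/

section Init

variable {n : ℕ} (G : SimpleGraph (Fin n)) (k : ℕ)

theorem n_le_cap : n ≤ (ctx G k).cap := by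
  have := pow_le_cap G k (e := 1) (by omega)
  rw [pow_one] at this
  omega

theorem graphInput_bounded {V M : ℕ} (hV : n ≤ V) (hV' : 1 ≤ V) (hM : n * n ≤ M) :
    Bounded (max V k) 128 M (graphInput G k) where
  reg_le r := by
    rw [graphInput_reg]
    split_ifs <;> omega
  reg_zero r hr := by rw [graphInput_reg, if_neg (by omega), if_neg (by omega)]
  mem_le a := by
    have h1 := graphInput_mem_le G k a
    omega
  mem_zero a ha := graphInput_mem_of_le G k (by omega)

/-- Again `k - (k - n) = min k n`. Only these three instructions handle numbers that depend on the
size of `k`, so only they are measured with `max V k`; clearing register 40 removes `k - n`, and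
afterwards `V` bounds everything. -/
theorem capCode_spec {V M : ℕ} (hV : n ≤ V) (hV' : 1 ≤ V) (hM : n * n ≤ M) : ∃ s,
    RAM.Exe (max V k) 128 M capCode (graphInput G k) 3 s ∧
    Bounded V 128 M s ∧ s.mem = (graphInput G k).mem ∧
    ∀ r, s.reg r = if r = 0 then n else if r = 1 then min k n else 0 := by
  have b0 := graphInput_bounded G k hV hV' hM
  have r0 : (graphInput G k).reg 0 = n := by rw [graphInput_reg]; rfl
  have r1 : (graphInput G k).reg 1 = k := by rw [graphInput_reg]; rfl
  have e1 := Exe.arith (o := .sub) (d := 40) (a := 1) (b := 0) b0 (by omega)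
    (by rw [r1]; simp only [Op.eval]; omega)
  have b1 := b0.setReg (r := 40) (v := k - n) (by omega) (by omega)
  simp only [r0, r1, Op.eval] at e1
  have h2 : Op.eval .sub (((graphInput G k).setReg 40 (k - n)).reg 1)
      (((graphInput G k).setReg 40 (k - n)).reg 40) = min k n := by
    simp only [setReg_reg, Op.eval]
    rw [if_neg (by omega), if_pos trivial, r1]
    omega
  have e2 := Exe.arith (o := .sub) (d := 1) (a := 1) (b := 40) b1 (by omega)
    (by rw [h2]; omega)
  have b2 := b1.setReg (r := 1) (v := min k n) (by omega) (by omega)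
  rw [h2] at e2
  have e3 := Exe.const (d := 40) (c := 0) b2 (by omega) (by omega)
  have hreg : ∀ r, ((((graphInput G k).setReg 40 (k - n)).setReg 1 (min k n)).setReg 40 0).reg r =
      if r = 0 then n else if r = 1 then min k n else 0 := by
    intro r
    simp only [setReg_reg, graphInput_reg]
    split_ifs <;> omega
  refine ⟨_, e1.seq (e2.seq e3), ⟨fun r => ?_, fun r hr => ?_, fun a => ?_, ?_⟩, rfl, hreg⟩
  · rw [hreg]
    split_ifs <;> omega
  · rw [hreg, if_neg (by omega), if_neg (by omega)]
  · exact (graphInput_mem_le G k a).trans hV'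
  · exact b0.mem_zero

/-- Three squarings give `(n + 2) ^ 8`, and `n + 2` multiplications by it give `cap`. All
intermediate powers are at most `cap`. -/
theorem initCode_spec {Γ : Ctx} (hΓn : Γ.n = n) (hΓW : Γ.W = n + 2)
    (hcap : Γ.cap = (n + 2) ^ (8 * (n + 2))) (hinp : ∀ m, Γ.inp m = (graphInput G k).mem m)
    {s : State} (b0 : Bounded Γ.V 128 Γ.M s)
    (hm : s.mem = (graphInput G k).mem)
    (hr : ∀ r, s.reg r = if r = 0 then n else if r = 1 then min k n else 0) :
    ∃ s', Γ.Exe initCode s ((n + 2) * 3 + 13) s' ∧ Rep Γ (initEnv n k) s' := by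
  have le16 : ∀ {e : ℕ}, e ≤ 8 * (n + 2) → (n + 2) ^ e ≤ Γ.cap := fun he => by
    rw [hcap]; exact Nat.pow_le_pow_right (by omega) he
  have q0 := le_V (le16 (e := 0) (by omega))
  have q1' := le16 (e := 1) (by omega)
  have q2 := le_V (le16 (e := 2) (by omega))
  have q4 := le_V (le16 (e := 4) (by omega))
  have q5 := le_V (le16 (e := 5) (by omega))
  have q8 := le_V (le16 (e := 8) (by omega))
  have c32 : 32 ≤ Γ.V := q5.trans' (by
    calc 32 = 2 ^ 5 := by norm_num
      _ ≤ (n + 2) ^ 5 := Nat.pow_le_pow_left (by omega) 5)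
  rw [pow_one] at q1'
  have q1 := le_V q1'
  rw [pow_zero] at q0
  have sq : (n + 2) ^ 2 = n * n + 4 * n + 4 := by ring
  have sq' : (n + 2) * (n + 2) = (n + 2) ^ 2 := by ring
  have sq4 : (n + 2) ^ 2 * (n + 2) ^ 2 = (n + 2) ^ 4 := by ring
  have sq8 : (n + 2) ^ 4 * (n + 2) ^ 4 = (n + 2) ^ 8 := by ring
  have e1 := Exe.const (d := 33) (c := 1) b0 (by omega) (by omega)
  have b1 := b0.setReg (r := 33) (v := 1) (by omega) (by omega)
  have e2 := Exe.const (d := 40) (c := 2) b1 (by omega) (by omega)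
  have b2 := b1.setReg (r := 40) (v := 2) (by omega) (by omega)
  have e3 := Exe.arith (o := .add) (d := 35) (a := 0) (b := 40) b2 (by omega)
    (by simp [Op.eval, hr]; omega)
  have b3 := b2.setReg (r := 35) (v := n + 2) (by omega) (by omega)
  simp [Op.eval, hr] at e3
  have e4 := Exe.arith (o := .add) (d := 39) (a := 35) (b := 33) b3 (by omega)
    (by simp [Op.eval]; omega)
  have b4 := b3.setReg (r := 39) (v := n + 2 + 1) (by omega) (by omega)
  simp [Op.eval] at e4
  have e5 := Exe.arith (o := .mul) (d := 36) (a := 0) (b := 0) b4 (by omega)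
    (by simp [Op.eval, hr]; omega)
  have b5 := b4.setReg (r := 36) (v := n * n) (by omega) (by omega)
  simp [Op.eval, hr] at e5
  have e6 := Exe.arith (o := .add) (d := 37) (a := 36) (b := 33) b5 (by omega)
    (by simp [Op.eval]; omega)
  have b6 := b5.setReg (r := 37) (v := n * n + 1) (by omega) (by omega)
  simp [Op.eval] at e6
  have e7 := Exe.const (d := 38) (c := 32) b6 (by omega) c32
  have b7 := b6.setReg (r := 38) (v := 32) (by omega) c32
  have e8 := Exe.arith (o := .mul) (d := 40) (a := 35) (b := 35) b7 (by omega)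
    (by simp [Op.eval, sq', q2])
  have b8 := b7.setReg (r := 40) (v := (n + 2) ^ 2) (by omega) q2
  simp [Op.eval, sq'] at e8
  have e9 := Exe.arith (o := .mul) (d := 40) (a := 40) (b := 40) b8 (by omega)
    (by simp only [setReg_reg, if_true, Op.eval, sq4]; exact q4)
  have b9 := b8.setReg (r := 40) (v := (n + 2) ^ 4) (by omega) q4
  simp only [Op.eval, setReg_reg, if_true, sq4] at e9
  have e10 := Exe.arith (o := .mul) (d := 40) (a := 40) (b := 40) b9 (by omega)
    (by simp only [setReg_reg, if_true, Op.eval, sq8]; exact q8)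
  have b10 := b9.setReg (r := 40) (v := (n + 2) ^ 8) (by omega) q8
  simp only [Op.eval, setReg_reg, if_true, sq8] at e10
  have e11 := Exe.const (d := 34) (c := 1) b10 (by omega) (by omega)
  have b11 := b10.setReg (r := 34) (v := 1) (by omega) (by omega)
  have e12 := Exe.arith (o := .add) (d := 41) (a := 35) (b := 32) b11 (by omega)
    (by simp [Op.eval, hr]; omega)
  have b12 := b11.setReg (r := 41) (v := n + 2) (by omega) (by omega)
  simp [Op.eval, hr] at e12
  let J : ℕ → State → Prop := fun i t => Bounded Γ.V 128 Γ.M t ∧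
    t.mem = (graphInput G k).mem ∧
    (∀ x < 33, t.reg x = if x = 0 then n else if x = 1 then min k n else 0) ∧ t.reg 33 = 1 ∧
    t.reg 34 = (n + 2) ^ (8 * i) ∧ t.reg 35 = n + 2 ∧ t.reg 36 = n * n ∧ t.reg 37 = n * n + 1 ∧
    t.reg 38 = 32 ∧ t.reg 39 = n + 2 + 1 ∧ t.reg 40 = (n + 2) ^ 8 ∧ t.reg 41 = n + 2 - i
  obtain ⟨s', e13, hb, hm', hx, h33, h34, h35, h36, h37, h38, h39, h40, h41⟩ :=
    Exe.loop (V := Γ.V) (R := 128) (M := Γ.M)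
    (p := .seq (.instr (.arith .mul 34 34 40)) (.instr (.arith .sub 41 41 33)))
    (a := 41) (c := 2) (L := n + 2) J (fun i t h => h.1) (fun i t h => h.2.2.2.2.2.2.2.2.2.2.2) (by
      rintro i hi t ⟨hb, hm, hx, h33, h34, h35, h36, h37, h38, h39, h40, h41⟩
      have k1 : Op.eval .mul (t.reg 34) (t.reg 40) = (n + 2) ^ (8 * (i + 1)) := by
        rw [h34, h40]; simp only [Op.eval]; rw [← pow_add, Nat.mul_succ]
      have k1' : (n + 2) ^ (8 * (i + 1)) ≤ Γ.V :=
        le_V (le16 (by omega))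
      have a1 := Exe.arith (o := .mul) (d := 34) (a := 34) (b := 40) hb (by omega)
        (by rw [k1]; exact k1')
      rw [k1] at a1
      have c1 := hb.setReg (r := 34) (by omega) k1'
      have k2 : Op.eval .sub ((t.setReg 34 ((n + 2) ^ (8 * (i + 1)))).reg 41)
          ((t.setReg 34 ((n + 2) ^ (8 * (i + 1)))).reg 33) = n + 2 - (i + 1) := by
        simp only [setReg_reg, Op.eval]
        rw [if_neg (by omega), if_neg (by omega), h41, h33]
        omega
      have k2' : n + 2 - (i + 1) ≤ Γ.V := by omega
      have a2 := Exe.arith (o := .sub) (d := 41) (a := 41) (b := 33) c1 (by omega)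
        (by rw [k2]; exact k2')
      rw [k2] at a2
      refine ⟨_, a1.seq a2, c1.setReg (by omega) k2', hm, ?_, ?_, ?_, ?_, ?_, ?_, ?_, ?_, ?_, ?_⟩
      · intro x hx'
        rw [setReg_reg, if_neg (by omega), setReg_reg, if_neg (by omega), hx x hx']
      all_goals simp [*])
    (s := _) ⟨b12, hm, by
      intro x hx
      simp only [setReg_reg, hr]
      rw [if_neg (by omega), if_neg (by omega), if_neg (by omega), if_neg (by omega),
        if_neg (by omega), if_neg (by omega), if_neg (by omega), if_neg (by omega),
        if_neg (by omega), if_neg (by omega), if_neg (by omega), if_neg (by omega)],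
      by simp, by simp, by simp, by simp, by simp, by simp, by simp, by simp, by simp⟩
  refine ⟨s', ((e1.seq (e2.seq (e3.seq (e4.seq (e5.seq (e6.seq (e7.seq (e8.seq (e9.seq
    (e10.seq (e11.seq (e12.seq e13)))))))))))).mono (by omega)), ?_⟩
  refine ⟨hb, fun x hx' => hx x (by omega), ?_, ?_, ?_, h33, h34.trans hcap.symm,
    h35.trans hΓW.symm, h36.trans (by rw [hΓn]), h37.trans (by rw [hΓn]), h38,
    h39.trans (by rw [hΓW]), ?_, ?_⟩
  · intro x _
    simp only [initEnv]
    split_ifs <;> omega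
  · intros
    exact Nat.zero_le _
  · rw [hx 32 (by omega)]; rfl
  · intro m _
    rw [hm', hinp]
  · intro a ha i j hi hj
    rw [hm']
    refine graphInput_mem_of_le G k ?_
    unfold Ctx.addr
    rw [hΓn]
    omega

end Init

end ArrayLang

namespace ArrayLang

open RAM

/-! ### Time and space of a program with one long loop -/

/-- Polynomially bounded functions. -/
def PolyBdd (f : ℕ → ℕ) : Prop := ∃ c d : ℕ, ∀ n, f n ≤ c * (n + 1) ^ d

theorem PolyBdd.const (a : ℕ) : PolyBdd fun _ => a := ⟨a, 0, fun n => by simp⟩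

theorem PolyBdd.id : PolyBdd fun n => n := ⟨1, 1, fun n => by simp⟩

theorem PolyBdd.add {f g : ℕ → ℕ} (hf : PolyBdd f) (hg : PolyBdd g) :
    PolyBdd fun n => f n + g n := by
  obtain ⟨c, d, hc⟩ := hf
  obtain ⟨c', d', hc'⟩ := hg
  refine ⟨c + c', d + d', fun n => ?_⟩
  have h1 : (n + 1) ^ d ≤ (n + 1) ^ (d + d') := Nat.pow_le_pow_right (by omega) (by omega)
  have h2 : (n + 1) ^ d' ≤ (n + 1) ^ (d + d') := Nat.pow_le_pow_right (by omega) (by omega)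
  calc f n + g n ≤ c * (n + 1) ^ d + c' * (n + 1) ^ d' := add_le_add (hc n) (hc' n)
    _ ≤ c * (n + 1) ^ (d + d') + c' * (n + 1) ^ (d + d') := by gcongr
    _ = _ := by ring

theorem PolyBdd.mul {f g : ℕ → ℕ} (hf : PolyBdd f) (hg : PolyBdd g) :
    PolyBdd fun n => f n * g n := by
  obtain ⟨c, d, hc⟩ := hf
  obtain ⟨c', d', hc'⟩ := hg
  refine ⟨c * c', d + d', fun n => ?_⟩
  calc f n * g n ≤ (c * (n + 1) ^ d) * (c' * (n + 1) ^ d') := Nat.mul_le_mul (hc n) (hc' n)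
    _ = _ := by ring

/-- The expression is fixed, so each nested sum multiplies the cost by a linear factor only. -/
theorem PolyBdd.exp_cost : ∀ e : Exp, PolyBdd fun n => e.cost (n + 2)
  | .lit _ => .const 1
  | .var _ => .const 1
  | .inp e => (exp_cost e).add (.const 3)
  | .arr _ e f => ((exp_cost e).add (exp_cost f)).add (.const 11)
  | .bin _ e f => ((exp_cost e).add (exp_cost f)).add (.const 3)
  | .ite c e f => (((exp_cost c).add (exp_cost e)).add (exp_cost f)).add (.const 1)
  | .sum _ l e => ((exp_cost l).add
      ((PolyBdd.id.add (.const 2)).mul ((exp_cost e).add (.const 6)))).add (.const 7)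

theorem PolyBdd.stmt_cost : ∀ s : Stmt, PolyBdd fun n => s.cost (n + 2)
  | .store _ e f g => (((exp_cost g).add (exp_cost e)).add (exp_cost f)).add (.const 11)
  | .seq s t => (stmt_cost s).add (stmt_cost t)
  | .for _ l s => ((exp_cost l).add
      ((PolyBdd.id.add (.const 2)).mul ((stmt_cost s).add (.const 4)))).add (.const 4)

/-- From `n + 2 < 2 ^ (n + 2)` the number `cap` has at most about `8 * (n + 2) ^ 2` bits, and `V`
about twice as many. -/
theorem len_V_le {n : ℕ} {Γ : Ctx} (hcap : Γ.cap = (n + 2) ^ (8 * (n + 2))) :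
    len Γ.V ≤ 16 * ((n + 2) * (n + 2)) + 2 := by
  have h1 : n + 2 < 2 ^ (n + 2) := Nat.lt_two_pow_self
  have h2 : Γ.cap ≤ 2 ^ (8 * ((n + 2) * (n + 2))) := by
    rw [hcap]
    calc (n + 2) ^ (8 * (n + 2)) ≤ (2 ^ (n + 2)) ^ (8 * (n + 2)) := Nat.pow_le_pow_left h1.le _
      _ = _ := by rw [← pow_mul]; congr 1; ring
  obtain ⟨e, he⟩ : ∃ e, e = 8 * ((n + 2) * (n + 2)) := ⟨_, rfl⟩
  rw [← he] at h2
  clear hcap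
  have h3 : Γ.V < 2 ^ (2 * e + 1) := by
    have h4 : Γ.cap * Γ.cap ≤ 2 ^ e * 2 ^ e := Nat.mul_le_mul h2 h2
    have h5 : 2 ^ e < 2 ^ e * 2 ^ e := by
      have h7 : e < 2 ^ e := Nat.lt_two_pow_self
      have h8 : 0 < (n + 2) * (n + 2) := Nat.mul_pos (by omega) (by omega)
      exact lt_mul_of_one_lt_right (by omega) (by omega)
    have h6 : 2 ^ (2 * e + 1) = 2 ^ e * 2 ^ e + 2 ^ e * 2 ^ e := by ring
    unfold Ctx.V
    omega
  have := Nat.size_le.mpr h3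
  unfold len
  omega

/-- Code for `pre`, then `body` for `x` below the value of `L`, then the computation of `ans`. -/
def mainCode (pre : Stmt) (L : Exp) (x : ℕ) (body : Stmt) (ans : Exp) : Prog :=
  .seq (pre.code 0) <| .seq (L.code 0) <| .seq (forCode x (body.code 2) 0) <|
    .seq (ans.code 0) (.instr (.arith .add 0 40 32))

/-- A `for` statement is clamped to `W` rounds, so the one exponentially long loop is compiled with
`forCode` directly. The number of rounds enters the cost through this loop alone. -/
theorem mainCode_spec {Γ : Ctx} (hΓ : Γ.Ok) {pre body : Stmt} {L ans : Exp} {x : ℕ}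
    (hpre : pre.wf 0 = true) (hL : L.wf 0 = true) (hx : x < 32) (hbody : body.wf 2 = true)
    (hans : ans.wf 0 = true) {σ : Env} {s : State} (hs : Rep Γ σ s) :
    ∃ s', Γ.Exe (mainCode pre L x body ans) s (pre.cost Γ.W + L.cost Γ.W +
        L.eval Γ (pre.exec Γ σ) * (body.cost Γ.W + 4) + ans.cost Γ.W + 3) s' ∧
      s'.reg 0 = ans.eval Γ
        (iter (body.exec Γ) x (pre.exec Γ σ) (L.eval Γ (pre.exec Γ σ))) := by
  obtain ⟨s1, e1, r1, -⟩ := pre.code_spec hΓ 0 σ s hpre hs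
  obtain ⟨s2, e2, f2, v2⟩ := L.code_spec hΓ 0 _ s1 hL r1
  obtain ⟨s3, e3, r3, -⟩ := forCode_spec hΓ (c := body.cost Γ.W) (d := 0) hx (by omega)
    (r1.eval_le hΓ hL) (fun σ s h => body.code_spec hΓ 2 σ s hbody h)
    (r1.frame f2 (by omega)) v2
  obtain ⟨s4, e4, f4, v4⟩ := ans.code_spec hΓ 0 _ s3 hans r3
  have r4 := r3.frame f4 (by omega)
  have hv : Op.eval .add (s4.reg 40) (s4.reg 32) = s4.reg 40 := by rw [r4.r32]; rfl
  have e5 := Exe.arith (o := .add) (d := 0) (a := 40) (b := 32) r4.bd (by omega)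
    (by rw [hv]; exact r4.bd.reg_le _)
  refine ⟨_, (e1.seq (e2.seq (e3.seq (e4.seq e5)))).mono (by omega), ?_⟩
  rw [hv]
  simp only [setReg_reg, if_true]
  exact v4

theorem len_max_le (V k : ℕ) : len (max V k) ≤ len V + Nat.size k := by
  unfold len
  rcases le_total V k with h | h
  · rw [max_eq_right h]; omega
  · rw [max_eq_left h]; omega

/-- The cost outside the loop, the cost of a round and the length of all numbers are polynomial in
`n`, so the time is a polynomial times the number of rounds plus one. The term `12 * Nat.size k`
comes from the three instructions of `capCode`, each charged four lengths. -/
theorem exists_prog (pre body : Stmt) (L ans : Exp) (x : ℕ)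
    (hpre : pre.wf 0 = true) (hL : L.wf 0 = true) (hx : x < 32) (hbody : body.wf 2 = true)
    (hans : ans.wf 0 = true) :
    ∃ (P : Prog) (c d : ℕ), ∀ (n k : ℕ) (G : SimpleGraph (Fin n)), ∃ (t m : ℕ) (s : State),
      Runs P (graphInput G k) t m s ∧
      s.reg 0 = ans.eval (ctx G k) (iter (body.exec (ctx G k)) x
        (pre.exec (ctx G k) (initEnv n k))
        (L.eval (ctx G k) (pre.exec (ctx G k) (initEnv n k)))) ∧
      t ≤ c * (n + 1) ^ d * (L.eval (ctx G k) (pre.exec (ctx G k) (initEnv n k)) + 1) +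
        12 * Nat.size k ∧
      m ≤ c * (n + Nat.size k + 1) ^ d := by
  obtain ⟨ct, dt, ht⟩ : PolyBdd fun n => (3 * n + 30 + pre.cost (n + 2) + L.cost (n + 2) +
      ans.cost (n + 2) + (body.cost (n + 2) + 4)) * (4 * (16 * ((n + 2) * (n + 2)) + 2)) := by
    refine PolyBdd.mul ?_ ?_
    · exact ((((((PolyBdd.const 3).mul .id).add (.const 30)).add (.stmt_cost _)).add
        (.exp_cost _)).add (.exp_cost _)).add ((PolyBdd.stmt_cost _).add (.const 4))
    · exact (PolyBdd.const 4).mul (((PolyBdd.const 16).mul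
        ((PolyBdd.id.add (.const 2)).mul (PolyBdd.id.add (.const 2)))).add (.const 2))
  obtain ⟨cm, dm, hm⟩ : PolyBdd fun n => 128 * (16 * ((n + 2) * (n + 2)) + 2 + n) +
      (n * n + 1 + 32 * ((n + 3) * (n + 3))) *
        ((n * n + 1 + 32 * ((n + 3) * (n + 3)) + 1) + (16 * ((n + 2) * (n + 2)) + 2 + n)) := by
    have h1 : PolyBdd fun n => 16 * ((n + 2) * (n + 2)) + 2 + n :=
      (((PolyBdd.const 16).mul ((PolyBdd.id.add (.const 2)).mul
        (PolyBdd.id.add (.const 2)))).add (.const 2)).add .id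
    have h2 : PolyBdd fun n => n * n + 1 + 32 * ((n + 3) * (n + 3)) :=
      ((PolyBdd.id.mul .id).add (.const 1)).add ((PolyBdd.const 32).mul
        ((PolyBdd.id.add (.const 3)).mul (PolyBdd.id.add (.const 3))))
    exact ((PolyBdd.const 128).mul h1).add (h2.mul ((h2.add (.const 1)).add h1))
  refine ⟨.seq capCode (.seq initCode (mainCode pre L x body ans)), ct + cm, dt + dm,
    fun n k G => ?_⟩
  have hok := ctx_ok G k
  have hn := n_le_cap G k
  have h1cap : 1 ≤ (ctx G k).cap := (by decide : 1 ≤ 4).trans hok.four_le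
  have hlen : len (ctx G k).V ≤ 16 * ((n + 2) * (n + 2)) + 2 := len_V_le rfl
  have hW : (ctx G k).W = n + 2 := rfl
  have hM : (ctx G k).M = n * n + 1 + 32 * ((n + 3) * (n + 3)) := rfl
  obtain ⟨s0, ⟨t0, m0, run0, ht0, hm0⟩, b0, mem0, reg0⟩ :=
    capCode_spec G k (V := (ctx G k).V) (M := (ctx G k).M) (le_V hn) (le_V h1cap) (by rw [hM]; omega)
  obtain ⟨s1, e1, r1⟩ := initCode_spec G k (Γ := ctx G k) rfl rfl rfl (fun _ => rfl) b0 mem0 reg0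
  obtain ⟨s2, e2, v2⟩ := mainCode_spec hok hpre hL hx hbody hans r1
  obtain ⟨t1, m1, run1, ht1, hm1⟩ := e1.seq e2
  generalize (L.eval (ctx G k) (pre.exec (ctx G k) (initEnv n k))) = Lv at *
  refine ⟨_, _, s2, .seq run0 run1, v2, ?_, ?_⟩
  · have hmax := len_max_le (ctx G k).V k
    rw [hW] at ht1
    have key : t0 + t1 ≤ (3 * n + 30 + pre.cost (n + 2) + L.cost (n + 2) +
      ans.cost (n + 2) + (body.cost (n + 2) + 4)) * (4 * (16 * ((n + 2) * (n + 2)) + 2)) *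
        (Lv + 1) + 12 * Nat.size k := by
      set a := 3 * n + 30 + pre.cost (n + 2) + L.cost (n + 2) + ans.cost (n + 2) with ha
      set b := body.cost (n + 2) + 4
      set l := 16 * ((n + 2) * (n + 2)) + 2
      -- Initialization and the code outside the loop take `3 * n + 22` instructions plus the costs
      -- of `pre`, `L` and `ans`, which is `a - 8`; the slack pays for the three instructions of
      -- `capCode`.
      have h1 : t1 ≤ (a - 8 + Lv * b) * (4 * l) :=
        ht1.trans (Nat.mul_le_mul (by omega) (by omega))
      have h2 : t0 ≤ 3 * (4 * l) + 12 * Nat.size k := by omega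
      have h3 : (3 + (a - 8 + Lv * b)) * (4 * l) ≤ ((a + b) * (Lv + 1)) * (4 * l) := by
        refine Nat.mul_le_mul_right _ ?_
        have : a * (Lv + 1) = a * Lv + a := by ring
        have : b * (Lv + 1) = Lv * b + b := by ring
        have : (a + b) * (Lv + 1) = a * (Lv + 1) + b * (Lv + 1) := by ring
        omega
      calc t0 + t1 ≤ (3 + (a - 8 + Lv * b)) * (4 * l) + 12 * Nat.size k := by
            rw [add_mul]; omega
        _ ≤ ((a + b) * (Lv + 1)) * (4 * l) + 12 * Nat.size k := by omega
        _ = _ := by ring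
    refine key.trans (Nat.add_le_add_right (Nat.mul_le_mul_right _ ((ht n).trans ?_)) _)
    exact Nat.mul_le_mul (by omega) (Nat.pow_le_pow_right (by omega) (by omega))
  · have hmono : spaceBound (ctx G k).V 128 (ctx G k).M ≤
        spaceBound (max (ctx G k).V k) 128 (ctx G k).M := by
      unfold spaceBound
      have := len_mono (le_max_left (ctx G k).V k)
      gcongr
    refine (max_le hm0 (hm1.trans hmono)).trans ?_
    have hmax := len_max_le (ctx G k).V k
    set N := n + Nat.size k with hN
    have hl : len (max (ctx G k).V k) ≤ 16 * ((N + 2) * (N + 2)) + 2 + N := by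
      have : (n + 2) * (n + 2) ≤ (N + 2) * (N + 2) := Nat.mul_le_mul (by omega) (by omega)
      omega
    have hM' : (ctx G k).M ≤ N * N + 1 + 32 * ((N + 3) * (N + 3)) := by
      rw [hM]
      have h1 : (n + 3) * (n + 3) ≤ (N + 3) * (N + 3) := Nat.mul_le_mul (by omega) (by omega)
      have h2 : n * n ≤ N * N := Nat.mul_le_mul (by omega) (by omega)
      omega
    have hlM : len (ctx G k).M ≤ N * N + 1 + 32 * ((N + 3) * (N + 3)) + 1 := by
      have : (ctx G k).M < 2 ^ (ctx G k).M := Nat.lt_two_pow_self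
      have := Nat.size_le.mpr this
      unfold len; omega
    calc spaceBound (max (ctx G k).V k) 128 (ctx G k).M ≤ _ := by
          unfold spaceBound
          exact Nat.add_le_add (Nat.mul_le_mul_left _ hl)
            (Nat.mul_le_mul hM' (Nat.add_le_add hlM hl))
      _ ≤ cm * (N + 1) ^ dm := hm N
      _ ≤ (ct + cm) * (N + 1) ^ (dt + dm) :=
          Nat.mul_le_mul (by omega) (Nat.pow_le_pow_right (by omega) (by omega))

end ArrayLang

namespace ConnectedCover

open Finset

/-! ### Connected sets and component labels -/

/-- `U` is connected for the relation `r`: a nonempty part of `U` closed under `r` is `U`. -/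
def Conn (r : ℕ → ℕ → Prop) (U : Finset ℕ) : Prop :=
  ∀ p : ℕ → Prop, (∃ a ∈ U, p a) → (∀ a ∈ U, p a → ∀ b ∈ U, r a b → p b) → ∀ a ∈ U, p a

open Classical in
/-- Labels of the components of the subgraph induced by the vertices `i < t` with `inn i`: when a
vertex is added, the components it touches are merged and get its name as their label. -/
noncomputable def lab (r : ℕ → ℕ → Prop) (inn : ℕ → Prop) : ℕ → ℕ → ℕ
  | 0, i => i
  | t + 1, i =>
    if inn t ∧ (i = t ∨ ∃ j < t, inn j ∧ r t j ∧ lab r inn t j = lab r inn t i) then t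
    else lab r inn t i

section Lab

variable {r : ℕ → ℕ → Prop} {inn : ℕ → Prop}

theorem lab_of_le : ∀ {t i : ℕ}, (∀ s ≤ t, ∀ j < s, inn j → lab r inn s j < s) → t ≤ i →
    lab r inn t i = i
  | 0, _, _, _ => rfl
  | t + 1, i, h, hi => by
    have ih : lab r inn t i = i := lab_of_le (fun s hs => h s (by omega)) (by omega)
    rw [lab, if_neg, ih]
    rintro ⟨-, h1 | ⟨j, hj, hj', -, h2⟩⟩
    · omega
    · have := h t (by omega) j hj hj'
      omega

theorem lab_lt : ∀ t, ∀ j < t, inn j → lab r inn t j < t := by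
  intro t
  induction t with
  | zero => intro j hj; omega
  | succ t ih =>
    intro j hj hin
    rw [lab]
    split_ifs with h
    · omega
    · have : j ≠ t := by
        rintro rfl
        exact h ⟨hin, .inl rfl⟩
      have := ih j (by omega) hin
      omega

theorem lab_eq_self {t i : ℕ} (h : t ≤ i) : lab r inn t i = i :=
  lab_of_le (fun s _ => lab_lt s) h

theorem lab_inn {t i : ℕ} (h : inn i) : inn (lab r inn t i) := by
  induction t with
  | zero => exact h
  | succ t ih =>
    rw [lab]
    split_ifs with h'
    · exact h'.1
    · exact ih

/-- A label names a vertex of its own class, so the components can be counted as fixed points of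
`lab`. -/
theorem lab_lab {t i : ℕ} (h : inn i) : lab r inn t (lab r inn t i) = lab r inn t i := by
  induction t generalizing i with
  | zero => rfl
  | succ t ih =>
    by_cases h' : inn t ∧ (i = t ∨ ∃ j < t, inn j ∧ r t j ∧ lab r inn t j = lab r inn t i)
    · have e : lab r inn (t + 1) i = t := by rw [lab, if_pos h']
      rw [e, lab, if_pos ⟨h'.1, .inl rfl⟩]
    · have e : lab r inn (t + 1) i = lab r inn t i := by rw [lab, if_neg h']
      rw [e, lab, ih h]
      split_ifs with h2
      · exfalso
        rcases h2.2 with h3 | h3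
        · by_cases hi : i < t
          · have := lab_lt (r := r) t i hi h
            omega
          · have := lab_eq_self (r := r) (inn := inn) (le_of_not_gt hi)
            exact h' ⟨h2.1, .inl (by omega)⟩
        · exact h' ⟨h2.1, .inr h3⟩
      · rfl

/-- The two labels become equal when the later of `u` and `v` is added, and later steps treat equal
labels alike. -/
theorem lab_adj (hr : ∀ i j, r i j → r j i) (hirr : ∀ i, ¬ r i i) {t u v : ℕ} (hu : u < t)
    (hv : v < t) (iu : inn u) (iv : inn v) (h : r u v) : lab r inn t u = lab r inn t v := by
  induction t with
  | zero => omega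
  | succ t ih =>
    have key : ∀ {u v : ℕ}, u = t → v < t → inn u → inn v → r u v →
        lab r inn (t + 1) u = lab r inn (t + 1) v := by
      rintro u v rfl hv iu iv h
      rw [lab, if_pos ⟨iu, .inl rfl⟩, lab, if_pos ⟨iu, .inr ⟨v, hv, iv, h, rfl⟩⟩]
    rcases Nat.lt_succ_iff_lt_or_eq.mp hu with hu | hu
    · rcases Nat.lt_succ_iff_lt_or_eq.mp hv with hv | hv
      · have := ih hu hv
        rw [lab, lab, this]
        have e : (u = t ∨ ∃ j < t, inn j ∧ r t j ∧ lab r inn t j = lab r inn t v) ↔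
            (v = t ∨ ∃ j < t, inn j ∧ r t j ∧ lab r inn t j = lab r inn t v) := by
          constructor <;> rintro (h | h)
          · omega
          · exact .inr h
          · omega
          · exact .inr h
        classical
        exact if_congr (and_congr_right fun _ => e) rfl rfl
      · exact (key hv hu iv iu (hr _ _ h)).symm
    · rcases Nat.lt_succ_iff_lt_or_eq.mp hv with hv | hv
      · exact key hu hv iu iv h
      · subst hu hv
        exact absurd h (hirr _)

/-- A closed property is constant on labelled components. -/
theorem lab_closed (hr : ∀ i j, r i j → r j i) {p : ℕ → Prop}
    (hp : ∀ a b, inn a → inn b → r a b → p a → p b) {t u : ℕ} (iu : inn u) :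
    p (lab r inn t u) ↔ p u := by
  induction t generalizing u with
  | zero => rfl
  | succ t ih =>
    rw [lab]
    split_ifs with h
    · obtain ⟨it, rfl | ⟨j, hj, ij, h1, h2⟩⟩ := h
      · rfl
      · rw [← ih iu, ← h2, ih ij]
        exact ⟨hp _ _ it ij h1, hp _ _ ij it (hr _ _ h1)⟩
    · exact ih iu

end Lab

/-! ### Branching walks -/

section Walks

variable (H : ℕ → ℕ → Prop) (n : ℕ)

open Classical in
/-- The number of branching walks with `j` nodes rooted at `a`, for the relation `H`, with nodes in
`O`. -/
noncomputable def bw (O : ℕ → Prop) (j a : ℕ) : ℕ :=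
  if j = 0 then 0 else if ¬ O a then 0 else if j = 1 then 1 else
    ∑ i : Fin (j - 1), bw O (i + 1) a * ∑ a' ∈ range n, if H a a' then bw O (j - 1 - i) a' else 0
termination_by j
decreasing_by
  all_goals omega

open Classical in
/-- The number of branching walks with `j` nodes rooted at `a`, whose set of nodes is `Y`. -/
noncomputable def cw (j a : ℕ) (Y : Finset ℕ) : ℕ :=
  if j = 0 then 0 else if j = 1 then (if Y = {a} then 1 else 0) else
    ∑ i : Fin (j - 1), ∑ a' ∈ range n, if H a a' then
      ∑ p ∈ (Y.powerset ×ˢ Y.powerset) with p.1 ∪ p.2 = Y,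
        cw (i + 1) a p.1 * cw (j - 1 - i) a' p.2 else 0
termination_by j
decreasing_by
  all_goals omega

variable {H n}

theorem cw_pos_iff {j a : ℕ} {Y : Finset ℕ} (hj : 2 ≤ j) : 0 < cw H n j a Y ↔
    ∃ i < j - 1, ∃ a' < n, H a a' ∧ ∃ Y₁ Y₂, Y₁ ∪ Y₂ = Y ∧ 0 < cw H n (i + 1) a Y₁ ∧
      0 < cw H n (j - 1 - i) a' Y₂ := by
  classical
  rw [cw, if_neg (by omega), if_neg (by omega), Finset.sum_pos_iff]
  constructor
  · rintro ⟨i, -, h⟩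
    rw [Finset.sum_pos_iff] at h
    obtain ⟨a', ha', h⟩ := h
    split_ifs at h with hH
    · rw [Finset.sum_pos_iff] at h
      obtain ⟨p, hp, h⟩ := h
      rw [mem_filter] at hp
      exact ⟨i, i.2, a', mem_range.mp ha', hH, p.1, p.2, hp.2, Nat.pos_of_mul_pos_right h,
        Nat.pos_of_mul_pos_left h⟩
    · omega
  · rintro ⟨i, hi, a', ha', hH, Y₁, Y₂, hY, h1, h2⟩
    refine ⟨⟨i, hi⟩, mem_univ _, ?_⟩
    rw [Finset.sum_pos_iff]
    refine ⟨a', mem_range.mpr ha', ?_⟩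
    rw [if_pos hH, Finset.sum_pos_iff]
    refine ⟨(Y₁, Y₂), ?_, Nat.mul_pos h1 h2⟩
    rw [mem_filter, mem_product, mem_powerset, mem_powerset]
    exact ⟨⟨hY ▸ subset_union_left, hY ▸ subset_union_right⟩, hY⟩

theorem cw_one {a : ℕ} {Y : Finset ℕ} : 0 < cw H n 1 a Y ↔ Y = {a} := by
  classical
  rw [cw]
  by_cases h : Y = {a} <;> simp [h]

theorem cw_zero {a : ℕ} {Y : Finset ℕ} : cw H n 0 a Y = 0 := by
  rw [cw]; simp

/-- A branching walk with at least two nodes consists of two smaller ones whose roots are joined by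
an edge, so connectedness passes to the union of the node sets. Nodes may repeat, hence only `#Y ≤
j`. -/
theorem cw_sound (hH : ∀ a b, H a b → H b a) {j : ℕ} : ∀ {a : ℕ} {Y : Finset ℕ},
    0 < cw H n j a Y → a ∈ Y ∧ #Y ≤ j ∧ Conn H Y := by
  induction j using Nat.strong_induction_on with
  | _ j ih =>
    intro a Y h
    rcases Nat.lt_or_ge j 2 with hj | hj
    · interval_cases j
      · rw [cw_zero] at h; omega
      · rw [cw_one] at h
        subst h
        refine ⟨mem_singleton_self _, by simp, ?_⟩
        rintro p ⟨b, hb, hp⟩ - c hc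
        rw [mem_singleton] at hb hc
        rwa [hc, ← hb]
    · obtain ⟨i, hi, a', ha', haa, Y₁, Y₂, rfl, h1, h2⟩ := (cw_pos_iff hj).mp h
      obtain ⟨m1, c1, k1⟩ := ih _ (by omega) h1
      obtain ⟨m2, c2, k2⟩ := ih _ (by omega) h2
      refine ⟨mem_union_left _ m1, (card_union_le _ _).trans (by omega), ?_⟩
      rintro p ⟨b, hb, hp⟩ hcl
      have p1 : (∃ b ∈ Y₁, p b) → ∀ b ∈ Y₁, p b := fun he => k1 p he fun x hx hpx y hy hxy =>
        hcl x (mem_union_left _ hx) hpx y (mem_union_left _ hy) hxy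
      have p2 : (∃ b ∈ Y₂, p b) → ∀ b ∈ Y₂, p b := fun he => k2 p he fun x hx hpx y hy hxy =>
        hcl x (mem_union_right _ hx) hpx y (mem_union_right _ hy) hxy
      have hpa : p a ↔ p a' :=
        ⟨fun h => hcl a (mem_union_left _ m1) h a' (mem_union_right _ m2) haa,
          fun h => hcl a' (mem_union_right _ m2) h a (mem_union_left _ m1) (hH _ _ haa)⟩
      have hboth : (∀ b ∈ Y₁, p b) ∧ ∀ b ∈ Y₂, p b := by
        rcases mem_union.mp hb with hb | hb
        · have := p1 ⟨b, hb, hp⟩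
          exact ⟨this, p2 ⟨a', m2, hpa.mp (this a m1)⟩⟩
        · have := p2 ⟨b, hb, hp⟩
          exact ⟨p1 ⟨a, m1, hpa.mpr (this a' m2)⟩, this⟩
      intro c hc
      rcases mem_union.mp hc with hc | hc
      · exact hboth.1 c hc
      · exact hboth.2 c hc

/-- A new node is hung below `y`, in whichever of the two parts of the walk contains `y`. -/
theorem cw_insert {j : ℕ} : ∀ {a : ℕ} {Y : Finset ℕ} {y v : ℕ}, 0 < cw H n j a Y → y ∈ Y →
    H y v → v < n → 0 < cw H n (j + 1) a (insert v Y) := by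
  induction j using Nat.strong_induction_on with
  | _ j ih =>
    intro a Y y v h hy hyv hv
    rcases Nat.lt_or_ge j 2 with hj | hj
    · interval_cases j
      · rw [cw_zero] at h; omega
      · rw [cw_one] at h
        subst h
        rw [mem_singleton] at hy
        subst hy
        refine (cw_pos_iff (by omega)).mpr ⟨0, by omega, v, hv, hyv, {y}, {v}, ?_, ?_, ?_⟩
        · ext x; simp [or_comm]
        · exact cw_one.mpr rfl
        · exact cw_one.mpr rfl
    · obtain ⟨i, hi, a', ha', haa, Y₁, Y₂, rfl, h1, h2⟩ := (cw_pos_iff hj).mp h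
      rcases mem_union.mp hy with hy | hy
      · have := ih _ (by omega) h1 hy hyv hv
        refine (cw_pos_iff (by omega)).mpr ⟨i + 1, by omega, a', ha', haa, insert v Y₁, Y₂, ?_,
          this, ?_⟩
        · rw [insert_union]
        · rwa [show j + 1 - 1 - (i + 1) = j - 1 - i by omega]
      · have := ih _ (by omega) h2 hy hyv hv
        refine (cw_pos_iff (by omega)).mpr ⟨i, by omega, a', ha', haa, Y₁, insert v Y₂, ?_,
          h1, ?_⟩
        · rw [union_insert]
        · rwa [show j + 1 - 1 - i = j - 1 - i + 1 by omega]

/-- Starting from `{a}` the walk grows by one vertex at a time: as long as the visited set is not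
all of `Y`, connectedness supplies an edge leaving it. -/
theorem cw_complete {Y : Finset ℕ} {a : ℕ} (ha : a ∈ Y) (hY : ∀ y ∈ Y, y < n)
    (hc : Conn H Y) : 0 < cw H n #Y a Y := by
  have key : ∀ m, 1 ≤ m → m ≤ #Y → ∃ S ⊆ Y, a ∈ S ∧ #S = m ∧ 0 < cw H n m a S := by
    intro m hm
    induction m, hm using Nat.le_induction with
    | base => exact fun _ => ⟨{a}, by simpa using ha, by simp, by simp, cw_one.mpr rfl⟩
    | succ m hm ih =>
      intro hm'
      obtain ⟨S, hS, haS, hcS, h⟩ := ih (by omega)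
      have : ∃ y ∈ S, ∃ v ∈ Y, v ∉ S ∧ H y v := by
        by_contra hcon
        push Not at hcon
        have hall := hc (· ∈ S) ⟨a, ha, haS⟩ fun x _ hxS y hy hxy => by
          by_contra hyS
          exact hcon x hxS y hy hyS hxy
        have : #Y ≤ #S := card_le_card hall
        omega
      obtain ⟨y, hyS, v, hvY, hvS, hyv⟩ := this
      refine ⟨insert v S, insert_subset hvY hS, mem_insert_of_mem haS, ?_,
        cw_insert h hyS hyv (hY v hvY)⟩
      rw [card_insert_of_notMem hvS, hcS]
  obtain ⟨S, hS, -, hcS, h⟩ := key #Y (card_pos.mpr ⟨a, ha⟩) le_rfl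
  rwa [eq_of_subset_of_card_le hS hcS.ge] at h

theorem mem_of_cw_ne_zero {j : ℕ} : ∀ {a : ℕ} {Y : Finset ℕ}, cw H n j a Y ≠ 0 → a ∈ Y := by
  induction j using Nat.strong_induction_on with
  | _ j ih =>
    intro a Y h
    rcases Nat.lt_or_ge j 2 with hj | hj
    · interval_cases j
      · exact absurd cw_zero h
      · rw [← Nat.pos_iff_ne_zero, cw_one] at h
        simp [h]
    · obtain ⟨i, hi, a', ha', haa, Y₁, Y₂, rfl, h1, h2⟩ := (cw_pos_iff hj).mp (Nat.pos_of_ne_zero h)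
      exact mem_union_left _ (ih _ (by omega) h1.ne')

-- Sorting the walks by their node sets. The recursion for `bw` never mentions node sets and is
-- therefore cheap, whereas the right hand side is what inclusion and exclusion acts on. Pairs of
-- subsets of `S` are grouped by their union.
open Classical in
theorem bw_eq_sum (O : ℕ → Prop) (S : Finset ℕ) (hS : ∀ a, a ∈ S ↔ O a) {j : ℕ} : ∀ {a : ℕ},
    bw H n O j a = ∑ Y ∈ S.powerset, cw H n j a Y := by
  induction j using Nat.strong_induction_on with
  | _ j ih =>
    intro a
    by_cases hj0 : j = 0
    · subst hj0
      rw [bw, if_pos rfl]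
      exact (sum_eq_zero fun Y _ => cw_zero).symm
    by_cases hOa : O a
    · rw [bw, if_neg hj0, if_neg (not_not.mpr hOa)]
      by_cases hj1 : j = 1
      · subst hj1
        have : ∀ Y ∈ S.powerset, cw H n 1 a Y = if Y = {a} then 1 else 0 := by
          intro Y _
          rw [cw]; simp
        rw [if_pos rfl, sum_congr rfl this, sum_ite_eq', if_pos]
        rw [mem_powerset, singleton_subset_iff, hS]
        exact hOa
      · rw [if_neg hj1]
        have e : ∀ Y ∈ S.powerset, cw H n j a Y = ∑ i : Fin (j - 1), ∑ a' ∈ range n, if H a a' then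
            ∑ p ∈ (S.powerset ×ˢ S.powerset) with p.1 ∪ p.2 = Y,
              cw H n (i + 1) a p.1 * cw H n (j - 1 - i) a' p.2 else 0 := by
          intro Y hY
          rw [mem_powerset] at hY
          rw [cw, if_neg hj0, if_neg hj1]
          have : ((Y.powerset ×ˢ Y.powerset).filter fun p : Finset ℕ × Finset ℕ => p.1 ∪ p.2 = Y) =
              (S.powerset ×ˢ S.powerset).filter fun p => p.1 ∪ p.2 = Y := by
            ext p
            simp only [mem_filter, mem_product, mem_powerset]
            constructor
            · rintro ⟨⟨h1, h2⟩, h3⟩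
              exact ⟨⟨h1.trans hY, h2.trans hY⟩, h3⟩
            · rintro ⟨-, h3⟩
              exact ⟨⟨h3 ▸ subset_union_left, h3 ▸ subset_union_right⟩, h3⟩
          rw [this]
        rw [sum_congr rfl e, sum_comm]
        refine sum_congr rfl fun i _ => ?_
        rw [sum_comm, mul_sum]
        refine sum_congr rfl fun a' _ => ?_
        by_cases hH : H a a'
        · simp only [if_pos hH]
          rw [ih _ (by omega), ih _ (by omega), sum_mul_sum, ← sum_product']
          refine (sum_fiberwise_of_maps_to (fun p hp => ?_) _).symm
          rw [mem_product, mem_powerset, mem_powerset] at hp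
          exact mem_powerset.mpr (union_subset hp.1 hp.2)
        · simp [hH]
    · rw [bw, if_neg hj0, if_pos hOa]
      symm
      refine sum_eq_zero fun Y hY => ?_
      by_contra h
      exact hOa ((hS a).mp (mem_powerset.mp hY (mem_of_cw_ne_zero h)))

/-- A crude bound for the number of branching walks. -/
theorem bw_le (O : ℕ → Prop) {A : ℕ} {j : ℕ} : ∀ {a : ℕ}, j * n ≤ A → 1 ≤ A →
    bw H n O j a ≤ A ^ (2 * j) / A := by
  induction j using Nat.strong_induction_on with
  | _ j ih =>
    intro a hA hA1
    -- For positive `j` the bound is `A ^ (2 * j - 1)`. The exponents for the two parts of a walk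
    -- add up to `2 * j - 2`, and the missing factor `A` pays for the choice of the split and of the
    -- second root, as `j * n ≤ A`.
    have hpow : ∀ m, A ^ (2 * (m + 1)) / A = A ^ (2 * m + 1) := fun m => by
      rw [show 2 * (m + 1) = 2 * m + 1 + 1 by ring, pow_succ, Nat.mul_div_cancel _ hA1]
    rw [bw]
    split_ifs with h0 hO h1
    · exact Nat.zero_le _
    · subst h1
      rw [hpow 0]; simpa using hA1
    · obtain ⟨m, rfl⟩ : ∃ m, j = m + 2 := ⟨j - 2, by omega⟩
      have hterm : ∀ i : Fin (m + 2 - 1), bw H n O (i + 1) a *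
          ∑ a' ∈ range n, (open Classical in if H a a' then bw H n O (m + 2 - 1 - i) a' else 0) ≤
          n * A ^ (2 * m + 2) := by
        intro i
        have hi := i.2
        have b1 : bw H n O (i + 1) a ≤ A ^ (2 * (i : ℕ) + 1) := by
          rw [← hpow]
          exact ih _ (by omega) ((Nat.mul_le_mul_right n (by omega)).trans hA) hA1
        have b2 : ∀ a', bw H n O (m + 2 - 1 - i) a' ≤ A ^ (2 * (m - i) + 1) := by
          intro a'
          rw [← hpow, show m + 2 - 1 - (i : ℕ) = m - i + 1 by omega]
          exact ih _ (by omega) ((Nat.mul_le_mul_right n (by omega)).trans hA) hA1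
        calc _ ≤ A ^ (2 * (i : ℕ) + 1) * ∑ a' ∈ range n, A ^ (2 * (m - i) + 1) := by
              refine Nat.mul_le_mul b1 (sum_le_sum fun a' _ => ?_)
              split_ifs
              · exact b2 a'
              · exact Nat.zero_le _
          _ = n * (A ^ (2 * (i : ℕ) + 1) * A ^ (2 * (m - i) + 1)) := by
              rw [sum_const, card_range, smul_eq_mul]; ring
          _ = n * A ^ (2 * m + 2) := by
              rw [← pow_add]; congr 2; omega
      rw [hpow]
      calc _ ≤ ∑ i : Fin (m + 2 - 1), n * A ^ (2 * m + 2) := sum_le_sum fun i _ => hterm i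
        _ = (m + 1) * n * A ^ (2 * m + 2) := by
            rw [sum_const, card_univ, Fintype.card_fin, smul_eq_mul]; rw [← mul_assoc]; congr 1
        _ ≤ A * A ^ (2 * m + 2) :=
            Nat.mul_le_mul_right _ ((Nat.mul_le_mul_right n (by omega)).trans hA)
        _ = A ^ (2 * (m + 1) + 1) := by ring
    · exact Nat.zero_le _

end Walks

end ConnectedCover

namespace ConnectedCover

open Finset

/-! ### Ordered graphs and the enumeration of colourings -/

open Classical in
/-- The first `u < n` with `P u`, and `n` if there is none. -/
noncomputable def firstIdx (n : ℕ) (P : ℕ → Prop) : ℕ :=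
  ∑ u ∈ range n, if ∃ w < u + 1, P w then 0 else 1

/-- The sum counts the `u` before the first success, that is, `u < a`. Minimization is written as a
sum because the array language has sums as its only form of search. -/
theorem firstIdx_of_min {n a : ℕ} {P : ℕ → Prop} (ha : a < n) (hP : P a) (hmin : ∀ b < a, ¬ P b) :
    firstIdx n P = a := by
  classical
  have : ∀ u ∈ range n, (if ∃ w < u + 1, P w then 0 else 1) = if u < a then 1 else 0 := by
    intro u _
    by_cases hu : u < a
    · rw [if_pos hu, if_neg]
      rintro ⟨w, hw, h⟩
      exact hmin w (by omega) h
    · rw [if_neg hu, if_pos ⟨a, by omega, hP⟩]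
  rw [firstIdx, sum_congr rfl this, sum_ite, sum_const_zero, add_zero, sum_const, smul_eq_mul,
    mul_one, show (range n).filter (· < a) = range a by ext; simp; omega, card_range]

theorem firstIdx_spec {n : ℕ} {P : ℕ → Prop} (h : ∃ u < n, P u) :
    firstIdx n P < n ∧ P (firstIdx n P) ∧ ∀ b < firstIdx n P, ¬ P b := by
  classical
  have h' : ∃ u, P u := h.imp fun _ h => h.2
  have hlt : Nat.find h' < n := by
    obtain ⟨u, hu, hP⟩ := h
    exact (Nat.find_min' h' hP).trans_lt hu
  rw [firstIdx_of_min hlt (Nat.find_spec h') fun b hb => Nat.find_min h' hb]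
  exact ⟨hlt, Nat.find_spec h', fun b hb => Nat.find_min h' hb⟩

theorem firstIdx_eq {n : ℕ} {P : ℕ → Prop} (h : ¬ ∃ u < n, P u) : firstIdx n P = n := by
  classical
  rw [firstIdx, sum_congr rfl fun u hu => if_neg ?_]
  · simp
  · rintro ⟨w, hw, hP⟩
    exact h ⟨w, by have := mem_range.mp hu; omega, hP⟩

theorem firstIdx_le {n : ℕ} {P : ℕ → Prop} : firstIdx n P ≤ n := by
  by_cases h : ∃ u < n, P u
  · exact (firstIdx_spec h).1.le
  · exact (firstIdx_eq h).le

/-- A graph with vertices `0, …, N - 1`, where `N ≤ n`. -/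
structure Ord where
  n : ℕ
  N : ℕ
  r : ℕ → ℕ → Prop

namespace Ord

variable (D : Ord)

/-- The graph is ordered as in a depth first search: every vertex but the first has an earlier
neighbour, and a vertex with a later neighbour is adjacent to the next vertex. -/
structure Ok : Prop where
  symm : ∀ i j, D.r i j → D.r j i
  irrefl : ∀ i, ¬ D.r i i
  lt : ∀ i j, D.r i j → i < D.N
  N_le : D.N ≤ D.n
  two_le : 2 ≤ D.N
  prev : ∀ i < D.N, 0 < i → ∃ j < i, D.r i j
  next : ∀ i j, i < j → D.r i j → D.r i (i + 1)

/-- A vertex without later neighbours. -/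
def leaf (i : ℕ) : Prop := ¬ ∃ j < D.n, i < j ∧ D.r i j

/-- The first neighbour. -/
noncomputable def par (i : ℕ) : ℕ := firstIdx D.n (D.r i)

open Classical in
/-- The number of leaves. -/
noncomputable def leaves : ℕ := ∑ i ∈ range D.n, if i < D.N ∧ D.leaf i then 1 else 0

/-- There are many leaves. -/
def Many : Prop := D.N ≤ 4 * D.leaves

open Classical in
/-- The number of digit strings for the last `t` vertices. -/
noncomputable def cnt : ℕ → ℕ
  | 0 => 1
  | t + 1 =>
    if D.Many then
      (if D.leaf (D.N - (t + 1)) then cnt t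
        else if D.N - (t + 1) = 0 then 3 * cnt t else 2 * cnt t)
    else (if D.leaf (D.N - (t + 1)) then 2 * cnt t else cnt t + cnt (t - 1))
termination_by t => t
decreasing_by all_goals omega

/-- The remainders of the number `x` after splitting off its first digits. -/
noncomputable def rem (x : ℕ) : ℕ → ℕ
  | 0 => x
  | i + 1 => rem x i % D.cnt (D.N - (i + 1))

/-- The digits of `x`. -/
noncomputable def dig (x i : ℕ) : ℕ := D.rem x i / D.cnt (D.N - (i + 1))

open Classical in
/-- The colouring given by the number `x`: colour `0` is out, `1` and `2` are in, `3` is undecided. -/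
noncomputable def col (x i : ℕ) : ℕ :=
  if D.Many then
    (if D.leaf i then 3 else if i = 0 then D.dig x 0 else
      if _h : D.par i < i then
        (if col x (D.par i) = 0 then 1 + D.dig x i else D.dig x i * col x (D.par i))
      else 0)
  else 1 - D.dig x i
termination_by i

variable {D}

theorem cnt_pos : ∀ t, 0 < D.cnt t
  | 0 => by rw [cnt]; omega
  | t + 1 => by
    have := cnt_pos t
    rw [cnt]
    split_ifs <;> omega

theorem cnt_mono_succ (t : ℕ) : D.cnt t ≤ D.cnt (t + 1) := by
  rw [cnt]
  split_ifs <;> omega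

/-- A crude bound, used for the size of the numbers and not for the running time. -/
theorem cnt_le_pow : ∀ t, D.cnt t ≤ 3 ^ t
  | 0 => by rw [cnt]; simp
  | t + 1 => by
    have h1 := cnt_le_pow t
    have h2 : D.cnt (t - 1) ≤ D.cnt t := by
      cases t with
      | zero => exact le_rfl
      | succ t => exact cnt_mono_succ t
    have : 3 ^ (t + 1) = 3 * 3 ^ t := by ring
    rw [cnt]
    split_ifs <;> omega

theorem rem_lt {x : ℕ} (hx : x < D.cnt D.N) : ∀ i, D.rem x i < D.cnt (D.N - i)
  | 0 => hx
  | i + 1 => by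
    rw [rem]
    exact Nat.mod_lt _ (cnt_pos _)

theorem rem_eq (x i : ℕ) : D.rem x i = D.dig x i * D.cnt (D.N - (i + 1)) + D.rem x (i + 1) := by
  rw [rem, dig, mul_comm]
  exact (Nat.div_add_mod _ _).symm

/-- The digits are read off greedily with weights `cnt (N - 1), …, cnt 0`. The last remainder is
taken modulo `cnt 0 = 1` and vanishes, so `x` is rebuilt from its digits backwards. -/
theorem dig_injective (hN : 0 < D.N) {x y : ℕ} (h : ∀ i < D.N, D.dig x i = D.dig y i) : x = y := by
  have key : ∀ t ≤ D.N, D.rem x (D.N - t) = D.rem y (D.N - t) := by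
    intro t
    induction t with
    | zero =>
      intro _
      obtain ⟨m, hm⟩ : ∃ m, D.N = m + 1 := ⟨D.N - 1, by omega⟩
      rw [Nat.sub_zero, hm, rem, rem, hm, Nat.sub_self, cnt, Nat.mod_one, Nat.mod_one]
    | succ t ih =>
      intro ht
      rw [rem_eq x, rem_eq y, h _ (by omega), show D.N - (t + 1) + 1 = D.N - t by omega,
        ih (by omega)]
  have := key D.N le_rfl
  rwa [Nat.sub_self, rem, rem] at this

/-- The number with given last digits. -/
noncomputable def ofDig (D : Ord) (d : ℕ → ℕ) : ℕ → ℕ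
  | 0 => 0
  | t + 1 => d (D.N - (t + 1)) * D.cnt t + ofDig D d t

/-- Greedy division recovers prescribed digits provided each tail stays below the next weight. This
condition covers both the ordinary radix and the Fibonacci-like one used for few leaves. -/
theorem dig_ofDig {d : ℕ → ℕ} (h : ∀ t ≤ D.N, ofDig D d t < D.cnt t) {i : ℕ} (hi : i < D.N) :
    D.dig (ofDig D d D.N) i = d i := by
  have key : ∀ i ≤ D.N, D.rem (ofDig D d D.N) i = ofDig D d (D.N - i) := by
    intro i
    induction i with
    | zero => intro _; rfl
    | succ i ih =>
      intro hi
      obtain ⟨t, ht⟩ : ∃ t, D.N - i = t + 1 := ⟨D.N - i - 1, by omega⟩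
      rw [rem, ih (by omega), ht, show D.N - (i + 1) = t by omega, ofDig, mul_comm,
        Nat.mul_add_mod, Nat.mod_eq_of_lt (h t (by omega))]
  obtain ⟨t, ht⟩ : ∃ t, D.N - i = t + 1 := ⟨D.N - i - 1, by omega⟩
  rw [dig, key i hi.le, ht, show D.N - (i + 1) = t by omega, ofDig, mul_comm,
    Nat.mul_add_div (cnt_pos t), Nat.div_eq_of_lt (h t (by omega)),
    show D.N - (t + 1) = i by omega, add_zero]

section

variable (hD : D.Ok)
include hD

theorem Ok.lt' {i j : ℕ} (h : D.r i j) : j < D.N := hD.lt j i (hD.symm i j h)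

theorem Ok.not_leaf {i j : ℕ} (hij : i < j) (h : D.r i j) : ¬ D.leaf i := by
  intro hl
  exact hl ⟨j, (hD.lt' h).trans_le hD.N_le, hij, h⟩

/-- Of two adjacent vertices the earlier one has a later neighbour. -/
theorem Ok.leaf_indep {i j : ℕ} (hi : D.leaf i) (h : D.r i j) : ¬ D.leaf j := by
  intro hj
  rcases lt_trichotomy i j with hij | rfl | hij
  · exact hD.not_leaf hij h hi
  · exact hD.irrefl _ h
  · exact hD.not_leaf hij (hD.symm _ _ h) hj

theorem Ok.zero_not_leaf : ¬ D.leaf 0 := by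
  obtain ⟨j, hj, h⟩ := hD.prev 1 (by have := hD.two_le; omega) one_pos
  obtain rfl : j = 0 := by omega
  exact hD.not_leaf one_pos (hD.symm _ _ h)

theorem Ok.next_of_not_leaf {i : ℕ} (h : ¬ D.leaf i) : D.r i (i + 1) := by
  rw [leaf, not_not] at h
  obtain ⟨j, -, hij, h⟩ := h
  exact hD.next i j hij h

theorem Ok.par_lt {i : ℕ} (hi : i < D.N) (h0 : i ≠ 0) : D.par i < i ∧ D.r i (D.par i) := by
  obtain ⟨j, hj, h⟩ := hD.prev i hi (by omega)
  obtain ⟨-, h2, h3⟩ := firstIdx_spec (n := D.n) (P := D.r i) ⟨j, by have := hD.N_le; omega, h⟩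
  refine ⟨?_, h2⟩
  by_contra hlt
  exact h3 j (by unfold par at hlt; omega) h

theorem Ok.par_not_leaf {i : ℕ} (hi : i < D.N) (h0 : i ≠ 0) : ¬ D.leaf (D.par i) := by
  obtain ⟨h1, h2⟩ := hD.par_lt hi h0
  exact hD.not_leaf h1 (hD.symm _ _ h2)

/-! #### Many leaves -/

section Many

variable (hM : D.Many)
include hM

omit hD in
theorem col_leaf {x i : ℕ} (h : D.leaf i) : D.col x i = 3 := by
  rw [col, if_pos hM, if_pos h]

theorem Ok.col_zero (x : ℕ) : D.col x 0 = D.dig x 0 := by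
  rw [col, if_pos hM, if_neg hD.zero_not_leaf, if_pos rfl]

theorem Ok.col_succ {x i : ℕ} (hi : i < D.N) (h0 : i ≠ 0) (h : ¬ D.leaf i) :
    D.col x i = if D.col x (D.par i) = 0 then 1 + D.dig x i
      else D.dig x i * D.col x (D.par i) := by
  rw [col, if_pos hM, if_neg h, if_neg h0, dif_pos (hD.par_lt hi h0).1]

omit hD in
theorem dig_leaf {x i : ℕ} (hx : x < D.cnt D.N) (hi : i < D.N) (h : D.leaf i) :
    D.dig x i = 0 := by
  have := rem_lt hx i
  rw [show D.N - i = D.N - (i + 1) + 1 by omega, cnt, if_pos hM, if_pos (by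
    rwa [show D.N - (D.N - (i + 1) + 1) = i by omega])] at this
  exact Nat.div_eq_of_lt this

omit hD in
theorem dig_lt {x i : ℕ} (hx : x < D.cnt D.N) (hi : i < D.N) (h : ¬ D.leaf i) :
    D.dig x i < if i = 0 then 3 else 2 := by
  have := rem_lt hx i
  rw [show D.N - i = D.N - (i + 1) + 1 by omega, cnt, if_pos hM,
    show D.N - (D.N - (i + 1) + 1) = i by omega, if_neg h] at this
  split_ifs at this ⊢
  · exact Nat.div_lt_of_lt_mul (by rwa [mul_comm])
  · exact Nat.div_lt_of_lt_mul (by rwa [mul_comm])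

theorem Ok.col_le {x : ℕ} (hx : x < D.cnt D.N) {i : ℕ} (hi : i < D.N) (h : ¬ D.leaf i) :
    D.col x i ≤ 2 := by
  induction i using Nat.strong_induction_on with
  | _ i ih =>
    have hd := dig_lt hM hx hi h
    by_cases h0 : i = 0
    · subst h0
      rw [hD.col_zero hM]
      simp at hd
      omega
    · rw [if_neg h0] at hd
      rw [hD.col_succ hM hi h0 h]
      have hp := hD.par_lt hi h0
      have := ih _ hp.1 (by omega) (hD.par_not_leaf hi h0)
      split_ifs
      · omega
      · interval_cases hd' : D.dig x i <;> omega

/-- Given the colour of the parent, the colour determines the digit: `1 + d` below an out parent,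
and `d` times a nonzero colour below an in parent. -/
theorem Ok.col_injective {x y : ℕ} (hx : x < D.cnt D.N) (hy : y < D.cnt D.N)
    (h : ∀ i < D.N, ¬ D.leaf i → D.col x i = D.col y i) : x = y := by
  refine dig_injective (D := D) (by have := hD.two_le; omega) fun i hi => ?_
  by_cases hl : D.leaf i
  · rw [dig_leaf hM hx hi hl, dig_leaf hM hy hi hl]
  · have hc := h i hi hl
    by_cases h0 : i = 0
    · subst h0
      rwa [hD.col_zero hM, hD.col_zero hM] at hc
    · have hp := hD.par_lt hi h0
      rw [hD.col_succ hM hi h0 hl, hD.col_succ hM hi h0 hl,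
        h _ (by omega) (hD.par_not_leaf hi h0)] at hc
      split_ifs at hc with h1
      · omega
      · exact Nat.eq_of_mul_eq_mul_right (by omega) hc

/-- Every colouring in which neighbours are not both out and have the same colour if they are both
in is encoded by a number. -/
theorem Ok.exists_col {c : ℕ → ℕ} (hc : ∀ i < D.N, ¬ D.leaf i → c i ≤ 2)
    (h00 : ∀ i j, D.r i j → ¬ D.leaf i → ¬ D.leaf j → ¬ (c i = 0 ∧ c j = 0))
    (h12 : ∀ i j, D.r i j → ¬ D.leaf i → ¬ D.leaf j → c i ≠ 0 → c j ≠ 0 → c i = c j) :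
    ∃ x < D.cnt D.N, ∀ i < D.N, ¬ D.leaf i → D.col x i = c i := by
  classical
  -- The decoding inverted: below an out parent the digit is the colour minus one, and below an in
  -- parent it distinguishes out from the colour of the parent.
  set d : ℕ → ℕ := fun i => if D.leaf i then 0 else if i = 0 then c 0 else
    if c (D.par i) = 0 then c i - 1 else if c i = 0 then 0 else 1 with hd
  have hval : ∀ t ≤ D.N, ofDig D d t < D.cnt t := by
    intro t
    induction t with
    | zero => intro _; exact cnt_pos 0
    | succ t ih =>
      intro ht
      have h1 := ih (by omega)
      obtain ⟨i, hi, hi'⟩ : ∃ i, D.N - (t + 1) = i ∧ i < D.N := ⟨_, rfl, by omega⟩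
      rw [ofDig, cnt, if_pos hM, hi]
      by_cases hl : D.leaf i
      · have hdi : d i = 0 := by simp only [hd, if_pos hl]
        rw [if_pos hl, hdi]
        omega
      · have hci := hc i hi' hl
        rw [if_neg hl]
        by_cases h0 : i = 0
        · subst h0
          rw [if_pos rfl]
          have : d 0 ≤ 2 := by simp only [hd, if_neg hl, if_true]; exact hci
          have := Nat.mul_le_mul_right (D.cnt t) this
          omega
        · rw [if_neg h0]
          have : d i ≤ 1 := by
            simp only [hd, if_neg hl, if_neg h0]
            split_ifs <;> omega
          have := Nat.mul_le_mul_right (D.cnt t) this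
          omega
  refine ⟨ofDig D d D.N, hval D.N le_rfl, fun i => ?_⟩
  induction i using Nat.strong_induction_on with
  | _ i ih =>
    intro hi hl
    by_cases h0 : i = 0
    · subst h0
      rw [hD.col_zero hM, dig_ofDig hval hi]
      simp only [hd, if_neg hl, if_true]
    · have hp := hD.par_lt hi h0
      have hpl := hD.par_not_leaf hi h0
      rw [hD.col_succ hM hi h0 hl, dig_ofDig hval hi, ih _ hp.1 (by omega) hpl]
      simp only [hd, if_neg hl, if_neg h0]
      have h1 := h00 _ _ hp.2 hl hpl
      have h2 := h12 _ _ hp.2 hl hpl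
      split_ifs with h3 h4
      · have : c i ≠ 0 := fun h => h1 ⟨h, h3⟩
        omega
      · omega
      · rw [h2 h4 h3, one_mul]

end Many

/-! #### Few leaves -/

section Few

variable (hM : ¬ D.Many)
include hM

omit hD in
theorem col_few (x i : ℕ) : D.col x i = 1 - D.dig x i := by
  rw [col, if_neg hM]

/-- Every independent set is encoded by a number. -/
theorem Ok.exists_col_few {p : ℕ → Prop} (hp : ∀ i j, D.r i j → p i ∨ p j) :
    ∃ x < D.cnt D.N, ∀ i < D.N, (D.col x i = 1 ↔ p i) := by
  classical
  set d : ℕ → ℕ := fun i => if p i then 0 else 1 with hd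
  have hval : ∀ t ≤ D.N, ofDig D d t < D.cnt t := by
    intro t
    induction t using Nat.strong_induction_on with
    | _ t ih =>
      intro ht
      cases t with
      | zero => exact cnt_pos 0
      | succ t =>
        have h1 := ih t (by omega) (by omega)
        obtain ⟨i, hi, hi'⟩ : ∃ i, D.N - (t + 1) = i ∧ i < D.N := ⟨_, rfl, by omega⟩
        have hdi : d i ≤ 1 := by simp only [hd]; split_ifs <;> omega
        have hdi' := Nat.mul_le_mul_right (D.cnt t) hdi
        rw [ofDig, cnt, if_neg hM, hi]
        by_cases hl : D.leaf i
        · rw [if_pos hl]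
          omega
        · rw [if_neg hl]
          have hr := hD.next_of_not_leaf hl
          have hlt := hD.lt' hr
          by_cases hpi : p i
          · have : d i = 0 := by simp only [hd, if_pos hpi]
            rw [this]
            omega
          · have hpi' : p (i + 1) := (hp _ _ hr).resolve_left hpi
            obtain ⟨s, rfl⟩ : ∃ s, t = s + 1 := ⟨t - 1, by omega⟩
            have h2 := ih s (by omega) (by omega)
            have : d (D.N - (s + 1)) = 0 := by
              rw [show D.N - (s + 1) = i + 1 by omega]
              simp only [hd, if_pos hpi']
            rw [ofDig, this]
            simp only [Nat.add_sub_cancel]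
            omega
  refine ⟨ofDig D d D.N, hval D.N le_rfl, fun i hi => ?_⟩
  rw [col_few hM, dig_ofDig hval hi]
  simp only [hd]
  split_ifs with h <;> simp [h]

end Few

end

end Ord

end ConnectedCover

namespace ConnectedCover

open Finset

/-! ### Evaluation of a colouring -/

namespace Ord

variable (D : Ord)

/-- `i` has a neighbour of colour `q`. -/
def touch (c : ℕ → ℕ) (q i : ℕ) : Prop := ∃ j < D.n, D.r i j ∧ c j = q

open Classical in
/-- The colours after putting the neighbours of vertices that are out into the cover. -/
noncomputable def fin (c : ℕ → ℕ) (i : ℕ) : ℕ :=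
  if i < D.N then
    (if c i ≠ 3 then c i else if ¬ D.touch c 0 i then 3 else if D.touch c 1 i then 1 else
      if D.touch c 2 i then 2 else 0)
  else 4

/-- No edge is uncovered, and no edge joins the two colours. -/
def Valid (c : ℕ → ℕ) : Prop := ∀ i < D.n, ∀ j < D.n, D.r i j →
  ¬ (D.fin c i = 0 ∧ D.fin c j = 0) ∧ ¬ (D.fin c i = 1 ∧ D.fin c j = 2)

/-- `i` is in the cover. -/
def inn (c : ℕ → ℕ) (i : ℕ) : Prop := D.fin c i = 1 ∨ D.fin c i = 2

/-- The label of the component of `i`. -/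
noncomputable def L (c : ℕ → ℕ) (i : ℕ) : ℕ := lab D.r (D.inn c) D.n i

open Classical in
/-- The number of vertices in the cover. -/
noncomputable def size (c : ℕ → ℕ) : ℕ := ∑ i ∈ range D.n, if D.inn c i then 1 else 0

open Classical in
/-- The number of components of colour `q`. -/
noncomputable def comps (c : ℕ → ℕ) (q : ℕ) : ℕ :=
  ∑ i ∈ range D.n, if D.fin c i = q ∧ D.L c i = i then 1 else 0

/-- The optional vertices which touch components of colour `1` only. -/
def opt (c : ℕ → ℕ) (a : ℕ) : Prop := D.fin c a = 3 ∧ ¬ D.touch (D.fin c) 2 a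

/-- `a` and `b` touch a common component. -/
def link (c : ℕ → ℕ) (a b : ℕ) : Prop := ∃ u < D.n, ∃ v < D.n, D.r a u ∧ D.r b v ∧
  D.inn c u ∧ D.inn c v ∧ D.L c u = D.L c v

open Classical in
/-- The weight of a colouring. -/
noncomputable def wt (k : ℕ) (c : ℕ → ℕ) : ℕ :=
  (if D.size c ≤ k ∧ D.comps c 1 = 1 ∧ D.comps c 2 = 0 then 1 else 0) +
    ∑ j ∈ range (k - D.size c), ∑ a ∈ range D.n, bw (D.link c) D.n (D.opt c) (j + 1) a

open Classical in
/-- The weight counted in the class of colourings with `par` components of colour `2` modulo `2`. -/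
noncomputable def signed (k q : ℕ) (c : ℕ → ℕ) : ℕ :=
  if D.Valid c ∧ D.comps c 2 % 2 = q then D.wt k c else 0

/-- Connected vertex covers. -/
def IsCover (U : Finset ℕ) : Prop :=
  (∀ i ∈ U, i < D.N) ∧ (∀ i j, D.r i j → i ∈ U ∨ j ∈ U) ∧ Conn D.r U

end Ord

/-! ### Connecting components -/

section Connecting

variable {n : ℕ} {r : ℕ → ℕ → Prop} {inn : ℕ → Prop}

/-- The common touching of components. -/
def Link (n : ℕ) (r : ℕ → ℕ → Prop) (inn : ℕ → Prop) (a b : ℕ) : Prop :=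
  ∃ u < n, ∃ v < n, r a u ∧ r b v ∧ inn u ∧ inn v ∧ lab r inn n u = lab r inn n v

open Classical in
/-- The labels of the components. -/
noncomputable def compSet (n : ℕ) (r : ℕ → ℕ → Prop) (inn : ℕ → Prop) : Finset ℕ :=
  {i ∈ range n | inn i ∧ lab r inn n i = i}

open Classical in
/-- The labels of the components touched by `a`. -/
noncomputable def touched (n : ℕ) (r : ℕ → ℕ → Prop) (inn : ℕ → Prop) (a : ℕ) : Finset ℕ :=
  {u ∈ range n | r a u ∧ inn u}.image (lab r inn n)

theorem mem_touched {a l : ℕ} :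
    l ∈ touched n r inn a ↔ ∃ u < n, r a u ∧ inn u ∧ lab r inn n u = l := by
  classical
  simp only [touched, mem_image, mem_filter, mem_range]
  constructor
  · rintro ⟨u, ⟨h1, h2, h3⟩, h4⟩; exact ⟨u, h1, h2, h3, h4⟩
  · rintro ⟨u, h1, h2, h3, h4⟩; exact ⟨u, ⟨h1, h2, h3⟩, h4⟩

theorem mem_compSet {l : ℕ} : l ∈ compSet n r inn ↔ l < n ∧ inn l ∧ lab r inn n l = l := by
  classical
  simp [compSet]

variable (hn : ∀ i, inn i → i < n)
include hn

theorem lab_mem_compSet {i : ℕ} (hi : inn i) : lab r inn n i ∈ compSet n r inn :=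
  mem_compSet.mpr ⟨hn _ (lab_inn hi), lab_inn hi, lab_lab hi⟩

theorem touched_subset {a : ℕ} : touched n r inn a ⊆ compSet n r inn := by
  intro l hl
  obtain ⟨u, -, -, hu, rfl⟩ := mem_touched.mp hl
  exact lab_mem_compSet hn hu

variable (hr : ∀ i j, r i j → r j i)
include hr

/-- A property closed under `r` is constant on each component of `I`, and a vertex of `Y` agrees
with the components it touches. Hence the property is closed under `Link` on `Y`, holds on all of
`Y`, and reaches every component because each one is touched. -/
theorem conn_union {I Y : Finset ℕ} (hI : ∀ i, i ∈ I ↔ inn i)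
    (hY : Conn (Link n r inn) Y) (hC : Y.biUnion (touched n r inn) = compSet n r inn) :
    Conn r (I ∪ Y) := by
  rintro p ⟨w, hw, hpw⟩ hcl
  have hclI : ∀ a b, inn a → inn b → r a b → p a → p b := fun a b ha hb hab hpa =>
    hcl a (mem_union_left _ ((hI a).mpr ha)) hpa b (mem_union_left _ ((hI b).mpr hb)) hab
  have hlab : ∀ {u}, inn u → (p (lab r inn n u) ↔ p u) := fun hu => lab_closed hr hclI hu
  have hyu : ∀ y ∈ Y, ∀ u, inn u → r y u → (p y ↔ p u) := fun y hy u hu hyu =>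
    ⟨fun h => hcl y (mem_union_right _ hy) h u (mem_union_left _ ((hI u).mpr hu)) hyu,
      fun h => hcl u (mem_union_left _ ((hI u).mpr hu)) h y (mem_union_right _ hy) (hr _ _ hyu)⟩
  have hlink : ∀ a ∈ Y, p a → ∀ b ∈ Y, Link n r inn a b → p b := by
    rintro a ha hpa b hb ⟨u, -, v, -, hau, hbv, hu, hv, huv⟩
    rw [hyu b hb v hv hbv, ← hlab hv, ← huv, hlab hu, ← hyu a ha u hu hau]
    exact hpa
  have htouch : ∀ i, inn i → ∃ y ∈ Y, (p i ↔ p y) := by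
    intro i hi
    have := lab_mem_compSet (r := r) hn hi
    rw [← hC, mem_biUnion] at this
    obtain ⟨y, hy, hl⟩ := this
    obtain ⟨u, -, hyu', hu, hlu⟩ := mem_touched.mp hl
    exact ⟨y, hy, by rw [hyu y hy u hu hyu', ← hlab hu, hlu, hlab hi]⟩
  have hex : ∃ y ∈ Y, p y := by
    rcases mem_union.mp hw with hw | hw
    · obtain ⟨y, hy, h⟩ := htouch w ((hI w).mp hw)
      exact ⟨y, hy, h.mp hpw⟩
    · exact ⟨w, hw, hpw⟩
  have hall := hY p hex hlink
  intro z hz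
  rcases mem_union.mp hz with hz | hz
  · obtain ⟨y, hy, h⟩ := htouch z ((hI z).mp hz)
    exact h.mpr (hall y hy)
  · exact hall z hz

theorem conn_of_card {I : Finset ℕ} (hI : ∀ i, i ∈ I ↔ inn i)
    (hC : #(compSet n r inn) = 1) : Conn r I := by
  rintro p ⟨w, hw, hpw⟩ hcl z hz
  have hclI : ∀ a b, inn a → inn b → r a b → p a → p b := fun a b ha hb hab hpa =>
    hcl a ((hI a).mpr ha) hpa b ((hI b).mpr hb) hab
  obtain ⟨l, hl⟩ := card_eq_one.mp hC
  have hlab : ∀ i, inn i → lab r inn n i = l := fun i hi => by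
    have := lab_mem_compSet (r := r) hn hi
    rwa [hl, mem_singleton] at this
  rw [hI] at hw hz
  rw [← lab_closed hr hclI (t := n) hz, hlab z hz, ← hlab w hw, lab_closed hr hclI hw]
  exact hpw

variable (hirr : ∀ i, ¬ r i i)
include hirr

theorem card_of_conn {I : Finset ℕ} (hI : ∀ i, i ∈ I ↔ inn i) (hne : I.Nonempty)
    (hc : Conn r I) : #(compSet n r inn) = 1 := by
  obtain ⟨w, hw⟩ := hne
  have hall := hc (fun z => lab r inn n z = lab r inn n w) ⟨w, hw, rfl⟩ (by
    intro a ha hpa b hb hab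
    rw [hI] at ha hb
    rw [← hpa, lab_adj hr hirr (hn _ hb) (hn _ ha) hb ha (hr _ _ hab)])
  rw [card_eq_one]
  refine ⟨lab r inn n w, ?_⟩
  ext l
  rw [mem_singleton]
  constructor
  · intro hl
    obtain ⟨-, h1, h2⟩ := mem_compSet.mp hl
    rw [← h2, hall l ((hI l).mpr h1)]
  · rintro rfl
    exact lab_mem_compSet hn ((hI w).mp hw)

/-- Converse of `conn_union`. As `Y` is independent, a path in `I ∪ Y` stays within one component of
`I` between two consecutive visits to `Y`, and such visits are linked. -/
theorem link_of_conn {I Y : Finset ℕ} (hI : ∀ i, i ∈ I ↔ inn i)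
    (hdisj : ∀ y ∈ Y, ¬ inn y) (hYY : ∀ y ∈ Y, ∀ y' ∈ Y, ¬ r y y') (hne : Y.Nonempty)
    (hc : Conn r (I ∪ Y)) :
    Conn (Link n r inn) Y ∧ Y.biUnion (touched n r inn) = compSet n r inn := by
  -- A property of `Y` closed under links is extended to the components touched by vertices that
  -- have it; the extension is closed under `r`.
  have key : ∀ S : ℕ → Prop, (∃ y ∈ Y, S y) →
      (∀ a ∈ Y, S a → ∀ b ∈ Y, Link n r inn a b → S b) →
      (∀ y ∈ Y, S y) ∧ ∀ i, inn i → ∃ s ∈ Y, S s ∧ lab r inn n i ∈ touched n r inn s := by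
    rintro S ⟨y₀, hy₀, hS₀⟩ hcl
    have hall := hc (fun z => (z ∈ Y ∧ S z) ∨
      (inn z ∧ ∃ s ∈ Y, S s ∧ lab r inn n z ∈ touched n r inn s))
      ⟨y₀, mem_union_right _ hy₀, .inl ⟨hy₀, hS₀⟩⟩ (by
        rintro a - (⟨haY, haS⟩ | ⟨hai, s, hs, hsS, hl⟩) b hb hab
        · rcases mem_union.mp hb with hb | hb
          · rw [hI] at hb
            exact .inr ⟨hb, a, haY, haS, mem_touched.mpr ⟨b, hn b hb, hab, hb, rfl⟩⟩
          · exact absurd hab (hYY a haY b hb)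
        · rcases mem_union.mp hb with hb | hb
          · rw [hI] at hb
            refine .inr ⟨hb, s, hs, hsS, ?_⟩
            rwa [lab_adj hr hirr (hn _ hb) (hn _ hai) hb hai (hr _ _ hab)]
          · obtain ⟨u, hun, hsu, hu, hlu⟩ := mem_touched.mp hl
            exact .inl ⟨hb, hcl s hs hsS b hb
              ⟨u, hun, a, hn a hai, hsu, hr _ _ hab, hu, hai, hlu⟩⟩)
    constructor
    · intro y hy
      rcases hall y (mem_union_right _ hy) with h | h
      · exact h.2
      · exact absurd h.1 (hdisj y hy)
    · intro i hi
      rcases hall i (mem_union_left _ ((hI i).mpr hi)) with h | h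
      · exact absurd hi (hdisj i h.1)
      · exact h.2
  refine ⟨fun p h1 h2 => (key p h1 h2).1, ?_⟩
  apply Subset.antisymm
  · intro l hl
    obtain ⟨y, -, hl⟩ := mem_biUnion.mp hl
    exact touched_subset hn hl
  · intro l hl
    obtain ⟨-, h1, h2⟩ := mem_compSet.mp hl
    obtain ⟨y, hy⟩ := hne
    obtain ⟨s, hs, -, hls⟩ := (key (fun _ => True) ⟨y, hy, trivial⟩ (fun _ _ _ _ _ _ => trivial)).2
      l h1
    rw [h2] at hls
    exact mem_biUnion.mpr ⟨s, hs, hls⟩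

end Connecting

/-! ### Inclusion and exclusion -/

/-- Complements in `C` turn the interval from `B` to `C` into the power set of `C \ B`, whose
alternating sum vanishes unless it is empty. -/
theorem sum_Icc_neg_one {B C : Finset ℕ} (hB : B ⊆ C) :
    ∑ X ∈ C.powerset with B ⊆ X, (-1 : ℤ) ^ #(C \ X) = if B = C then 1 else 0 := by
  have h : ∑ X ∈ C.powerset with B ⊆ X, (-1 : ℤ) ^ #(C \ X) =
      ∑ Z ∈ (C \ B).powerset, (-1 : ℤ) ^ #Z := by
    refine sum_nbij' (fun X => C \ X) (fun Z => C \ Z) ?_ ?_ ?_ ?_ ?_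
    · intro X hX
      simp only [mem_filter, mem_powerset] at hX ⊢
      exact sdiff_subset_sdiff le_rfl hX.2
    · intro Z hZ
      simp only [mem_filter, mem_powerset] at hZ ⊢
      refine ⟨sdiff_subset, fun b hb => mem_sdiff.mpr ⟨hB hb, fun hbZ => ?_⟩⟩
      exact (mem_sdiff.mp (hZ hbZ)).2 hb
    · intro X hX
      simp only [mem_filter, mem_powerset] at hX
      exact Finset.sdiff_sdiff_eq_self hX.1
    · intro Z hZ
      simp only [mem_powerset] at hZ
      exact Finset.sdiff_sdiff_eq_self (hZ.trans sdiff_subset)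
    · intro X _
      rfl
  rw [h, sum_powerset_neg_one_pow_card]
  refine if_congr ?_ rfl rfl
  rw [sdiff_eq_empty_iff_subset]
  exact ⟨fun h => Subset.antisymm hB h, fun h => h.ge⟩

/-- After exchanging the sums, a set `Y` occurs for exactly the `X` that contain its union of
labels, and the alternating sum over these `X` leaves only the `Y` touching all of `C`. -/
theorem sum_inclusion_exclusion {C P : Finset ℕ} {lb : ℕ → Finset ℕ} (hlb : ∀ a ∈ P, lb a ⊆ C)
    (g : Finset ℕ → ℤ) :
    ∑ X ∈ C.powerset, (-1 : ℤ) ^ #(C \ X) * ∑ Y ∈ (P.filter (lb · ⊆ X)).powerset, g Y =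
      ∑ Y ∈ P.powerset with Y.biUnion lb = C, g Y := by
  have h1 : ∀ X ∈ C.powerset,
      (-1 : ℤ) ^ #(C \ X) * ∑ Y ∈ (P.filter (lb · ⊆ X)).powerset, g Y =
      ∑ Y ∈ P.powerset, if Y.biUnion lb ⊆ X then (-1 : ℤ) ^ #(C \ X) * g Y else 0 := by
    intro X _
    rw [← sum_filter, mul_sum]
    refine sum_congr ?_ fun _ _ => rfl
    ext Y
    simp only [mem_powerset, mem_filter, biUnion_subset_iff_forall_subset]
    exact ⟨fun h => ⟨h.trans (filter_subset _ _), fun a ha => (mem_filter.mp (h ha)).2⟩,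
      fun h a ha => mem_filter.mpr ⟨h.1 ha, h.2 a ha⟩⟩
  rw [sum_congr rfl h1, sum_comm, sum_filter]
  refine sum_congr rfl fun Y hY => ?_
  have hsub : Y.biUnion lb ⊆ C :=
    biUnion_subset_iff_forall_subset.mpr fun a ha => hlb a (mem_powerset.mp hY ha)
  rw [← sum_filter, ← sum_mul, sum_Icc_neg_one hsub]
  split_ifs <;> simp

end ConnectedCover

/-! ### Correctness of the enumeration for few leaves -/

namespace ConnectedCover

open Finset

namespace Ord

variable {D : Ord} (hD : D.Ok)

theorem fin_lt {c : ℕ → ℕ} {i : ℕ} (h : D.fin c i ≤ 3) : i < D.N := by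
  by_contra hi
  rw [fin, if_neg hi] at h
  omega

include hD

theorem Ok.touch_iff {c : ℕ → ℕ} {q i : ℕ} : D.touch c q i ↔ ∃ j, D.r i j ∧ c j = q :=
  ⟨fun ⟨j, _, h⟩ => ⟨j, h⟩, fun ⟨j, h⟩ => ⟨j, (hD.lt' h.1).trans_le hD.N_le, h⟩⟩

theorem Ok.valid_iff {c : ℕ → ℕ} : D.Valid c ↔ ∀ i j, D.r i j →
    ¬ (D.fin c i = 0 ∧ D.fin c j = 0) ∧ ¬ (D.fin c i = 1 ∧ D.fin c j = 2) :=
  ⟨fun h i j hij => h i ((hD.lt _ _ hij).trans_le hD.N_le) j ((hD.lt' hij).trans_le hD.N_le) hij,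
    fun h i _ j _ hij => h i j hij⟩

theorem Ok.inn_lt {c : ℕ → ℕ} {i : ℕ} (h : D.inn c i) : i < D.n := by
  refine (fin_lt (c := c) ?_).trans_le hD.N_le
  rcases h with h | h <;> omega

omit hD in
theorem size_eq {c : ℕ → ℕ} {I : Finset ℕ} (hI : ∀ i, i ∈ I ↔ i < D.n ∧ D.inn c i) :
    D.size c = #I := by
  classical
  rw [size, sum_boole, Nat.cast_id]
  congr 1
  ext i
  rw [mem_filter, mem_range, hI]

/-! #### Few leaves -/

omit hD in
theorem fin_few (hM : ¬ D.Many) {x i : ℕ} (hi : i < D.N) :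
    D.fin (D.col x) i = D.col x i := by
  rw [fin, if_pos hi, if_pos]
  rw [col_few hM]
  omega

omit hD in
-- Here every vertex has colour 0 or 1. There are no optional vertices, hence no branching walks,
-- and no components of colour 2, hence no negative terms; the weight just tests the colouring.
theorem signed_few (hM : ¬ D.Many) (k x : ℕ) :
    D.signed k 1 (D.col x) = 0 ∧ (0 < D.signed k 0 (D.col x) ↔
      D.Valid (D.col x) ∧ D.size (D.col x) ≤ k ∧ D.comps (D.col x) 1 = 1) := by
  have h2 : ∀ i, D.fin (D.col x) i ≠ 2 ∧ D.fin (D.col x) i ≠ 3 := by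
    intro i
    by_cases hi : i < D.N
    · rw [fin_few hM hi, col_few hM]
      omega
    · rw [fin, if_neg hi]
      omega
  have hc2 : D.comps (D.col x) 2 = 0 := by
    rw [comps]
    exact sum_eq_zero fun i _ => if_neg fun h => (h2 i).1 h.1
  have hb : ∀ j a, bw (D.link (D.col x)) D.n (D.opt (D.col x)) j a = 0 := by
    intro j a
    have hno : ¬ D.opt (D.col x) a := fun h => (h2 a).2 h.1
    rw [bw]
    split_ifs <;> rfl
  have hw : D.wt k (D.col x) =
      if D.size (D.col x) ≤ k ∧ D.comps (D.col x) 1 = 1 then 1 else 0 := by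
    simp only [wt, hb, hc2, sum_const_zero, add_zero, and_true]
  constructor
  · rw [signed, if_neg]
    rw [hc2]
    simp
  · rw [signed, hc2, hw]
    split_ifs with h3 h4
    · simp only [one_pos, true_iff]
      exact ⟨h3.1, h4⟩
    · simp only [lt_irrefl, false_iff]
      exact fun h => h4 h.2
    · simp only [lt_irrefl, false_iff]
      exact fun h => h3 ⟨h.1, rfl⟩

omit hD in
theorem inn_few (hM : ¬ D.Many) {x i : ℕ} : D.inn (D.col x) i ↔ i < D.N ∧ D.col x i = 1 := by
  constructor
  · intro h
    have hi : i < D.N := fin_lt (c := D.col x) (by rcases h with h | h <;> omega)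
    refine ⟨hi, ?_⟩
    rw [inn, fin_few hM hi, col_few hM] at h
    rw [col_few hM]
    omega
  · rintro ⟨hi, h⟩
    left
    rw [fin_few hM hi, h]

omit hD in
theorem comps_few (hM : ¬ D.Many) {x : ℕ} :
    D.comps (D.col x) 1 = #(compSet D.n D.r (D.inn (D.col x))) := by
  classical
  rw [comps, sum_boole, Nat.cast_id, compSet]
  congr 1
  ext i
  rw [mem_filter, mem_filter, mem_range, L]
  refine and_congr_right fun _ => and_congr_left fun _ => ?_
  constructor
  · exact .inl
  · intro h
    have := (inn_few hM).mp h
    rw [fin_few hM this.1, this.2]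

/-- Validity says that the vertices of colour 1 form a vertex cover, and a single component says
that it is connected. Repetitions in the enumeration do no harm, since all terms are nonnegative. -/
theorem Ok.cover_few (hM : ¬ D.Many) (k : ℕ) :
    (∃ x < D.cnt D.N, 0 < D.signed k 0 (D.col x)) ↔ ∃ U, D.IsCover U ∧ #U ≤ k := by
  classical
  -- An edge makes every cover nonempty, so a connected one has exactly one component and not none.
  have hedge : ∃ i j, D.r i j := by
    obtain ⟨j, -, h⟩ := hD.prev 1 (by have := hD.two_le; omega) one_pos
    exact ⟨1, j, h⟩
  constructor
  · rintro ⟨x, -, hx⟩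
    obtain ⟨hv, hs, hc⟩ := (signed_few hM k x).2.mp hx
    rw [comps_few hM] at hc
    rw [hD.valid_iff] at hv
    set I : Finset ℕ := {i ∈ range D.n | D.inn (D.col x) i} with hI
    have hI' : ∀ i, i ∈ I ↔ D.inn (D.col x) i := fun i => by
      rw [hI, mem_filter, mem_range]
      exact ⟨fun h => h.2, fun h => ⟨hD.inn_lt h, h⟩⟩
    refine ⟨I, ⟨fun i hi => ((inn_few hM).mp ((hI' i).mp hi)).1, fun i j hij => ?_,
      conn_of_card (fun i => hD.inn_lt) hD.symm hI' hc⟩, ?_⟩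
    · rw [hI', hI', inn_few hM, inn_few hM]
      have h := (hv i j hij).1
      have hi := hD.lt _ _ hij
      have hj := hD.lt' hij
      rw [fin_few hM hi, fin_few hM hj] at h
      by_contra hcon
      push Not at hcon
      refine h ⟨?_, ?_⟩
      · have := hcon.1 hi
        rw [col_few hM] at this ⊢
        omega
      · have := hcon.2 hj
        rw [col_few hM] at this ⊢
        omega
    · rwa [size_eq (I := I) fun i => by rw [hI, mem_filter, mem_range]] at hs
  · rintro ⟨U, ⟨hU1, hU2, hU3⟩, hk⟩
    obtain ⟨x, hx, hxU⟩ := hD.exists_col_few hM (p := (· ∈ U)) hU2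
    have hinn : ∀ i, i ∈ U ↔ D.inn (D.col x) i := fun i => by
      rw [inn_few hM]
      constructor
      · intro h
        exact ⟨hU1 i h, (hxU i (hU1 i h)).mpr h⟩
      · rintro ⟨h1, h2⟩
        exact (hxU i h1).mp h2
    refine ⟨x, hx, (signed_few hM k x).2.mpr ⟨?_, ?_, ?_⟩⟩
    · rw [hD.valid_iff]
      intro i j hij
      have hi := hD.lt _ _ hij
      have hj := hD.lt' hij
      rw [fin_few hM hi, fin_few hM hj]
      constructor
      · rintro ⟨h1, h2⟩
        rcases hU2 i j hij with h | h
        · have := (hxU i hi).mpr h; omega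
        · have := (hxU j hj).mpr h; omega
      · rintro ⟨-, h2⟩
        rw [col_few hM] at h2
        omega
    · rw [size_eq (I := U) fun i => ?_]
      · exact hk
      · rw [hinn]
        exact ⟨fun h => ⟨hD.inn_lt h, h⟩, fun h => h.2⟩
    · rw [comps_few hM]
      obtain ⟨i, j, hij⟩ := hedge
      refine card_of_conn (fun i => hD.inn_lt) hD.symm hD.irrefl hinn ?_ hU3
      rcases hU2 i j hij with h | h
      · exact ⟨i, h⟩
      · exact ⟨j, h⟩

end Ord

end ConnectedCover

/-! ### The signed count for many leaves -/

namespace ConnectedCover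

open Finset

namespace Ord

variable (D : Ord)

/-- The vertices which are in the cover if exactly the vertices in `Q` and some leaves are out. -/
def innOf (Q : Finset ℕ) (i : ℕ) : Prop :=
  i < D.N ∧ ((¬ D.leaf i ∧ i ∉ Q) ∨ (D.leaf i ∧ ∃ q ∈ Q, D.r i q))

open Classical in
/-- The leaves which need not be in the cover if the vertices in `Q` are out. -/
noncomputable def optOf (Q : Finset ℕ) : Finset ℕ :=
  {i ∈ range D.n | i < D.N ∧ D.leaf i ∧ ¬ ∃ q ∈ Q, D.r i q}

open Classical in
/-- The vertices other than leaves which are out. -/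
noncomputable def outs (x : ℕ) : Finset ℕ := {i ∈ range D.N | ¬ D.leaf i ∧ D.col x i = 0}

/-- Conditions for `Q` to be the set of vertices other than leaves which are out of a cover. -/
structure Good (Q : Finset ℕ) : Prop where
  sub : ∀ i ∈ Q, i < D.N ∧ ¬ D.leaf i
  indep : ∀ i ∈ Q, ∀ j ∈ Q, ¬ D.r i j
  nbr : ∀ f < D.N, D.leaf f → (∃ q ∈ Q, D.r f q) → ∃ z, z ∉ Q ∧ D.r f z

open Classical in
/-- The finite set of vertices which are in the cover. -/
noncomputable def innSet (Q : Finset ℕ) : Finset ℕ := {i ∈ range D.n | D.innOf Q i}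

/-- The components of the vertices which are in the cover. -/
noncomputable def compOf (Q : Finset ℕ) : Finset ℕ := compSet D.n D.r (D.innOf Q)

open Classical in
/-- The number of branching walks that touch all components. -/
noncomputable def value (k : ℕ) (Q : Finset ℕ) : ℕ :=
  (if #(D.innSet Q) ≤ k ∧ #(D.compOf Q) = 1 then 1 else 0) +
    ∑ j ∈ range (k - #(D.innSet Q)), ∑ a ∈ range D.n,
      ∑ Y ∈ (D.optOf Q).powerset with Y.biUnion (touched D.n D.r (D.innOf Q)) = D.compOf Q,
        cw (Link D.n D.r (D.innOf Q)) D.n (j + 1) a Y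

open Classical in
/-- The number of branching walks that touch components in `X` only. -/
noncomputable def valueIn (k : ℕ) (Q X : Finset ℕ) : ℕ :=
  (if #(D.innSet Q) ≤ k ∧ #X = 1 ∧ #(D.compOf Q \ X) = 0 then 1 else 0) +
    ∑ j ∈ range (k - #(D.innSet Q)), ∑ a ∈ range D.n,
      ∑ Y ∈ ((D.optOf Q).filter (touched D.n D.r (D.innOf Q) · ⊆ X)).powerset,
        cw (Link D.n D.r (D.innOf Q)) D.n (j + 1) a Y

variable {D} (hD : D.Ok)
include hD

theorem Ok.innOf_lt {Q : Finset ℕ} {i : ℕ} (h : D.innOf Q i) : i < D.n := h.1.trans_le hD.N_le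

theorem Ok.mem_innSet {Q : Finset ℕ} {i : ℕ} : i ∈ D.innSet Q ↔ D.innOf Q i := by
  classical
  rw [innSet, mem_filter, mem_range]
  exact ⟨fun h => h.2, fun h => ⟨hD.innOf_lt h, h⟩⟩

theorem Ok.mem_optOf {Q : Finset ℕ} {i : ℕ} :
    i ∈ D.optOf Q ↔ i < D.N ∧ D.leaf i ∧ ¬ ∃ q ∈ Q, D.r i q := by
  classical
  rw [optOf, mem_filter, mem_range]
  exact ⟨fun h => h.2, fun h => ⟨h.1.trans_le hD.N_le, h⟩⟩

omit hD in
theorem mem_outs {x i : ℕ} : i ∈ D.outs x ↔ i < D.N ∧ ¬ D.leaf i ∧ D.col x i = 0 := by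
  classical
  rw [outs, mem_filter, mem_range]

/-- Inclusion and exclusion for the walks; the indicator of the cover without optional leaves
contributes only for `X = compOf Q`. -/
theorem sum_valueIn (k : ℕ) (Q : Finset ℕ) :
    ∑ X ∈ (D.compOf Q).powerset, (-1 : ℤ) ^ #(D.compOf Q \ X) * (D.valueIn k Q X : ℤ) =
      D.value k Q := by
  classical
  simp only [valueIn, value, Nat.cast_add, Nat.cast_sum, mul_add, sum_add_distrib]
  congr 1
  · rw [sum_eq_single (D.compOf Q)]
    · simp
    · intro X hX hne
      rw [if_neg]
      · simp
      · rintro ⟨-, -, h⟩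
        rw [card_eq_zero, sdiff_eq_empty_iff_subset] at h
        exact hne (Subset.antisymm (mem_powerset.mp hX) h)
    · intro h
      exact absurd (mem_powerset_self _) h
  · simp only [mul_sum]
    rw [sum_comm]
    refine sum_congr rfl fun j _ => ?_
    rw [sum_comm]
    refine sum_congr rfl fun a _ => ?_
    simp only [← mul_sum]
    exact sum_inclusion_exclusion
      (fun _ _ => touched_subset (fun i hi => hD.innOf_lt hi)) _

section Many

variable (hM : D.Many) {x : ℕ} (hx : x < D.cnt D.N)
include hM hx

theorem Ok.fin_many {i : ℕ} (hi : i < D.N) (hl : ¬ D.leaf i) :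
    D.fin (D.col x) i = D.col x i := by
  have := hD.col_le hM hx hi hl
  rw [fin, if_pos hi, if_pos (by omega)]

omit hM hx in
theorem Ok.touch_zero {i : ℕ} (hl : D.leaf i) :
    D.touch (D.col x) 0 i ↔ ∃ q ∈ D.outs x, D.r i q := by
  rw [hD.touch_iff]
  constructor
  · rintro ⟨j, h, h'⟩
    exact ⟨j, mem_outs.mpr ⟨hD.lt' h, hD.leaf_indep hl h, h'⟩, h⟩
  · rintro ⟨q, hq, h⟩
    exact ⟨q, h, (mem_outs.mp hq).2.2⟩

omit hx in
theorem Ok.fin_leaf {i : ℕ} (hi : i < D.N) (hl : D.leaf i) (hq : ∃ q ∈ D.outs x, D.r i q) :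
    (D.touch (D.col x) 1 i ∧ D.fin (D.col x) i = 1) ∨
    (¬ D.touch (D.col x) 1 i ∧ D.touch (D.col x) 2 i ∧ D.fin (D.col x) i = 2) ∨
    (¬ D.touch (D.col x) 1 i ∧ ¬ D.touch (D.col x) 2 i ∧ D.fin (D.col x) i = 0) := by
  rw [← hD.touch_zero hl] at hq
  rw [fin, if_pos hi, if_neg (not_not.mpr (col_leaf hM hl)), if_neg (not_not.mpr hq)]
  split_ifs with h1 h2
  · exact .inl ⟨h1, rfl⟩
  · exact .inr (.inl ⟨h1, h2, rfl⟩)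
  · exact .inr (.inr ⟨h1, h2, rfl⟩)

omit hx in
theorem Ok.fin_opt {i : ℕ} (hi : i < D.N) (hl : D.leaf i) (hq : ¬ ∃ q ∈ D.outs x, D.r i q) :
    D.fin (D.col x) i = 3 := by
  rw [← hD.touch_zero hl] at hq
  rw [fin, if_pos hi, if_neg (not_not.mpr (col_leaf hM hl)), if_pos hq]

/-- In a valid colouring the forced part depends only on the set of out vertices: a leaf next to an
out vertex that found no colour to take over gets colour 0 and would leave an edge uncovered. -/
theorem Ok.inn_of_valid (hv : D.Valid (D.col x)) : D.inn (D.col x) = D.innOf (D.outs x) := by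
  rw [hD.valid_iff] at hv
  funext i
  by_cases hi : i < D.N
  · by_cases hl : D.leaf i
    · by_cases hq : ∃ q ∈ D.outs x, D.r i q
      · have hR : D.innOf (D.outs x) i := ⟨hi, .inr ⟨hl, hq⟩⟩
        simp only [hR, eq_iff_iff, iff_true]
        rcases hD.fin_leaf hM hi hl hq with h | h | h
        · exact .inl h.2
        · exact .inr h.2.2
        · obtain ⟨q, hq, hr⟩ := hq
          have hq' := mem_outs.mp hq
          refine absurd ⟨h.2.2, ?_⟩ (hv i q hr).1
          rw [hD.fin_many hM hx hq'.1 hq'.2.1, hq'.2.2]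
      · have hR : ¬ D.innOf (D.outs x) i := by
          rintro ⟨-, h | h⟩
          · exact h.1 hl
          · exact hq h.2
        simp only [hR, eq_iff_iff, iff_false]
        rw [inn, hD.fin_opt hM hi hl hq]
        omega
    · have := hD.col_le hM hx hi hl
      rw [inn, hD.fin_many hM hx hi hl, innOf, mem_outs, eq_iff_iff]
      simp only [hi, hl, not_false_eq_true, true_and, false_and, or_false]
      omega
  · rw [eq_iff_iff, inn, innOf, fin, if_neg hi]
    simp only [hi, false_and, iff_false]
    omega

theorem Ok.good_of_valid (hv : D.Valid (D.col x)) : D.Good (D.outs x) := by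
  have hv' := hD.valid_iff.mp hv
  refine ⟨fun i hi => ?_, fun i hi j hj hr => ?_, fun f hf hl hq => ?_⟩
  · exact ⟨(mem_outs.mp hi).1, (mem_outs.mp hi).2.1⟩
  · have h1 := mem_outs.mp hi
    have h2 := mem_outs.mp hj
    refine (hv' i j hr).1 ⟨?_, ?_⟩
    · rw [hD.fin_many hM hx h1.1 h1.2.1, h1.2.2]
    · rw [hD.fin_many hM hx h2.1 h2.2.1, h2.2.2]
  · have key : ∀ q, q ≠ 0 → D.touch (D.col x) q f → ∃ z, z ∉ D.outs x ∧ D.r f z := by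
      intro q hq0 ht
      obtain ⟨z, hz, hz'⟩ := hD.touch_iff.mp ht
      exact ⟨z, fun h => hq0 (by rw [← hz', (mem_outs.mp h).2.2]), hz⟩
    rcases hD.fin_leaf hM hf hl hq with h | h | h
    · exact key 1 (by omega) h.1
    · exact key 2 (by omega) h.2.1
    · have : D.inn (D.col x) f := by
        rw [hD.inn_of_valid hM hx hv]
        exact ⟨hf, .inr ⟨hl, hq⟩⟩
      rw [inn, h.2.2] at this
      omega

/-- Colours are constant on components. -/
theorem Ok.fin_lab (hv : D.Valid (D.col x)) {u : ℕ} (hu : D.innOf (D.outs x) u) :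
    D.fin (D.col x) (lab D.r (D.innOf (D.outs x)) D.n u) = 1 ↔ D.fin (D.col x) u = 1 := by
  have hv' := hD.valid_iff.mp hv
  have hinn := hD.inn_of_valid hM hx hv
  refine lab_closed (p := fun u => D.fin (D.col x) u = 1) hD.symm (fun a b _ hb hab ha => ?_) hu
  rw [← hinn] at hb
  rcases hb with h | h
  · exact h
  · exact absurd ⟨ha, h⟩ (hv' a b hab).2

-- The colouring enters its weight only through `Q` and the set `X` of components of colour 1: a
-- leaf touches no vertex of colour 2 exactly if all components it touches belong to `X`. The
-- components of colour 2 are the complement of `X`, which gives the sign.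
open Classical in
theorem Ok.wt_eq (hv : D.Valid (D.col x)) (k : ℕ) :
    D.comps (D.col x) 2 = #(D.compOf (D.outs x) \
      (D.compOf (D.outs x)).filter fun l => D.fin (D.col x) l = 1) ∧
    D.wt k (D.col x) = D.valueIn k (D.outs x)
      ((D.compOf (D.outs x)).filter fun l => D.fin (D.col x) l = 1) := by
  have hinn := hD.inn_of_valid hM hx hv
  set Q := D.outs x with hQ
  set X := (D.compOf Q).filter fun l => D.fin (D.col x) l = 1 with hX
  have h2 : D.comps (D.col x) 2 = #(D.compOf Q \ X) := by
    rw [comps, sum_boole, Nat.cast_id]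
    congr 1
    ext i
    rw [mem_filter, mem_range, mem_sdiff, hX, mem_filter, compOf, mem_compSet, L, hinn]
    constructor
    · rintro ⟨h1, h2, h3⟩
      have : D.innOf Q i := by rw [← hinn]; exact .inr h2
      exact ⟨⟨h1, this, h3⟩, fun h => by omega⟩
    · rintro ⟨⟨h1, h2, h3⟩, h4⟩
      rw [← hinn] at h2
      refine ⟨h1, h2.resolve_left fun h => h4 ⟨⟨h1, ?_, h3⟩, h⟩, h3⟩
      rw [← hinn]; exact h2
  have h1 : D.comps (D.col x) 1 = #X := by
    rw [comps, sum_boole, Nat.cast_id]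
    congr 1
    ext i
    rw [mem_filter, mem_range, hX, mem_filter, compOf, mem_compSet, L, hinn]
    constructor
    · rintro ⟨h1, h2, h3⟩
      have : D.innOf Q i := by rw [← hinn]; exact .inl h2
      exact ⟨⟨h1, this, h3⟩, h2⟩
    · rintro ⟨⟨h1, -, h3⟩, h4⟩
      exact ⟨h1, h4, h3⟩
  have hs : D.size (D.col x) = #(D.innSet Q) :=
    size_eq fun i => by
      rw [hD.mem_innSet, hinn]
      exact ⟨fun h => ⟨hD.innOf_lt h, h⟩, fun h => h.2⟩
  have hl : D.link (D.col x) = Link D.n D.r (D.innOf Q) := by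
    rw [← hinn]; rfl
  have ho : ∀ a, a ∈ (D.optOf Q).filter (touched D.n D.r (D.innOf Q) · ⊆ X) ↔
      D.opt (D.col x) a := by
    intro a
    rw [mem_filter, hD.mem_optOf, opt, hD.touch_iff]
    constructor
    · rintro ⟨⟨haN, hal, haq⟩, hsub⟩
      refine ⟨hD.fin_opt hM haN hal haq, ?_⟩
      rintro ⟨j, haj, hj⟩
      have hjn : D.innOf Q j := by rw [← hinn]; exact .inr hj
      have := hsub (mem_touched.mpr ⟨j, hD.innOf_lt hjn, haj, hjn, rfl⟩)
      rw [hX, mem_filter, hD.fin_lab hM hx hv hjn] at this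
      omega
    · rintro ⟨ha3, hno⟩
      have haN : a < D.N := fin_lt (c := D.col x) (by omega)
      have hal : D.leaf a := by
        by_contra hal
        have := hD.col_le hM hx haN hal
        rw [hD.fin_many hM hx haN hal] at ha3
        omega
      have haq : ¬ ∃ q ∈ Q, D.r a q := by
        intro hq
        rcases hD.fin_leaf hM haN hal hq with h | h | h <;> omega
      refine ⟨⟨haN, hal, haq⟩, fun l hl' => ?_⟩
      obtain ⟨u, -, hau, hu, rfl⟩ := mem_touched.mp hl'
      rw [hX, mem_filter, hD.fin_lab hM hx hv hu]
      refine ⟨lab_mem_compSet (fun i hi => hD.innOf_lt hi) hu, ?_⟩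
      rw [← hinn] at hu
      exact hu.resolve_right fun h => hno ⟨u, hau, h⟩
  refine ⟨h2, ?_⟩
  rw [wt, valueIn, h1, h2, hs, hl]
  congr 1
  refine sum_congr rfl fun j _ => sum_congr rfl fun a _ => ?_
  exact bw_eq_sum _ _ ho

end Many

/-- Every choice of components of colour `1` comes from a unique number. -/
theorem Ok.exists_of_good (hM : D.Many) {Q : Finset ℕ} (hQ : D.Good Q) (X : Finset ℕ) :
    ∃ x < D.cnt D.N, D.Valid (D.col x) ∧ D.outs x = Q ∧
      ∀ l ∈ D.compOf Q, D.fin (D.col x) l = 1 ↔ l ∈ X := by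
  classical
  set lb := lab D.r (D.innOf Q) D.n with hlb
  have hadj : ∀ {i j}, D.innOf Q i → D.innOf Q j → D.r i j → lb i = lb j := fun hi hj h =>
    lab_adj hD.symm hD.irrefl (hD.innOf_lt hi) (hD.innOf_lt hj) hi hj h
  have hin : ∀ {i}, i < D.N → ¬ D.leaf i → i ∉ Q → D.innOf Q i := fun h1 h2 h3 =>
    ⟨h1, .inl ⟨h2, h3⟩⟩
  -- Each vertex takes the colour prescribed for its component; as adjacent forced vertices share a
  -- label, the conditions of `exists_col` hold.
  set c : ℕ → ℕ := fun i => if i ∈ Q then 0 else if lb i ∈ X then 1 else 2 with hc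
  have hc0 : ∀ i, c i = 0 ↔ i ∈ Q := by
    intro i
    simp only [hc]
    split_ifs <;> simp [*]
  obtain ⟨x, hx, hxc⟩ := hD.exists_col hM (c := c)
    (fun i _ _ => by simp only [hc]; split_ifs <;> omega)
    (fun i j hij _ _ h => hQ.indep i ((hc0 i).mp h.1) j ((hc0 j).mp h.2) hij)
    (fun i j hij hi hj hi0 hj0 => by
      rw [Ne, hc0] at hi0 hj0
      have := hadj (hin (hD.lt _ _ hij) hi hi0) (hin (hD.lt' hij) hj hj0) hij
      simp only [hc, if_neg hi0, if_neg hj0, this])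
  have hout : D.outs x = Q := by
    ext i
    rw [mem_outs]
    constructor
    · rintro ⟨h1, h2, h3⟩
      rw [hxc i h1 h2, hc0] at h3
      exact h3
    · intro h
      have := hQ.sub i h
      exact ⟨this.1, this.2, by rw [hxc i this.1 this.2, hc0]; exact h⟩
  have hfn : ∀ {i}, i < D.N → ¬ D.leaf i → D.fin (D.col x) i = c i := fun hi hl => by
    rw [hD.fin_many hM hx hi hl, hxc _ hi hl]
  have hfin : ∀ i, D.innOf Q i → D.fin (D.col x) i = if lb i ∈ X then 1 else 2 := by
    rintro i ⟨hi, ⟨hl, hiQ⟩ | ⟨hl, hq⟩⟩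
    · rw [hfn hi hl]
      simp only [hc, if_neg hiQ]
    -- A forced leaf is not coloured by `c` but by `fin`. By `nbr` it has a neighbour in the cover,
    -- and all such neighbours lie in its component, so it gets the right colour.
    · obtain ⟨z, hz, hiz⟩ := hQ.nbr i hi hl hq
      have htouch : ∀ z, z ∉ Q → D.r i z → D.col x z = if lb i ∈ X then 1 else 2 := by
        intro z hz hiz
        have hzl := hD.leaf_indep hl hiz
        have hzN := hD.lt' hiz
        rw [hxc z hzN hzl]
        simp only [hc, if_neg hz]
        rw [hadj (hin hzN hzl hz) ⟨hi, .inr ⟨hl, hq⟩⟩ (hD.symm _ _ hiz)]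
      have htouch' : ∀ q, q ≠ 0 → D.touch (D.col x) q i → q = if lb i ∈ X then 1 else 2 := by
        intro q hq0 ht
        obtain ⟨z, hiz, hz⟩ := hD.touch_iff.mp ht
        rw [← hz]
        refine htouch z (fun hzQ => ?_) hiz
        rw [← hout, mem_outs] at hzQ
        omega
      have hz' := htouch z hz hiz
      rcases hD.fin_leaf hM hi hl (by rw [hout]; exact hq) with h | h | h
      · rw [h.2]; exact htouch' 1 (by omega) h.1
      · rw [h.2.2]; exact htouch' 2 (by omega) h.2.1
      · exfalso
        split_ifs at hz' with h'
        · exact h.1 (hD.touch_iff.mpr ⟨z, hiz, hz'⟩)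
        · exact h.2.1 (hD.touch_iff.mpr ⟨z, hiz, hz'⟩)
  have hcase : ∀ i, D.fin (D.col x) i ≤ 2 → i ∈ Q ∨ D.innOf Q i := by
    intro i hi2
    have hi : i < D.N := fin_lt (c := D.col x) (by omega)
    by_cases hl : D.leaf i
    · by_cases hq : ∃ q ∈ Q, D.r i q
      · exact .inr ⟨hi, .inr ⟨hl, hq⟩⟩
      · have := hD.fin_opt hM (x := x) hi hl (by rw [hout]; exact hq)
        omega
    · by_cases hiQ : i ∈ Q
      · exact .inl hiQ
      · exact .inr (hin hi hl hiQ)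
  have hfQ : ∀ i ∈ Q, D.fin (D.col x) i = 0 := fun i hi => by
    rw [hfn (hQ.sub i hi).1 (hQ.sub i hi).2, hc0]; exact hi
  refine ⟨x, hx, ?_, hout, ?_⟩
  · rw [hD.valid_iff]
    intro i j hij
    constructor
    · rintro ⟨h1, h2⟩
      have key : ∀ i, D.fin (D.col x) i = 0 → i ∈ Q := by
        intro i h
        rcases hcase i (by omega) with h' | h'
        · exact h'
        · rw [hfin i h'] at h
          split_ifs at h
      exact hQ.indep i (key i h1) j (key j h2) hij
    · rintro ⟨h1, h2⟩
      have key : ∀ i, D.fin (D.col x) i ≤ 2 → D.fin (D.col x) i ≠ 0 → D.innOf Q i := by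
        intro i h h0
        exact (hcase i h).resolve_left fun h' => h0 (hfQ i h')
      have hi := key i (by omega) (by omega)
      have hj := key j (by omega) (by omega)
      rw [hfin i hi] at h1
      rw [hfin j hj, ← hadj hi hj hij] at h2
      split_ifs at h1 h2 <;> omega
  · intro l hl
    obtain ⟨-, h1, h2⟩ := mem_compSet.mp hl
    rw [hfin l h1]
    rw [← hlb] at h2
    rw [h2]
    split_ifs with h <;> simp [h]

-- For good `Q` the valid numbers with out set `Q` correspond bijectively to the subsets `X` of the
-- components, so their signed weights form the alternating sum of `sum_valueIn`. For other `Q`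
-- there is no valid number.
open Classical in
theorem Ok.sum_fiber (hM : D.Many) (k : ℕ) (Q : Finset ℕ) :
    ∑ x ∈ range (D.cnt D.N) with D.outs x = Q,
      ((D.signed k 0 (D.col x) : ℤ) - D.signed k 1 (D.col x)) =
      if D.Good Q then (D.value k Q : ℤ) else 0 := by
  have hsgn : ∀ x, (D.signed k 0 (D.col x) : ℤ) - D.signed k 1 (D.col x) =
      if D.Valid (D.col x) then (-1 : ℤ) ^ D.comps (D.col x) 2 * D.wt k (D.col x) else 0 := by
    intro x
    rw [signed, signed]
    by_cases hv : D.Valid (D.col x)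
    · simp only [hv, true_and, if_true]
      rcases Nat.mod_two_eq_zero_or_one (D.comps (D.col x) 2) with h | h
      · rw [h, (Nat.even_iff.mpr h).neg_one_pow]; simp
      · rw [h, (Nat.odd_iff.mpr h).neg_one_pow]; simp
    · simp [hv]
  simp only [hsgn]
  rw [← sum_filter, filter_filter]
  split_ifs with hQ
  · rw [← sum_valueIn hD k Q]
    refine sum_bij (fun x _ => (D.compOf Q).filter fun l => D.fin (D.col x) l = 1) ?_ ?_ ?_ ?_
    · intro x _
      exact mem_powerset.mpr (filter_subset _ _)
    -- The set of components of colour 1 determines the colours of all vertices that are not leaves,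
    -- and these determine the number.
    · intro x hx y hy hxy
      simp only [mem_filter, mem_range] at hx hy
      obtain ⟨hx, hxQ, hxv⟩ := hx
      obtain ⟨hy, hyQ, hyv⟩ := hy
      refine hD.col_injective hM hx hy fun i hi hl => ?_
      by_cases hiQ : i ∈ Q
      · rw [(mem_outs.mp (hxQ ▸ hiQ)).2.2, (mem_outs.mp (hyQ ▸ hiQ)).2.2]
      · have hin : D.innOf Q i := ⟨hi, .inl ⟨hl, hiQ⟩⟩
        have e : D.fin (D.col x) i = 1 ↔ D.fin (D.col y) i = 1 := by
          have h1 := hD.fin_lab hM hx hxv (u := i) (by rwa [hxQ])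
          have h2 := hD.fin_lab hM hy hyv (u := i) (by rwa [hyQ])
          rw [hxQ] at h1
          rw [hyQ] at h2
          rw [← h1, ← h2]
          have hm := lab_mem_compSet (r := D.r) (fun i hi => hD.innOf_lt hi) hin
          have := congrArg (fun S => lab D.r (D.innOf Q) D.n i ∈ S) hxy
          simp only [mem_filter, compOf, hm, true_and] at this
          rw [this]
        have i1 : D.inn (D.col x) i := by rw [hD.inn_of_valid hM hx hxv, hxQ]; exact hin
        have i2 : D.inn (D.col y) i := by rw [hD.inn_of_valid hM hy hyv, hyQ]; exact hin
        rw [inn, hD.fin_many hM hx hi hl] at i1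
        rw [inn, hD.fin_many hM hy hi hl] at i2
        rw [hD.fin_many hM hx hi hl, hD.fin_many hM hy hi hl] at e
        omega
    · intro X hX
      obtain ⟨x, hx, hv, hout, hfin⟩ := hD.exists_of_good hM hQ X
      refine ⟨x, by simp only [mem_filter, mem_range]; exact ⟨hx, hout, hv⟩, ?_⟩
      ext l
      rw [mem_filter]
      constructor
      · rintro ⟨h1, h2⟩
        exact (hfin l h1).mp h2
      · intro h
        have := mem_powerset.mp hX h
        exact ⟨this, (hfin l this).mpr h⟩
    · intro x hx
      simp only [mem_filter, mem_range] at hx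
      obtain ⟨hx, rfl, hv⟩ := hx
      obtain ⟨h1, h2⟩ := hD.wt_eq hM hx hv k
      rw [h1, h2]
  · refine sum_eq_zero fun x hx => ?_
    simp only [mem_filter, mem_range] at hx
    exact absurd (hx.2.1 ▸ hD.good_of_valid hM hx.1 hx.2.2) hQ

/-- A counted walk with node set `Y` yields the cover `innSet Q ∪ Y`: it is connected by
`conn_union`, and the range of walk lengths keeps it within `k` vertices. -/
theorem Ok.value_pos {k : ℕ} {Q : Finset ℕ} (hQ : D.Good Q) (h : D.value k Q ≠ 0) :
    ∃ U, D.IsCover U ∧ #U ≤ k := by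
  classical
  -- The forced part alone is a vertex cover: `Q` and the leaves are independent sets, and leaves
  -- next to `Q` are forced.
  have hcov : ∀ Y : Finset ℕ, (∀ i j, D.r i j → i ∈ D.innSet Q ∪ Y ∨ j ∈ D.innSet Q ∪ Y) := by
    intro Y i j hij
    by_contra hcon
    push Not at hcon
    simp only [mem_union, hD.mem_innSet, not_or] at hcon
    obtain ⟨⟨hi, -⟩, hj, -⟩ := hcon
    have hiN := hD.lt _ _ hij
    have hjN := hD.lt' hij
    have key : ∀ {i}, i < D.N → ¬ D.innOf Q i → ¬ D.leaf i → i ∈ Q := fun h1 h2 h3 => by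
      by_contra h4
      exact h2 ⟨h1, .inl ⟨h3, h4⟩⟩
    by_cases hli : D.leaf i
    · have hjQ := key hjN hj (hD.leaf_indep hli hij)
      exact hi ⟨hiN, .inr ⟨hli, j, hjQ, hij⟩⟩
    · have hiQ := key hiN hi hli
      by_cases hlj : D.leaf j
      · exact hj ⟨hjN, .inr ⟨hlj, i, hiQ, hD.symm _ _ hij⟩⟩
      · exact hQ.indep i hiQ j (key hjN hj hlj) hij
  have hlink : ∀ a b, Link D.n D.r (D.innOf Q) a b → Link D.n D.r (D.innOf Q) b a := by
    rintro a b ⟨u, hu, v, hv, h1, h2, h3, h4, h5⟩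
    exact ⟨v, hv, u, hu, h2, h1, h4, h3, h5.symm⟩
  rw [value] at h
  by_cases h1 : #(D.innSet Q) ≤ k ∧ #(D.compOf Q) = 1
  · refine ⟨D.innSet Q, ⟨fun i hi => (hD.mem_innSet.mp hi).1, ?_,
      conn_of_card (fun i hi => hD.innOf_lt hi) hD.symm (fun i => hD.mem_innSet) h1.2⟩, h1.1⟩
    simpa using hcov ∅
  · rw [if_neg h1, zero_add] at h
    obtain ⟨j, hj, h⟩ := exists_ne_zero_of_sum_ne_zero h
    obtain ⟨a, ha, h⟩ := exists_ne_zero_of_sum_ne_zero h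
    obtain ⟨Y, hY, h⟩ := exists_ne_zero_of_sum_ne_zero h
    rw [mem_filter, mem_powerset] at hY
    obtain ⟨-, hcard, hconn⟩ := cw_sound hlink (Nat.pos_of_ne_zero h)
    refine ⟨D.innSet Q ∪ Y, ⟨fun i hi => ?_, hcov Y, conn_union (fun i hi => hD.innOf_lt hi) hD.symm
      (fun i => hD.mem_innSet) hconn hY.2⟩, ?_⟩
    · rcases mem_union.mp hi with hi | hi
      · exact (hD.mem_innSet.mp hi).1
      · exact (hD.mem_optOf.mp (hY.1 hi)).1
    · have := mem_range.mp hj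
      have := card_union_le (D.innSet Q) Y
      omega

/-- A connected vertex cover with one vertex may be assumed not to consist of a leaf. -/
theorem Ok.cover_ne_leaf {U : Finset ℕ} (hU : D.IsCover U) :
    ∃ U', D.IsCover U' ∧ #U' ≤ #U ∧ ∀ f, D.leaf f → U' ≠ {f} := by
  by_cases h : ∃ f, D.leaf f ∧ U = {f}
  · obtain ⟨f, hf, rfl⟩ := h
    -- As `{f}` covers the edge between 0 and 1, the leaf `f` is 1. Its only neighbour is 0, so all
    -- edges join 0 and 1 and `{0}` serves as well.
    have h01 : D.r 0 1 := hD.next_of_not_leaf hD.zero_not_leaf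
    have hf1 : f = 1 := by
      rcases hU.2.1 0 1 h01 with h | h
      · rw [mem_singleton] at h
        exact absurd (h ▸ hf) hD.zero_not_leaf
      · exact (mem_singleton.mp h).symm
    subst hf1
    have key : ∀ j, D.r 1 j → j = 0 := by
      intro j hj
      by_contra hj0
      rcases Nat.lt_or_ge 1 j with h | h
      · exact hD.not_leaf h hj hf
      · obtain rfl : j = 1 := by omega
        exact hD.irrefl _ hj
    refine ⟨{0}, ⟨fun i hi => ?_, fun i j hij => ?_, ?_⟩, by simp, fun f' hf' he => ?_⟩
    · rw [mem_singleton] at hi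
      have := hD.two_le
      omega
    · rw [mem_singleton, mem_singleton]
      rcases hU.2.1 i j hij with h | h
      · rw [mem_singleton] at h
        exact .inr (key j (h ▸ hij))
      · rw [mem_singleton] at h
        exact .inl (key i (h ▸ hD.symm _ _ hij))
    · rintro p ⟨b, hb, hp⟩ - c hc
      rw [mem_singleton] at hb hc
      rwa [hc, ← hb]
    · rw [singleton_inj] at he
      exact hD.zero_not_leaf (he ▸ hf')
  · exact ⟨U, hU, le_rfl, fun f hf he => h ⟨f, hf, he⟩⟩

/-- With `Q` the vertices outside `U` that are not leaves, `U` splits into the forced part and a set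
`Y` of optional leaves. By `link_of_conn` the set `Y` is connected by links and touches all
components, so `cw_complete` provides a walk with `#Y` nodes. -/
theorem Ok.value_ne_zero {k : ℕ} {U : Finset ℕ} (hU : D.IsCover U) (hk : #U ≤ k)
    (hUl : ∀ f, D.leaf f → U ≠ {f}) :
    ∃ Q ∈ (range D.N).powerset, D.Good Q ∧ D.value k Q ≠ 0 := by
  classical
  obtain ⟨hU1, hU2, hU3⟩ := hU
  set Q : Finset ℕ := {i ∈ range D.N | ¬ D.leaf i ∧ i ∉ U} with hQ
  have mQ : ∀ {i}, i ∈ Q ↔ i < D.N ∧ ¬ D.leaf i ∧ i ∉ U := by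
    intro i; rw [hQ, mem_filter, mem_range]
  have hinU : ∀ {i}, D.innOf Q i → i ∈ U := by
    rintro i ⟨hi, ⟨hl, hiQ⟩ | ⟨hl, q, hq, hr⟩⟩
    · by_contra h
      exact hiQ (mQ.mpr ⟨hi, hl, h⟩)
    · exact (hU2 i q hr).resolve_right (mQ.mp hq).2.2
  have hUnl : ∀ {i}, i ∈ U → ¬ D.leaf i → D.innOf Q i := fun hi hl =>
    ⟨hU1 _ hi, .inl ⟨hl, fun h => (mQ.mp h).2.2 hi⟩⟩
  have hgood : D.Good Q := by
    refine ⟨fun i hi => ⟨(mQ.mp hi).1, (mQ.mp hi).2.1⟩, fun i hi j hj hij => ?_, ?_⟩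
    · rcases hU2 i j hij with h | h
      · exact (mQ.mp hi).2.2 h
      · exact (mQ.mp hj).2.2 h
    · intro f hf hl hq
      have hfU : f ∈ U := hinU ⟨hf, .inr ⟨hl, hq⟩⟩
      -- A leaf all of whose neighbours are in `Q` is isolated in `U`, which forces `U = {f}`. This
      -- is the case excluded by `hUl`.
      by_contra hcon
      push Not at hcon
      have hall := hU3 (· = f) ⟨f, hfU, rfl⟩ (by
        rintro a - rfl b hb hab
        exact absurd (hcon b fun h => (mQ.mp h).2.2 hb) (not_not.mpr hab))
      exact hUl f hl (eq_singleton_iff_unique_mem.mpr ⟨hfU, hall⟩)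
  refine ⟨Q, mem_powerset.mpr fun i hi => mem_range.mpr (mQ.mp hi).1, hgood, ?_⟩
  set Y : Finset ℕ := U.filter fun i => ¬ D.innOf Q i with hY
  have mY : ∀ {i}, i ∈ Y ↔ i ∈ U ∧ ¬ D.innOf Q i := by intro i; rw [hY, mem_filter]
  have hIY : D.innSet Q ∪ Y = U := by
    ext i
    rw [mem_union, hD.mem_innSet, mY]
    constructor
    · rintro (h | h)
      · exact hinU h
      · exact h.1
    · intro h
      by_cases hi : D.innOf Q i
      · exact .inl hi
      · exact .inr ⟨h, hi⟩
  have hdisj : Disjoint (D.innSet Q) Y := by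
    rw [disjoint_left]
    intro i h1 h2
    exact (mY.mp h2).2 (hD.mem_innSet.mp h1)
  have hcard : #(D.innSet Q) + #Y = #U := by rw [← card_union_of_disjoint hdisj, hIY]
  have hYl : ∀ {y}, y ∈ Y → D.leaf y := fun hy => by
    by_contra hl
    exact (mY.mp hy).2 (hUnl (mY.mp hy).1 hl)
  have hYopt : Y ⊆ D.optOf Q := fun y hy => hD.mem_optOf.mpr
    ⟨hU1 y (mY.mp hy).1, hYl hy, fun hq => (mY.mp hy).2 ⟨hU1 y (mY.mp hy).1, .inr ⟨hYl hy, hq⟩⟩⟩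
  rw [value]
  rcases Y.eq_empty_or_nonempty with hYe | hYne
  · rw [hYe, union_empty] at hIY
    rw [if_pos]
    · omega
    · refine ⟨by omega, card_of_conn (fun i hi => hD.innOf_lt hi) hD.symm hD.irrefl
        (fun i => hD.mem_innSet) ?_ (hIY ▸ hU3)⟩
      rw [hIY]
      have h01 : D.r 0 1 := hD.next_of_not_leaf hD.zero_not_leaf
      rcases hU2 0 1 h01 with h | h
      · exact ⟨0, h⟩
      · exact ⟨1, h⟩
  · obtain ⟨hc1, hc2⟩ := link_of_conn (fun i hi => hD.innOf_lt hi) hD.symm hD.irrefl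
      (fun i => hD.mem_innSet (Q := Q)) (fun y hy => (mY.mp hy).2)
      (fun y hy y' hy' h => hD.leaf_indep (hYl hy) h (hYl hy')) hYne (hIY ▸ hU3)
    obtain ⟨a, ha⟩ := hYne
    have hYn : ∀ y ∈ Y, y < D.n := fun y hy => (hU1 y (mY.mp hy).1).trans_le hD.N_le
    have hpos := cw_complete (n := D.n) ha hYn hc1
    have hY1 : 0 < #Y := card_pos.mpr ⟨a, ha⟩
    refine (Nat.add_pos_right _ ?_).ne'
    rw [Finset.sum_pos_iff]
    refine ⟨#Y - 1, mem_range.mpr (by omega), ?_⟩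
    rw [Finset.sum_pos_iff]
    refine ⟨a, mem_range.mpr (hYn a ha), ?_⟩
    rw [Finset.sum_pos_iff]
    refine ⟨Y, mem_filter.mpr ⟨mem_powerset.mpr hYopt, hc2⟩, ?_⟩
    rwa [show #Y - 1 + 1 = #Y by omega]

/-- The signed count of branching walks decides whether there is a connected vertex cover. -/
theorem Ok.sum_signed (k : ℕ) :
    ∑ x ∈ range (D.cnt D.N), D.signed k 0 (D.col x) ≠
      ∑ x ∈ range (D.cnt D.N), D.signed k 1 (D.col x) ↔ ∃ U, D.IsCover U ∧ #U ≤ k := by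
  classical
  by_cases hM : D.Many
  · have hsum : ((∑ x ∈ range (D.cnt D.N), D.signed k 0 (D.col x) : ℕ) : ℤ) -
        ((∑ x ∈ range (D.cnt D.N), D.signed k 1 (D.col x) : ℕ) : ℤ) =
        ∑ Q ∈ (range D.N).powerset, if D.Good Q then (D.value k Q : ℤ) else 0 := by
      rw [Nat.cast_sum, Nat.cast_sum, ← sum_sub_distrib, ← sum_fiberwise_of_maps_to (g := D.outs) (t := (range D.N).powerset)]
      · exact sum_congr rfl fun Q _ => hD.sum_fiber hM k Q
      · intro x _
        exact mem_powerset.mpr fun i hi => mem_range.mpr (mem_outs.mp hi).1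
    have hne : ∑ x ∈ range (D.cnt D.N), D.signed k 0 (D.col x) ≠
        ∑ x ∈ range (D.cnt D.N), D.signed k 1 (D.col x) ↔
        ∑ Q ∈ (range D.N).powerset, (if D.Good Q then (D.value k Q : ℤ) else 0) ≠ 0 := by
      rw [← hsum, sub_ne_zero, Ne, Ne, Nat.cast_inj]
    -- The values are natural numbers, so different `Q` cannot cancel.
    rw [hne, Ne, sum_eq_zero_iff_of_nonneg fun Q _ => by split_ifs <;> positivity]
    push Not
    constructor
    · rintro ⟨Q, -, h⟩
      split_ifs at h with hQ
      · exact hD.value_pos hQ (by exact_mod_cast h)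
      · exact absurd rfl h
    · rintro ⟨U, hU, hk⟩
      obtain ⟨U', hU', hle, hl⟩ := hD.cover_ne_leaf hU
      obtain ⟨Q, hQ, hg, hv⟩ := hD.value_ne_zero hU' (hle.trans hk) hl
      exact ⟨Q, hQ, by rw [if_pos hg]; exact_mod_cast hv⟩
  · have h1 : ∑ x ∈ range (D.cnt D.N), D.signed k 1 (D.col x) = 0 :=
      sum_eq_zero fun x _ => (signed_few hM k x).1
    rw [h1, ← hD.cover_few hM k, ← Nat.pos_iff_ne_zero, Finset.sum_pos_iff]
    simp only [mem_range]

end Ord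

end ConnectedCover

namespace ConnectedCover

open Finset

/-! ### The number of digit strings -/

namespace Ord

variable {D : Ord}

open Classical in
/-- The number of leaves among the last `t` vertices. -/
noncomputable def lastLeaves (D : Ord) : ℕ → ℕ
  | 0 => 0
  | t + 1 => lastLeaves D t + if D.leaf (D.N - (t + 1)) then 1 else 0

theorem leaves_eq (hN : D.N ≤ D.n) : D.leaves = D.lastLeaves D.N := by
  classical
  have h1 : D.leaves = ∑ i ∈ range D.N, if D.leaf i then 1 else 0 := by
    rw [leaves, ← sum_subset (range_subset_range.mpr hN)]
    · exact sum_congr rfl fun i hi => by simp [mem_range.mp hi]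
    · intro i _ hi
      rw [if_neg fun h => hi (mem_range.mpr h.1)]
  have h2 : ∀ t ≤ D.N, D.lastLeaves t = ∑ i ∈ range t, if D.leaf (D.N - (i + 1)) then 1 else 0 := by
    intro t
    induction t with
    | zero => intro _; rfl
    | succ t ih => intro ht; rw [lastLeaves, ih (by omega), sum_range_succ]
  rw [h1, h2 _ le_rfl, ← sum_range_reflect]
  exact sum_congr rfl fun i _ => by rw [show D.N - 1 - i = D.N - (i + 1) by omega]

theorem cnt_many (hM : D.Many) : D.cnt D.N * 2 ^ D.lastLeaves D.N ≤ 2 * 2 ^ D.N := by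
  -- The extra factor 2 at `t = D.N` absorbs the three colours of the root.
  have key : ∀ t ≤ D.N, D.cnt t * 2 ^ D.lastLeaves t ≤ (if t = D.N then 2 else 1) * 2 ^ t := by
    intro t
    induction t with
    | zero =>
      intro _
      rw [cnt, lastLeaves]
      split_ifs <;> simp
    | succ t ih =>
      intro ht
      have h := ih (by omega)
      rw [if_neg (by omega)] at h
      rw [cnt, if_pos hM, lastLeaves, pow_succ]
      have h2 : 1 * 2 ^ t * 2 ≤ (if t + 1 = D.N then 2 else 1) * (2 ^ t * 2) := by
        split_ifs <;> omega
      by_cases hl : D.leaf (D.N - (t + 1))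
      · rw [if_pos hl, if_pos hl, pow_succ, ← mul_assoc]
        omega
      · rw [if_neg hl, if_neg hl, add_zero]
        by_cases h0 : D.N - (t + 1) = 0
        · rw [if_pos h0, if_pos (by omega), mul_assoc]
          omega
        · rw [if_neg h0, mul_assoc]
          omega
  simpa using key D.N le_rfl

/-- The constants satisfy `2 ≤ 1.2361 * 1.6181` for a leaf and `1.6181 + 1 ≤ 1.6181 ^ 2` for the
Fibonacci step. -/
theorem Ok.cnt_few (hD : D.Ok) (hM : ¬ D.Many) :
    (D.cnt D.N : ℝ) ≤ 1.2361 ^ D.lastLeaves D.N * 1.6181 ^ D.N := by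
  have key : ∀ t ≤ D.N, (D.cnt t : ℝ) ≤ 1.2361 ^ D.lastLeaves t * 1.6181 ^ t := by
    intro t
    induction t using Nat.strong_induction_on with
    | _ t ih =>
      intro ht
      cases t with
      | zero => rw [cnt, lastLeaves]; simp
      | succ t =>
        have h1 := ih t (by omega) (by omega)
        rw [cnt, if_neg hM, lastLeaves, pow_succ]
        have hp : (0 : ℝ) < 1.2361 ^ D.lastLeaves t * 1.6181 ^ t := by positivity
        by_cases hl : D.leaf (D.N - (t + 1))
        · rw [if_pos hl, if_pos hl, pow_succ]
          push_cast
          nlinarith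
        · rw [if_neg hl, if_neg hl, add_zero]
          have hr := hD.lt' (hD.next_of_not_leaf hl)
          obtain ⟨s, rfl⟩ : ∃ s, t = s + 1 := ⟨t - 1, by omega⟩
          have h2 := ih s (by omega) (by omega)
          have h3 : (1.2361 : ℝ) ^ D.lastLeaves s ≤ 1.2361 ^ D.lastLeaves (s + 1) :=
            pow_le_pow_right₀ (by norm_num) (by rw [lastLeaves]; omega)
          have h4 : (0 : ℝ) < 1.6181 ^ s := by positivity
          have h5 := h2.trans (mul_le_mul_of_nonneg_right h3 h4.le)
          rw [pow_succ] at h1 hp ⊢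
          rw [Nat.add_sub_cancel]
          push_cast
          nlinarith
  exact key D.N le_rfl

/-- The fourth power avoids fractional exponents of `2 ^ (3 / 4)` type. With at least `N / 4` leaves
the base is `16 / 2 = 8`, and with fewer it is `1.2361 * 1.6181 ^ 4 ≤ 8.475`. -/
theorem Ok.cnt_pow_le (hD : D.Ok) : (D.cnt D.N : ℝ) ^ 4 ≤ 16 * 8.475 ^ D.N := by
  by_cases hM : D.Many
  · have h := cnt_many hM
    have hl : D.N ≤ 4 * D.lastLeaves D.N := by rw [← leaves_eq hD.N_le]; exact hM
    have h1 : D.cnt D.N ^ 4 * 2 ^ D.N ≤ 16 * 16 ^ D.N := by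
      calc D.cnt D.N ^ 4 * 2 ^ D.N ≤ D.cnt D.N ^ 4 * 2 ^ (4 * D.lastLeaves D.N) :=
            Nat.mul_le_mul_left _ (Nat.pow_le_pow_right (by omega) hl)
        _ = (D.cnt D.N * 2 ^ D.lastLeaves D.N) ^ 4 := by rw [mul_pow, ← pow_mul, mul_comm 4]
        _ ≤ (2 * 2 ^ D.N) ^ 4 := Nat.pow_le_pow_left h 4
        _ = 16 * 16 ^ D.N := by
          rw [mul_pow, ← pow_mul, mul_comm D.N, pow_mul]; norm_num
    have h2 : D.cnt D.N ^ 4 ≤ 16 * 8 ^ D.N := by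
      rw [show 16 = 8 * 2 from rfl, mul_pow, ← mul_assoc] at h1
      exact Nat.le_of_mul_le_mul_right h1 (by positivity)
    calc (D.cnt D.N : ℝ) ^ 4 ≤ 16 * 8 ^ D.N := by exact_mod_cast h2
      _ ≤ 16 * 8.475 ^ D.N := by gcongr; norm_num
  · have h := hD.cnt_few hM
    have hl : 4 * D.lastLeaves D.N ≤ D.N := by
      rw [← leaves_eq hD.N_le]; unfold Many at hM; omega
    calc (D.cnt D.N : ℝ) ^ 4 ≤ (1.2361 ^ D.lastLeaves D.N * 1.6181 ^ D.N) ^ 4 := by gcongr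
      _ = 1.2361 ^ (4 * D.lastLeaves D.N) * (1.6181 ^ 4) ^ D.N := by
        rw [mul_pow, ← pow_mul, ← pow_mul, ← pow_mul, mul_comm 4, mul_comm 4]
      _ ≤ 1.2361 ^ D.N * (1.6181 ^ 4) ^ D.N := by gcongr; norm_num
      _ = (1.2361 * 1.6181 ^ 4) ^ D.N := by rw [mul_pow]
      _ ≤ 8.475 ^ D.N := by gcongr; norm_num
      _ ≤ 16 * 8.475 ^ D.N := by
        have : (0 : ℝ) < 8.475 ^ D.N := by positivity
        linarith

end Ord

/-- The running time. -/
theorem exists_time_bound (c d : ℕ) : ∃ C : ℝ, 0 ≤ C ∧ ∀ n X : ℕ, (X : ℝ) ^ 4 ≤ 16 * 8.475 ^ n →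
    (c : ℝ) * (n + 1) ^ d * (X + 1) ≤ C * 1.7088 ^ n := by
  -- The number 1.7063 slightly exceeds the fourth root of 8.475. Since `r < 1`, the sequence `n ^ d
  -- * r ^ n` is bounded, and this absorbs the polynomial factor.
  set r : ℝ := 1.7063 / 1.7088 with hr
  have hr0 : 0 < r := by rw [hr]; norm_num
  have hlim := tendsto_pow_const_mul_const_pow_of_lt_one d hr0.le (by rw [hr]; norm_num)
  obtain ⟨B, hB⟩ := hlim.bddAbove_range
  have hB' : ∀ n : ℕ, ((n : ℝ) + 1) ^ d * r ^ n ≤ B / r := by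
    intro n
    rw [le_div_iff₀ hr0, mul_assoc, ← pow_succ]
    have := hB ⟨n + 1, rfl⟩
    push_cast at this
    exact this
  have hB0 : 0 ≤ B / r := le_trans (by positivity) (hB' 0)
  refine ⟨3 * c * (B / r), by positivity, fun n X hX => ?_⟩
  have hX' : (X : ℝ) ≤ 2 * 1.7063 ^ n := by
    refine le_of_pow_le_pow_left₀ (n := 4) (by omega) (by positivity) (hX.trans ?_)
    rw [mul_pow, ← pow_mul, mul_comm n, pow_mul]
    have : (8.475 : ℝ) ^ n ≤ (1.7063 ^ 4) ^ n := by gcongr; norm_num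
    norm_num at this ⊢
    exact this
  have h1 : (1 : ℝ) ≤ 1.7063 ^ n := one_le_pow₀ (by norm_num)
  have h2 : (1.7063 : ℝ) ^ n = r ^ n * 1.7088 ^ n := by
    rw [← mul_pow, hr]; norm_num
  calc (c : ℝ) * (n + 1) ^ d * (X + 1) ≤ c * (n + 1) ^ d * (3 * 1.7063 ^ n) := by
        gcongr; linarith
    _ = 3 * c * ((n + 1) ^ d * r ^ n) * 1.7088 ^ n := by rw [h2]; ring
    _ ≤ 3 * c * (B / r) * 1.7088 ^ n := by gcongr; exact hB' n

end ConnectedCover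

namespace ConnectedCover

open Finset

/-! ### The search order -/

section Order

variable (n : ℕ) (a : ℕ → ℕ → Prop)

/-- The search order: the next vertex is a new neighbour of the last one if possible, and otherwise
a new neighbour of an earlier one; the value is `n` if there is none. -/
noncomputable def ord (i : ℕ) : ℕ :=
  firstIdx n fun u => (∀ j, ∀ _h : j < i, ord j ≠ u) ∧
    if _h0 : i = 0 then ∃ w < n, a u w else
      a (ord (i - 1)) u ∨
        (¬ ∃ w < n, a (ord (i - 1)) w ∧ ∀ j, ∀ _h : j < i, ord j ≠ w) ∧
          ∃ j, ∃ _h : j < i, a (ord j) u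
termination_by i
decreasing_by all_goals omega

/-- The condition for being the next vertex in the search order. -/
def Step (o : ℕ → ℕ) (i u : ℕ) : Prop :=
  (∀ j < i, o j ≠ u) ∧
    if i = 0 then ∃ w < n, a u w else
      a (o (i - 1)) u ∨ (¬ ∃ w < n, a (o (i - 1)) w ∧ ∀ j < i, o j ≠ w) ∧ ∃ j < i, a (o j) u

theorem ord_eq (i : ℕ) : ord n a i = firstIdx n (Step n a (ord n a) i) := by
  rw [ord]
  congr 1
  ext u
  simp only [Step, dite_eq_ite, exists_prop]

/-- The number of vertices found. -/
noncomputable def ordLen : ℕ := firstIdx n fun i => ord n a i = n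

/-- The graph with the vertices in search order. -/
@[simps] noncomputable def ordGraph : Ord where
  n := n
  N := ordLen n a
  r i j := i < ordLen n a ∧ j < ordLen n a ∧ a (ord n a i) (ord n a j)

variable {n a}

theorem ord_lt {i : ℕ} (hi : i < ordLen n a) : ord n a i < n := by
  have hle : ord n a i ≤ n := by rw [ord_eq]; exact firstIdx_le
  refine lt_of_le_of_ne hle fun h => ?_
  have hin : i < n := hi.trans_le firstIdx_le
  exact (firstIdx_spec (P := fun i => ord n a i = n) ⟨i, hin, h⟩).2.2 i hi h

theorem step_ord {i : ℕ} (hi : i < ordLen n a) : Step n a (ord n a) i (ord n a i) := by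
  have h := ord_lt hi
  by_cases hex : ∃ u < n, Step n a (ord n a) i u
  · have := (firstIdx_spec hex).2.1
    rwa [← ord_eq] at this
  · have := firstIdx_eq hex
    rw [← ord_eq] at this
    omega

theorem ord_injOn {i j : ℕ} (hi : i < ordLen n a) (hj : j < ordLen n a)
    (h : ord n a i = ord n a j) : i = j := by
  rcases lt_trichotomy i j with hij | hij | hij
  · exact absurd h ((step_ord hj).1 i hij)
  · exact hij
  · exact absurd h.symm ((step_ord hi).1 j hij)

theorem not_step (h : ordLen n a < n) (u : ℕ) (hu : u < n) :
    ¬ Step n a (ord n a) (ordLen n a) u := by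
  intro hs
  have h1 : ∃ i < n, ord n a i = n := by
    by_contra hne
    have := firstIdx_eq hne
    unfold ordLen at h
    omega
  have h2 : ord n a (ordLen n a) = n := (firstIdx_spec h1).2.1
  rw [ord_eq] at h2
  have := (firstIdx_spec ⟨u, hu, hs⟩).1
  omega

/-- The vertices found. -/
def Found (n : ℕ) (a : ℕ → ℕ → Prop) (u : ℕ) : Prop := ∃ i < ordLen n a, ord n a i = u

variable (hs : ∀ u w, a u w → a w u) (hirr : ∀ u, ¬ a u u) (hlt : ∀ u w, a u w → u < n)
include hs hlt

/-- The first vertex is required to have a neighbour, so the search cannot stop after it. -/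
theorem one_lt_ordLen (hirr : ∀ u, ¬ a u u) (he : ∃ u w, a u w) : 1 < ordLen n a := by
  obtain ⟨u, w, h⟩ := he
  have hu := hlt _ _ h
  have hw := hlt _ _ (hs _ _ h)
  have hne : u ≠ w := by rintro rfl; exact hirr _ h
  have h0 : 0 < ordLen n a := by
    by_contra h0
    have h0 : ordLen n a = 0 := by omega
    refine not_step (n := n) (a := a) (by omega) u hu ?_
    rw [h0]
    exact ⟨fun j hj => absurd hj (by omega), by rw [if_pos rfl]; exact ⟨w, hw, h⟩⟩
  by_contra h1
  have h1 : ordLen n a = 1 := by omega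
  have hst := (step_ord h0).2
  rw [if_pos rfl] at hst
  obtain ⟨v, hv, hav⟩ := hst
  refine not_step (n := n) (a := a) (by omega) v hv ?_
  rw [h1]
  refine ⟨fun j hj => ?_, by rw [if_neg one_ne_zero]; exact .inl hav⟩
  obtain rfl : j = 0 := by omega
  rintro rfl
  exact hirr _ hav

/-- For `next`: a later neighbour of `i` was still new when vertex `i + 1` was chosen, so the search
preferred a neighbour of `i`. -/
theorem ordGraph_ok (hirr : ∀ u, ¬ a u u) (he : ∃ u w, a u w) : (ordGraph n a).Ok where
  symm := fun i j h => ⟨h.2.1, h.1, hs _ _ h.2.2⟩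
  irrefl := fun i h => hirr _ h.2.2
  lt := fun i j h => h.1
  N_le := firstIdx_le
  two_le := one_lt_ordLen hs hlt hirr he
  prev := by
    intro i hi h0
    have := (step_ord (show i < ordLen n a from hi)).2
    rw [if_neg h0.ne'] at this
    rcases this with h | ⟨-, j, hj, h⟩
    · exact ⟨i - 1, by omega, hi, (show i - 1 < i by omega).trans hi, hs _ _ h⟩
    · exact ⟨j, hj, hi, hj.trans hi, hs _ _ h⟩
  next := by
    rintro i j hij ⟨hi, hj, h⟩
    have hi' : i + 1 < ordLen n a := by
      have : j < ordLen n a := hj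
      omega
    have := (step_ord hi').2
    rw [if_neg (Nat.succ_ne_zero i), Nat.add_sub_cancel] at this
    rcases this with h' | ⟨h', -⟩
    · exact ⟨hi, hi', h'⟩
    · refine absurd ⟨ord n a j, ord_lt hj, h, fun l hl hl' => ?_⟩ h'
      have := ord_injOn (hl.trans hi') hj hl'
      omega

/-- If the search stopped before `n` vertices, a missing neighbour would have been a candidate for
the next one; otherwise all `n` vertices were found, by counting. -/
theorem Found.adj {u w : ℕ} (hu : Found n a u) (h : a u w) : Found n a w := by
  obtain ⟨i, hi, rfl⟩ := hu
  have hw := hlt _ _ (hs _ _ h)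
  by_contra hf
  have hne : ∀ j < ordLen n a, ord n a j ≠ w := fun j hj h => hf ⟨j, hj, h⟩
  rcases (show ordLen n a ≤ n from firstIdx_le).lt_or_eq with hN | hN
  · by_cases hex : ∃ v < n, a (ord n a (ordLen n a - 1)) v ∧ ∀ j < ordLen n a, ord n a j ≠ v
    · obtain ⟨v, hv, hav, hvn⟩ := hex
      exact not_step hN v hv ⟨hvn, by rw [if_neg (by omega)]; exact .inl hav⟩
    · exact not_step hN w hw ⟨hne, by rw [if_neg (by omega)]; exact .inr ⟨hex, i, hi, h⟩⟩
  · have himg : (range n).image (ord n a) = range n := by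
      refine eq_of_subset_of_card_le (fun x hx => ?_) ?_
      · obtain ⟨j, hj, rfl⟩ := mem_image.mp hx
        exact mem_range.mpr (ord_lt (by rw [hN]; exact mem_range.mp hj))
      · rw [card_image_of_injOn]
        intro x hx y hy hxy
        exact ord_injOn (by rw [hN]; simpa using hx) (by rw [hN]; simpa using hy) hxy
    have := mem_range.mpr hw
    rw [← himg] at this
    obtain ⟨j, hj, hjw⟩ := mem_image.mp this
    exact hne j (by rw [hN]; exact mem_range.mp hj) hjw

/-- The cover contains an endpoint of an edge at the first vertex, and being found spreads along the
connected set `U`. -/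
theorem found_of_cover (hirr : ∀ u, ¬ a u u) {U : Finset ℕ} (hU : (⟨n, n, a⟩ : Ord).IsCover U)
    (he : ∃ u w, a u w) : ∀ u ∈ U, Found n a u := by
  obtain ⟨-, h2, h3⟩ := hU
  have hN := one_lt_ordLen hs hlt hirr he
  have h0 := (step_ord (show 0 < ordLen n a by omega)).2
  rw [if_pos rfl] at h0
  obtain ⟨w, -, hw⟩ := h0
  have hf0 : Found n a (ord n a 0) := ⟨0, by omega, rfl⟩
  have hfw := hf0.adj hs hlt hw
  refine h3 _ ?_ fun x _ hx y _ hxy => hx.adj hs hlt hxy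
  rcases h2 _ _ hw with h | h
  · exact ⟨_, h, hf0⟩
  · exact ⟨_, h, hfw⟩

theorem not_cover (hirr : ∀ u, ¬ a u u) {u w : ℕ} (h : a u w) (hu : ¬ Found n a u) {U : Finset ℕ} :
    ¬ (⟨n, n, a⟩ : Ord).IsCover U := by
  intro hU
  have hf := found_of_cover hs hlt hirr hU ⟨u, w, h⟩
  rcases hU.2.1 _ _ h with h' | h'
  · exact hu (hf _ h')
  · exact hu ((hf _ h').adj hs hlt (hs _ _ h))

omit hs hlt in
theorem conn_image {U : Finset ℕ} (hU : ∀ i ∈ U, i < ordLen n a) :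
    Conn a (U.image (ord n a)) ↔ Conn (ordGraph n a).r U := by
  constructor
  · intro h p hp hcl
    obtain ⟨w, hw, hpw⟩ := hp
    have := h (fun u => ∃ i ∈ U, ord n a i = u ∧ p i) ⟨_, mem_image_of_mem _ hw, w, hw, rfl, hpw⟩ ?_
    · intro z hz
      obtain ⟨i, hi, hiz, hpi⟩ := this _ (mem_image_of_mem _ hz)
      rwa [← ord_injOn (hU _ hi) (hU _ hz) hiz]
    · rintro x - ⟨i, hi, rfl, hpi⟩ y hy hxy
      obtain ⟨j, hj, rfl⟩ := mem_image.mp hy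
      exact ⟨j, hj, rfl, hcl i hi hpi j hj ⟨hU _ hi, hU _ hj, hxy⟩⟩
  · intro h p hp hcl z hz
    obtain ⟨w, hw, hpw⟩ := hp
    obtain ⟨i, hi, rfl⟩ := mem_image.mp hw
    obtain ⟨j, hj, rfl⟩ := mem_image.mp hz
    exact h (fun i => p (ord n a i)) ⟨i, hi, hpw⟩ (fun x hx hpx y hy hxy =>
      hcl _ (mem_image_of_mem _ hx) hpx _ (mem_image_of_mem _ hy) hxy.2.2) j hj

/-- When every edge lies among the found vertices, renumbering by `ord` transports covers both ways.
Replacing `k` by `min k n` is harmless because a cover has at most `n` vertices. -/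
theorem cover_iff (hirr : ∀ u, ¬ a u u) (he : ∃ u w, a u w) (hf : ∀ u w, a u w → Found n a u)
    (k : ℕ) : (∃ U, (⟨n, n, a⟩ : Ord).IsCover U ∧ #U ≤ k) ↔
      ∃ U, (ordGraph n a).IsCover U ∧ #U ≤ min k n := by
  have hcard : ∀ U : Finset ℕ, (∀ i ∈ U, i < ordLen n a) → #(U.image (ord n a)) = #U :=
    fun U hU => card_image_of_injOn fun x hx y hy hxy => ord_injOn (hU _ hx) (hU _ hy) hxy
  constructor
  · rintro ⟨U, hU, hk⟩
    classical
    have hfU := found_of_cover hs hlt hirr hU he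
    set V : Finset ℕ := {i ∈ range (ordLen n a) | ord n a i ∈ U} with hV
    have hVlt : ∀ i ∈ V, i < ordLen n a := fun i hi => mem_range.mp (mem_filter.mp hi).1
    have himg : V.image (ord n a) = U := by
      ext u
      constructor
      · intro h
        obtain ⟨i, hi, rfl⟩ := mem_image.mp h
        exact (mem_filter.mp hi).2
      · intro h
        obtain ⟨i, hi, rfl⟩ := hfU u h
        exact mem_image_of_mem _ (mem_filter.mpr ⟨mem_range.mpr hi, h⟩)
    refine ⟨V, ⟨hVlt, ?_, ?_⟩, le_min ?_ ?_⟩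
    · rintro i j ⟨hi, hj, h⟩
      refine (hU.2.1 _ _ h).imp (fun h => ?_) fun h => ?_
      · exact mem_filter.mpr ⟨mem_range.mpr hi, h⟩
      · exact mem_filter.mpr ⟨mem_range.mpr hj, h⟩
    · rw [← conn_image hVlt, himg]
      exact hU.2.2
    · rwa [← hcard V hVlt, himg]
    · refine (card_le_card (filter_subset _ _)).trans ?_
      rw [card_range]
      exact firstIdx_le
  · rintro ⟨U, ⟨h1, h2, h3⟩, hk⟩
    refine ⟨U.image (ord n a), ⟨?_, ?_, (conn_image h1).mpr h3⟩, ?_⟩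
    · intro u hu
      obtain ⟨i, hi, rfl⟩ := mem_image.mp hu
      exact ord_lt (h1 i hi)
    · intro u w h
      obtain ⟨i, hi, rfl⟩ := hf _ _ h
      obtain ⟨j, hj, rfl⟩ := hf _ _ (hs _ _ h)
      exact (h2 i j ⟨hi, hj, h⟩).imp (mem_image_of_mem _) (mem_image_of_mem _)
    · rw [hcard U h1]
      exact hk.trans (min_le_left _ _)

end Order

/-! ### Graphs on `Fin n` -/

section Graph

variable {n : ℕ} (G : SimpleGraph (Fin n))

/-- Adjacency of natural numbers. -/
def natAdj (u w : ℕ) : Prop := ∃ (hu : u < n) (hw : w < n), G.Adj ⟨u, hu⟩ ⟨w, hw⟩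

theorem natAdj_symm (u w : ℕ) (h : natAdj G u w) : natAdj G w u :=
  let ⟨hu, hw, h⟩ := h; ⟨hw, hu, h.symm⟩

theorem natAdj_irrefl (u : ℕ) : ¬ natAdj G u u := fun ⟨_, _, h⟩ => G.loopless.irrefl _ h

theorem natAdj_lt (u w : ℕ) (h : natAdj G u w) : u < n := h.1

theorem ordLen_eq_zero {n : ℕ} {a : ℕ → ℕ → Prop} (he : ¬ ∃ u w, a u w) : ordLen n a = 0 := by
  by_contra h
  have := (step_ord (n := n) (a := a) (show 0 < ordLen n a by omega)).2
  rw [if_pos rfl] at this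
  obtain ⟨w, -, h⟩ := this
  exact he ⟨_, _, h⟩

/-- Reachability from a fixed vertex is a closed property; conversely a closed property is carried
along paths. -/
theorem conn_iff_preconnected (U : Finset (Fin n)) :
    Conn (natAdj G) (U.image Fin.val) ↔ (G.induce (U : Set (Fin n))).Preconnected := by
  constructor
  · intro h x y
    have := h (fun v => ∃ (hv : v < n) (hU : (⟨v, hv⟩ : Fin n) ∈ (U : Set (Fin n))),
      (G.induce (U : Set (Fin n))).Reachable x ⟨⟨v, hv⟩, hU⟩)
      ⟨x.1.1, mem_image_of_mem _ x.2, x.1.2, x.2, .refl _⟩ ?_ y.1.1 (mem_image_of_mem _ y.2)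
    · obtain ⟨_, _, h⟩ := this
      exact h
    · rintro u - ⟨hu, hU, hr⟩ v hv ⟨_, hvn, huv⟩
      obtain ⟨v', hv', rfl⟩ := mem_image.mp hv
      refine ⟨hvn, hv', hr.trans (SimpleGraph.Adj.reachable ?_)⟩
      exact huv
  · intro h p hp hcl z hz
    obtain ⟨w, hw, hpw⟩ := hp
    obtain ⟨w', hw', rfl⟩ := mem_image.mp hw
    obtain ⟨z', hz', rfl⟩ := mem_image.mp hz
    have hr := h ⟨w', hw'⟩ ⟨z', hz'⟩
    rw [SimpleGraph.reachable_iff_reflTransGen] at hr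
    have key : ∀ y : (U : Set (Fin n)),
        Relation.ReflTransGen (G.induce (U : Set (Fin n))).Adj ⟨w', hw'⟩ y → p y.1.1 := by
      intro y hy
      induction hy with
      | refl => exact hpw
      | @tail b c _ hbc ih =>
        exact hcl _ (mem_image_of_mem _ b.2) ih _ (mem_image_of_mem _ c.2) ⟨b.1.2, c.1.2, hbc⟩
    exact key _ hr

theorem hasConnectedVertexCover_iff (k : ℕ) :
    HasConnectedVertexCover G k ↔ ∃ U, (⟨n, n, natAdj G⟩ : Ord).IsCover U ∧ #U ≤ k := by
  have hcard : ∀ U : Finset (Fin n), #(U.image Fin.val) = #U :=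
    fun U => card_image_of_injective _ Fin.val_injective
  constructor
  · rintro ⟨U, ⟨h1, h2⟩, hk⟩
    refine ⟨U.image Fin.val, ⟨?_, ?_, (conn_iff_preconnected G U).mpr h2⟩, by rwa [hcard]⟩
    · intro i hi
      obtain ⟨u, -, rfl⟩ := mem_image.mp hi
      exact u.2
    · rintro i j ⟨hi, hj, h⟩
      exact (h1 h).imp (mem_image_of_mem Fin.val) (mem_image_of_mem Fin.val)
  · rintro ⟨U, ⟨h1, h2, h3⟩, hk⟩
    classical
    set V : Finset (Fin n) := {u | u.1 ∈ U} with hV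
    have himg : V.image Fin.val = U := by
      ext u
      constructor
      · intro h
        obtain ⟨v, hv, rfl⟩ := mem_image.mp h
        exact (mem_filter.mp hv).2
      · intro h
        exact mem_image.mpr ⟨⟨u, h1 u h⟩, mem_filter.mpr ⟨mem_univ _, h⟩, rfl⟩
    refine ⟨V, ⟨?_, ?_⟩, by rwa [← hcard, himg]⟩
    · intro u w h
      refine (h2 u w ⟨u.2, w.2, h⟩).imp (fun h => ?_) fun h => ?_
      · exact mem_filter.mpr ⟨mem_univ _, h⟩
      · exact mem_filter.mpr ⟨mem_univ _, h⟩
    · rw [← conn_iff_preconnected, himg]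
      exact h3

end Graph

end ConnectedCover

namespace ArrayLang

open RAM

/-! ### Unclamped evaluation -/

/-- Update of a function. -/
def upd (ρ : ℕ → ℕ) (x i : ℕ) : ℕ → ℕ := fun y => if y = x then i else ρ y

/-- The value of an expression for given values of the arrays and variables, without clamping. -/
def Exp.val (T : ℕ → ℕ → ℕ → ℕ) (I : ℕ → ℕ) : Exp → (ℕ → ℕ) → ℕ
  | lit c, _ => c
  | var x, ρ => ρ x
  | inp e, ρ => I (e.val T I ρ)
  | arr a e f, ρ => T a (e.val T I ρ) (f.val T I ρ)
  | bin o e f, ρ => o.eval (e.val T I ρ) (f.val T I ρ)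
  | ite c e f, ρ => if c.val T I ρ ≠ 0 then e.val T I ρ else f.val T I ρ
  | sum x l e, ρ => ∑ i ∈ Finset.range (l.val T I ρ), e.val T I (upd ρ x i)

/-- The rows of array `a` are known up to row `lim a`. No index leaves the known range and no value
exceeds `cap` in the evaluation of an expression. -/
def Exp.Good (T : ℕ → ℕ → ℕ → ℕ) (I : ℕ → ℕ) (n cap : ℕ) (lim : ℕ → ℕ) :
    Exp → (ℕ → ℕ) → Prop
  | lit _, _ => True
  | var _, _ => True
  | inp e, ρ => e.Good T I n cap lim ρ
  | arr a e f, ρ => e.Good T I n cap lim ρ ∧ f.Good T I n cap lim ρ ∧ e.val T I ρ < lim a ∧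
      f.val T I ρ < n + 2
  | bin o e f, ρ => e.Good T I n cap lim ρ ∧ f.Good T I n cap lim ρ ∧
      o.eval (e.val T I ρ) (f.val T I ρ) ≤ cap
  | ite c e f, ρ => c.Good T I n cap lim ρ ∧ (c.val T I ρ ≠ 0 → e.Good T I n cap lim ρ) ∧
      (c.val T I ρ = 0 → f.Good T I n cap lim ρ)
  | sum x l e, ρ => l.Good T I n cap lim ρ ∧ l.val T I ρ ≤ n + 2 ∧
      (∀ i < l.val T I ρ, e.Good T I n cap lim (upd ρ x i)) ∧
      ∑ i ∈ Finset.range (l.val T I ρ), e.val T I (upd ρ x i) ≤ cap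

/-- Under `Good` no clamp on arrays, sums or arithmetic has an effect. Input addresses need no
condition, since the input is 0 from `n * n` on. -/
theorem Exp.eval_eq_val {Γ : Ctx} {T : ℕ → ℕ → ℕ → ℕ} {lim : ℕ → ℕ} (hW : Γ.W = Γ.n + 2)
    (hI : ∀ m, Γ.n * Γ.n ≤ m → Γ.inp m = 0) (hlim : ∀ a, lim a ≤ Γ.n + 2) :
    ∀ (e : Exp) (σ : Env), (∀ a i j, i < lim a → j < Γ.n + 2 → σ.A a i j = T a i j) →
      e.Good T Γ.inp Γ.n Γ.cap lim σ.v → e.eval Γ σ = e.val T Γ.inp σ.v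
  | lit c, σ, _, _ => rfl
  | var x, σ, _, _ => rfl
  | inp e, σ, hA, h => by
    rw [eval, val, eval_eq_val hW hI hlim e σ hA h]
    rcases le_total (e.val T Γ.inp σ.v) (Γ.n * Γ.n) with h' | h'
    · rw [min_eq_left h']
    · rw [min_eq_right h', hI _ le_rfl, hI _ h']
  | arr a e f, σ, hA, ⟨h1, h2, h3, h4⟩ => by
    have := hlim a
    rw [eval, val, eval_eq_val hW hI hlim e σ hA h1, eval_eq_val hW hI hlim f σ hA h2,
      min_eq_left (by omega), min_eq_left (by omega), hA _ _ _ h3 h4]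
  | bin o e f, σ, hA, ⟨h1, h2, h3⟩ => by
    rw [eval, val, eval_eq_val hW hI hlim e σ hA h1, eval_eq_val hW hI hlim f σ hA h2,
      min_eq_left h3]
  | ite c e f, σ, hA, ⟨h1, h2, h3⟩ => by
    rw [eval, val, eval_eq_val hW hI hlim c σ hA h1]
    by_cases h : c.val T Γ.inp σ.v = 0
    · rw [if_neg (not_not.mpr h), if_neg (not_not.mpr h)]
      exact eval_eq_val hW hI hlim f σ hA (h3 h)
    · rw [if_pos h, if_pos h]
      exact eval_eq_val hW hI hlim e σ hA (h2 h)
  | sum x l e, σ, hA, ⟨h1, h2, h3, h4⟩ => by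
    rw [eval, val, eval_eq_val hW hI hlim l σ hA h1,
      min_eq_left (show l.val T Γ.inp σ.v ≤ Γ.W by omega)]
    have : ∀ i ∈ Finset.range (l.val T Γ.inp σ.v),
        e.eval Γ (σ.set x i) = e.val T Γ.inp (upd σ.v x i) := fun i hi =>
      eval_eq_val hW hI hlim e (σ.set x i) hA (h3 i (Finset.mem_range.mp hi))
    rw [Finset.sum_congr rfl this, min_eq_left h4]

/-! ### Filling an array -/

/-- Fill an array: `A a i j := e` for all `i` and `j`, the values of the variables `2` and `3`. -/
def fill (a : ℕ) (e : Exp) : Stmt :=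
  .for 2 (.bin .add (.var 0) (.lit 2)) <| .for 3 (.bin .add (.var 0) (.lit 2)) <|
    .store a (.var 2) (.var 3) e

theorem limit_eval {Γ : Ctx} (hW : Γ.W = Γ.n + 2) (hcap : Γ.n + 2 ≤ Γ.cap) {σ : Env}
    (h0 : σ.v 0 = Γ.n) :
    min ((Exp.bin .add (.var 0) (.lit 2)).eval Γ σ) Γ.W = Γ.n + 2 := by
  simp only [Exp.eval, h0, Op.eval]
  omega

theorem fill_row {Γ : Ctx} (hW : Γ.W = Γ.n + 2) {a : ℕ} {e : Exp} {σ : Env} {g : ℕ → ℕ} {i : ℕ}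
    (hi : i < Γ.n + 2) (h2 : σ.v 2 = i)
    (he : ∀ j < Γ.n + 2, ∀ τ : Env, τ.v = upd σ.v 3 j → (∀ b ≠ a, τ.A b = σ.A b) →
      (∀ i' ≠ i, τ.A a i' = σ.A a i') → e.eval Γ τ = g j) :
    ∀ J ≤ Γ.n + 2, let σ' := iter ((Stmt.store a (.var 2) (.var 3) e).exec Γ) 3 σ J
      (∀ x ≠ 3, σ'.v x = σ.v x) ∧ (∀ b ≠ a, σ'.A b = σ.A b) ∧ (∀ i' ≠ i, σ'.A a i' = σ.A a i') ∧
        ∀ j < J, σ'.A a i j = g j := by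
  intro J
  induction J with
  | zero => intro _; exact ⟨fun _ _ => rfl, fun _ _ => rfl, fun _ _ => rfl, by omega⟩
  | succ J ih =>
    intro hJ
    obtain ⟨i1, i2, i3, i4⟩ := ih (by omega)
    rw [iter]
    generalize iter ((Stmt.store a (.var 2) (.var 3) e).exec Γ) 3 σ J = σ₁ at i1 i2 i3 i4 ⊢
    have hval : e.eval Γ (σ₁.set 3 J) = g J := by
      refine he J (by omega) _ ?_ i2 i3
      funext x
      simp only [Env.set, upd]
      split_ifs with h
      · rfl
      · exact i1 x h
    have e2 : (σ₁.set 3 J).v 2 = i := (i1 2 (by omega)).trans h2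
    have e3 : (σ₁.set 3 J).v 3 = J := rfl
    simp only [Stmt.exec, Exp.eval, e2, e3, hval]
    rw [min_eq_left (show i ≤ Γ.W by omega), min_eq_left (show J ≤ Γ.W by omega)]
    refine ⟨fun x hx => ?_, fun b hb => ?_, fun i' hi' => ?_, fun j hj => ?_⟩
    · simp only [Env.setA, Env.set, if_neg hx, i1 x hx]
    · funext k l
      simp only [Env.setA, Env.set, hb, false_and, if_false, i2 b hb]
    · funext l
      simp only [Env.setA, Env.set, hi', false_and, and_false, if_false, i3 i' hi']
    · simp only [Env.setA, Env.set, true_and]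
      split_ifs with h
      · rw [h]
      · exact i4 j (by omega)

/-- The expression for row `i` may rely on the finished rows `i' < i` of the same array. This is how
recursive definitions such as `ord`, `cnt`, `lab` and `bw` are tabulated. -/
theorem fill_exec {Γ : Ctx} (hW : Γ.W = Γ.n + 2) (hcap : Γ.n + 2 ≤ Γ.cap) {a : ℕ} {e : Exp}
    {σ : Env} {g : ℕ → ℕ → ℕ} (h0 : σ.v 0 = Γ.n)
    (he : ∀ i < Γ.n + 2, ∀ j < Γ.n + 2, ∀ τ : Env, τ.v = upd (upd σ.v 2 i) 3 j →
      (∀ b ≠ a, τ.A b = σ.A b) → (∀ i' < i, ∀ j' < Γ.n + 2, τ.A a i' j' = g i' j') →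
      e.eval Γ τ = g i j) :
    let σ' := (fill a e).exec Γ σ
    (∀ x, x ≠ 2 → x ≠ 3 → σ'.v x = σ.v x) ∧ (∀ b ≠ a, σ'.A b = σ.A b) ∧
      ∀ i < Γ.n + 2, ∀ j < Γ.n + 2, σ'.A a i j = g i j := by
  rw [fill, Stmt.exec, limit_eval hW hcap h0]
  suffices h : ∀ R ≤ Γ.n + 2, let σ' := iter ((Stmt.for 3 (.bin .add (.var 0) (.lit 2)) <|
      .store a (.var 2) (.var 3) e).exec Γ) 2 σ R
      (∀ x, x ≠ 2 → x ≠ 3 → σ'.v x = σ.v x) ∧ (∀ b ≠ a, σ'.A b = σ.A b) ∧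
        ∀ i < R, ∀ j < Γ.n + 2, σ'.A a i j = g i j from h _ le_rfl
  intro R
  induction R with
  | zero => intro _; exact ⟨fun _ _ _ => rfl, fun _ _ => rfl, by omega⟩
  | succ R ih =>
    intro hR
    obtain ⟨i1, i2, i3⟩ := ih (by omega)
    rw [iter]
    generalize iter ((Stmt.for 3 (.bin .add (.var 0) (.lit 2)) <|
      .store a (.var 2) (.var 3) e).exec Γ) 2 σ R = σ₁ at i1 i2 i3 ⊢
    have hrow := fill_row (a := a) (e := e) (σ := σ₁.set 2 R) (g := g R) hW
      (show R < Γ.n + 2 by omega) rfl (fun j hj τ hv hb hr => by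
        refine he R (by omega) j hj τ ?_ (fun b hb' => (hb b hb').trans (i2 b hb')) ?_
        · rw [hv]
          funext x
          simp only [Env.set, upd]
          split_ifs with h3 h2
          · rfl
          · rfl
          · exact i1 x h2 h3
        · intro i' hi' j' hj'
          rw [hr i' (by omega)]
          exact i3 i' hi' j' hj') _ le_rfl
    obtain ⟨r1, r2, r3, r4⟩ := hrow
    rw [Stmt.exec, limit_eval hW hcap (show (σ₁.set 2 R).v 0 = Γ.n from (i1 0 (by omega)
      (by omega)).trans h0)]
    refine ⟨fun x h2 h3 => ?_, fun b hb => ?_, fun i hi j hj => ?_⟩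
    · rw [r1 x h3]
      simp only [Env.set, if_neg h2, i1 x h2 h3]
    · rw [r2 b hb]
      exact i2 b hb
    · by_cases h : i = R
      · subst h
        exact r4 j hj
      · rw [r3 i h]
        exact i3 i (by omega) j hj

/-- The rows known when row `i` of array `b` is computed. -/
def lim (n b i a : ℕ) : ℕ := if a < b then n + 2 else if a = b then i else 0

/-- `E b` computes the values `T b` from the values of the previous arrays. -/
def Computes (Γ : Ctx) (T : ℕ → ℕ → ℕ → ℕ) (ρ : ℕ → ℕ) (b : ℕ) (e : Exp) : Prop :=
  ∀ i < Γ.n + 2, ∀ j < Γ.n + 2,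
    e.Good T Γ.inp Γ.n Γ.cap (lim Γ.n b i) (upd (upd ρ 2 i) 3 j) ∧
      e.val T Γ.inp (upd (upd ρ 2 i) 3 j) = T b i j

/-- The arrays `a < b` have the values `T a`. -/
def Known (n : ℕ) (T : ℕ → ℕ → ℕ → ℕ) (b : ℕ) (σ : Env) : Prop :=
  ∀ a < b, ∀ i < n + 2, ∀ j < n + 2, σ.A a i j = T a i j

theorem fill_known {Γ : Ctx} (hW : Γ.W = Γ.n + 2) (hcap : Γ.n + 2 ≤ Γ.cap)
    (hI : ∀ m, Γ.n * Γ.n ≤ m → Γ.inp m = 0) {T : ℕ → ℕ → ℕ → ℕ} {b : ℕ} {e : Exp} {σ : Env}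
    (h0 : σ.v 0 = Γ.n) (he : Computes Γ T σ.v b e) (hσ : Known Γ.n T b σ) :
    let σ' := (fill b e).exec Γ σ
    (∀ x, x ≠ 2 → x ≠ 3 → σ'.v x = σ.v x) ∧ (∀ a ≠ b, σ'.A a = σ.A a) ∧
      Known Γ.n T (b + 1) σ' := by
  have hlim : ∀ i < Γ.n + 2, ∀ a, lim Γ.n b i a ≤ Γ.n + 2 := by
    intro i hi a
    unfold lim
    split_ifs <;> omega
  obtain ⟨h1, h2, h3⟩ := fill_exec (a := b) (e := e) (g := T b) hW hcap h0
    (fun i hi j hj τ hv hb hr => by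
      rw [e.eval_eq_val (T := T) (lim := lim Γ.n b i) hW hI (hlim i hi) τ ?_ ?_, hv]
      · exact (he i hi j hj).2
      · intro a i' j' hi' hj'
        unfold lim at hi'
        split_ifs at hi' with h h
        · rw [hb a (by omega)]
          exact hσ a h i' hi' j' hj'
        · rw [h]
          exact hr i' hi' j' hj'
        · omega
      · rw [hv]
        exact (he i hi j hj).1)
  refine ⟨h1, h2, fun a ha i hi j hj => ?_⟩
  rcases Nat.lt_succ_iff_lt_or_eq.mp ha with h | rfl
  · rw [h2 a (by omega)]
    exact hσ a h i hi j hj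
  · exact h3 i hi j hj

/-- Fill the arrays `b, …, b + m`. -/
def fills (E : ℕ → Exp) (b : ℕ) : ℕ → Stmt
  | 0 => fill b (E b)
  | m + 1 => .seq (fills E b m) (fill (b + (m + 1)) (E (b + (m + 1))))

theorem fills_known {Γ : Ctx} (hW : Γ.W = Γ.n + 2) (hcap : Γ.n + 2 ≤ Γ.cap)
    (hI : ∀ m, Γ.n * Γ.n ≤ m → Γ.inp m = 0) {T : ℕ → ℕ → ℕ → ℕ} {b : ℕ} {E : ℕ → Exp} {σ : Env}
    (h0 : σ.v 0 = Γ.n) (hσ : Known Γ.n T b σ) : ∀ m : ℕ,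
    (∀ ρ : ℕ → ℕ, (∀ x, x ≠ 2 → x ≠ 3 → ρ x = σ.v x) → ∀ a, b ≤ a → a ≤ b + m →
      Computes Γ T ρ a (E a)) →
    let σ' := (fills E b m).exec Γ σ
    (∀ x, x ≠ 2 → x ≠ 3 → σ'.v x = σ.v x) ∧ (∀ a, b + m < a → σ'.A a = σ.A a) ∧
      Known Γ.n T (b + m + 1) σ'
  | 0, he => by
    obtain ⟨h1, h2, h3⟩ := fill_known hW hcap hI h0 (he σ.v (fun _ _ _ => rfl) b le_rfl le_rfl) hσ
    exact ⟨h1, fun a ha => h2 a (by omega), h3⟩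
  | m + 1, he => by
    obtain ⟨h1, h2, h3⟩ := fills_known hW hcap hI h0 hσ m
      fun ρ hρ a h h' => he ρ hρ a h (by omega)
    obtain ⟨i1, i2, i3⟩ := fill_known hW hcap hI ((h1 0 (by omega) (by omega)).trans h0)
      (he _ h1 (b + (m + 1)) (by omega) le_rfl) h3
    refine ⟨fun x hx hx' => (i1 x hx hx').trans (h1 x hx hx'), fun a ha => ?_, i3⟩
    exact (i2 a (by omega)).trans (h2 a (by omega))

end ArrayLang

namespace ArrayLang

open RAM

/-! ### Logical expressions -/

namespace Exp

/-- Negation. -/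
def not (c : Exp) : Exp := .ite c (.lit 0) (.lit 1)

/-- Conjunction. -/
def and (c d : Exp) : Exp := .ite c d (.lit 0)

/-- Disjunction. -/
def or (c d : Exp) : Exp := .ite c (.lit 1) d

/-- Comparison. -/
def lt (e f : Exp) : Exp := .bin .sub f e

/-- Equality. -/
def eq (e f : Exp) : Exp := .ite (.bin .sub e f) (.lit 0) (.ite (.bin .sub f e) (.lit 0) (.lit 1))

/-- The truth value of a condition, as a number. -/
def bool (c : Exp) : Exp := .ite c (.lit 1) (.lit 0)

/-- Bounded existential quantification. -/
def ex (x : ℕ) (l c : Exp) : Exp := .sum x l (bool c)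

/-- The first value of the variable `6` with a given property, using the variable `5`. -/
def first (l c : Exp) : Exp := .sum 5 l (not (ex 6 (.bin .add (.var 5) (.lit 1)) c))

/-- Remainders. -/
def mod (e f : Exp) : Exp := .bin .sub e (.bin .mul (.bin .div e f) f)

variable {T : ℕ → ℕ → ℕ → ℕ} {I : ℕ → ℕ}

/-- An expression is true if its value is not zero. -/
def Tr (T : ℕ → ℕ → ℕ → ℕ) (I : ℕ → ℕ) (e : Exp) (ρ : ℕ → ℕ) : Prop := e.val T I ρ ≠ 0

variable {c d e f l : Exp} {ρ : ℕ → ℕ} {x a : ℕ} {o : Op}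

theorem val_lit {c : ℕ} : (lit c).val T I ρ = c := rfl

theorem val_var : (var x).val T I ρ = ρ x := rfl

theorem val_arr : (arr a e f).val T I ρ = T a (e.val T I ρ) (f.val T I ρ) := rfl

theorem val_bin : (bin o e f).val T I ρ = o.eval (e.val T I ρ) (f.val T I ρ) := rfl

theorem val_sum : (sum x l e).val T I ρ =
    ∑ i ∈ Finset.range (l.val T I ρ), e.val T I (upd ρ x i) := rfl

theorem tr_bin : (bin o e f).Tr T I ρ ↔ o.eval (e.val T I ρ) (f.val T I ρ) ≠ 0 := Iff.rfl

theorem tr_var : (var x).Tr T I ρ ↔ ρ x ≠ 0 := Iff.rfl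

theorem tr_inp : (inp e).Tr T I ρ ↔ I (e.val T I ρ) ≠ 0 := Iff.rfl

theorem tr_arr : (arr a e f).Tr T I ρ ↔ T a (e.val T I ρ) (f.val T I ρ) ≠ 0 := Iff.rfl

theorem tr_not : (not c).Tr T I ρ ↔ ¬ c.Tr T I ρ := by
  simp only [Tr, not, val]
  split_ifs <;> simp_all

theorem tr_and : (and c d).Tr T I ρ ↔ c.Tr T I ρ ∧ d.Tr T I ρ := by
  simp only [Tr, and, val]
  split_ifs <;> simp_all

theorem tr_or : (or c d).Tr T I ρ ↔ c.Tr T I ρ ∨ d.Tr T I ρ := by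
  simp only [Tr, or, val]
  split_ifs <;> simp_all

theorem tr_lt : (lt e f).Tr T I ρ ↔ e.val T I ρ < f.val T I ρ := by
  simp only [Tr, lt, val, Op.eval]
  omega

theorem tr_eq : (eq e f).Tr T I ρ ↔ e.val T I ρ = f.val T I ρ := by
  simp only [Tr, eq, val, Op.eval]
  by_cases h : e.val T I ρ - f.val T I ρ = 0
  · by_cases h' : f.val T I ρ - e.val T I ρ = 0
    · simp [h, h']
      omega
    · simp [h, h']
      omega
  · simp [h]
    omega

theorem tr_ite {p : Exp} : (ite p c d).Tr T I ρ ↔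
    (p.Tr T I ρ → c.Tr T I ρ) ∧ (¬ p.Tr T I ρ → d.Tr T I ρ) := by
  simp only [Tr, val]
  split_ifs <;> simp_all

theorem val_not [Decidable (c.Tr T I ρ)] :
    (not c).val T I ρ = if c.Tr T I ρ then 0 else 1 := by
  simp only [Tr, not, val]
  split_ifs <;> simp_all

theorem val_bool [Decidable (c.Tr T I ρ)] :
    (bool c).val T I ρ = if c.Tr T I ρ then 1 else 0 := by
  simp only [Tr, bool, val]
  split_ifs <;> simp_all

theorem tr_bool : (bool c).Tr T I ρ ↔ c.Tr T I ρ := by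
  classical
  rw [Tr, val_bool]
  simp

theorem tr_ex : (ex x l c).Tr T I ρ ↔ ∃ i < l.val T I ρ, c.Tr T I (upd ρ x i) := by
  simp only [Tr, ex, val, ne_eq, Finset.sum_eq_zero_iff, Finset.mem_range, not_forall, exists_prop]
  exact exists_congr fun i => and_congr_right fun _ => tr_bool

theorem val_mod : (mod e f).val T I ρ = e.val T I ρ % f.val T I ρ := by
  simp only [mod, val, Op.eval]
  rw [Nat.mod_eq_sub_div_mul]

theorem val_ite [Decidable (c.Tr T I ρ)] :
    (ite c e f).val T I ρ = if c.Tr T I ρ then e.val T I ρ else f.val T I ρ := by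
  simp only [Tr, val]
  congr

theorem val_first {p : ℕ → Prop} (h : ∀ u w, c.Tr T I (upd (upd ρ 5 u) 6 w) ↔ p w) :
    (first l c).val T I ρ = ConnectedCover.firstIdx (l.val T I ρ) p := by
  classical
  rw [first, val, ConnectedCover.firstIdx]
  refine Finset.sum_congr rfl fun u _ => ?_
  rw [val_not]
  refine if_congr ?_ rfl rfl
  simp only [tr_ex, h]
  rfl

variable {n cap : ℕ} {lim : ℕ → ℕ}

theorem good_lit {c : ℕ} : (lit c).Good T I n cap lim ρ := trivial

theorem good_var : (var x).Good T I n cap lim ρ := trivial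

theorem good_arr : (arr a e f).Good T I n cap lim ρ ↔ e.Good T I n cap lim ρ ∧
    f.Good T I n cap lim ρ ∧ e.val T I ρ < lim a ∧ f.val T I ρ < n + 2 := Iff.rfl

theorem good_bin : (bin o e f).Good T I n cap lim ρ ↔ e.Good T I n cap lim ρ ∧
    f.Good T I n cap lim ρ ∧ o.eval (e.val T I ρ) (f.val T I ρ) ≤ cap := Iff.rfl

theorem good_sum : (sum x l e).Good T I n cap lim ρ ↔ l.Good T I n cap lim ρ ∧
    l.val T I ρ ≤ n + 2 ∧ (∀ i < l.val T I ρ, e.Good T I n cap lim (upd ρ x i)) ∧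
      ∑ i ∈ Finset.range (l.val T I ρ), e.val T I (upd ρ x i) ≤ cap := Iff.rfl

theorem good_not : (not c).Good T I n cap lim ρ ↔ c.Good T I n cap lim ρ := by
  simp [not, Good]

theorem good_bool : (bool c).Good T I n cap lim ρ ↔ c.Good T I n cap lim ρ := by
  simp [bool, Good]

theorem good_and : (and c d).Good T I n cap lim ρ ↔
    c.Good T I n cap lim ρ ∧ (c.Tr T I ρ → d.Good T I n cap lim ρ) := by
  simp [and, Good, Tr]

theorem good_or : (or c d).Good T I n cap lim ρ ↔
    c.Good T I n cap lim ρ ∧ (¬ c.Tr T I ρ → d.Good T I n cap lim ρ) := by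
  simp [or, Good, Tr]

theorem good_ite : (ite c e f).Good T I n cap lim ρ ↔ c.Good T I n cap lim ρ ∧
    (c.Tr T I ρ → e.Good T I n cap lim ρ) ∧ (¬ c.Tr T I ρ → f.Good T I n cap lim ρ) := by
  simp [Good, Tr]

theorem good_lt : (lt e f).Good T I n cap lim ρ ↔ f.Good T I n cap lim ρ ∧ e.Good T I n cap lim ρ ∧
    f.val T I ρ - e.val T I ρ ≤ cap := Iff.rfl

theorem good_eq : (eq e f).Good T I n cap lim ρ ↔ e.Good T I n cap lim ρ ∧ f.Good T I n cap lim ρ ∧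
    e.val T I ρ - f.val T I ρ ≤ cap ∧ f.val T I ρ - e.val T I ρ ≤ cap := by
  simp only [eq, Good, val, Op.eval]
  constructor
  · rintro ⟨⟨h1, h2, h3⟩, -, h4⟩
    refine ⟨h1, h2, h3, ?_⟩
    rcases Nat.eq_zero_or_pos (e.val T I ρ - f.val T I ρ) with h | h
    · exact (h4 h).1.2.2
    · omega
  · rintro ⟨h1, h2, h3, h4⟩
    exact ⟨⟨h1, h2, h3⟩, fun _ => trivial, fun _ => ⟨⟨h2, h1, h4⟩, fun _ => trivial, fun _ => trivial⟩⟩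

theorem good_mod : (mod e f).Good T I n cap lim ρ ↔ e.Good T I n cap lim ρ ∧
    f.Good T I n cap lim ρ ∧ e.val T I ρ / f.val T I ρ ≤ cap ∧
    e.val T I ρ / f.val T I ρ * f.val T I ρ ≤ cap ∧ e.val T I ρ % f.val T I ρ ≤ cap := by
  simp only [mod, Good, val, Op.eval, Nat.mod_eq_sub_div_mul]
  tauto

theorem good_ex (hcap : n + 2 ≤ cap) : (ex x l c).Good T I n cap lim ρ ↔
    l.Good T I n cap lim ρ ∧ l.val T I ρ ≤ n + 2 ∧
      ∀ i < l.val T I ρ, c.Good T I n cap lim (upd ρ x i) := by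
  simp only [ex, Good, good_bool]
  refine and_congr_right fun _ => and_congr_right fun h => and_iff_left ?_
  have : ∀ i ∈ Finset.range (l.val T I ρ), (bool c).val T I (upd ρ x i) ≤ 1 := by
    classical
    intro i _
    rw [val_bool]
    split_ifs <;> omega
  have := Finset.sum_le_card_nsmul _ _ _ this
  rw [Finset.card_range, smul_eq_mul, mul_one] at this
  omega

theorem good_first (hcap : n + 2 ≤ cap) : (first l c).Good T I n cap lim ρ ↔
    l.Good T I n cap lim ρ ∧ l.val T I ρ ≤ n + 2 ∧
      ∀ u < l.val T I ρ, ∀ w < u + 1, c.Good T I n cap lim (upd (upd ρ 5 u) 6 w) := by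
  have h5 : ∀ u, (bin .add (var 5) (lit 1)).val T I (upd ρ 5 u) = u + 1 := fun _ => rfl
  simp only [first, Good, good_not, good_ex hcap, h5]
  refine and_congr_right fun _ => and_congr_right fun h => ?_
  constructor
  · rintro ⟨h1, -⟩ u hu w hw
    exact (h1 u hu).2.2 w hw
  · intro h1
    refine ⟨fun u hu => ⟨⟨trivial, trivial, ?_⟩, by omega, h1 u hu⟩, ?_⟩
    · change u + 1 ≤ cap
      omega
    · have : ∀ i ∈ Finset.range (l.val T I ρ),
          (not (ex 6 (bin .add (var 5) (lit 1)) c)).val T I (upd ρ 5 i) ≤ 1 := by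
        classical
        intro i _
        rw [val_not]
        split_ifs <;> omega
      have := Finset.sum_le_card_nsmul _ _ _ this
      rw [Finset.card_range, smul_eq_mul, mul_one] at this
      omega

end Exp

end ArrayLang

namespace ConnectedCover

open Finset ArrayLang ArrayLang.Exp

/-! ### The program -/

open Classical in
/-- The arrays computed by the program for a graph with adjacency relation `a` in the round `x` of
the main loop. -/
noncomputable def tab (n k : ℕ) (a : ℕ → ℕ → Prop) (x : ℕ) : ℕ → ℕ → ℕ → ℕ
  | 0, i, _ => ord n a i
  | 1, _, _ => ordLen n a
  | 2, i, j => if (ordGraph n a).r i j then 1 else 0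
  | 3, _, _ => if ∃ u w, a u w then 0 else 1
  | 4, _, _ => if ∀ u w, a u w → Found n a u then 1 else 0
  | 5, i, _ => if (ordGraph n a).leaf i then 1 else 0
  | 6, i, _ => (ordGraph n a).par i
  | 7, _, _ => if (ordGraph n a).Many then 1 else 0
  | 8, i, _ => (ordGraph n a).cnt i
  | 9, _, _ => ∑ y ∈ range x, (ordGraph n a).signed k 0 ((ordGraph n a).col y)
  | 10, _, _ => ∑ y ∈ range x, (ordGraph n a).signed k 1 ((ordGraph n a).col y)
  | 11, i, _ => (ordGraph n a).rem x i
  | 12, i, _ => (ordGraph n a).dig x i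
  | 13, i, _ => (ordGraph n a).col x i
  | 14, i, _ => (ordGraph n a).fin ((ordGraph n a).col x) i
  | 15, _, _ => if (ordGraph n a).Valid ((ordGraph n a).col x) then 1 else 0
  | 16, i, j => lab (ordGraph n a).r ((ordGraph n a).inn ((ordGraph n a).col x)) i j
  | 17, _, _ => (ordGraph n a).size ((ordGraph n a).col x)
  | 18, _, _ => (ordGraph n a).comps ((ordGraph n a).col x) 1
  | 19, _, _ => (ordGraph n a).comps ((ordGraph n a).col x) 2
  | 20, i, j => if (ordGraph n a).link ((ordGraph n a).col x) i j then 1 else 0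
  | 21, i, _ => if (ordGraph n a).opt ((ordGraph n a).col x) i then 1 else 0
  | 22, i, j => bw ((ordGraph n a).link ((ordGraph n a).col x)) n
      ((ordGraph n a).opt ((ordGraph n a).col x)) i j
  | 23, _, _ => (ordGraph n a).wt k ((ordGraph n a).col x)
  | 24, _, _ => ∑ y ∈ range (x + 1), (ordGraph n a).signed k 0 ((ordGraph n a).col y)
  | 25, _, _ => ∑ y ∈ range (x + 1), (ordGraph n a).signed k 1 ((ordGraph n a).col y)
  | _, _, _ => 0

/-- A one-dimensional array. -/
abbrev arr₁ (a : ℕ) (e : Exp) : Exp := .arr a e (.lit 0)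

/-- A single value. -/
abbrev arr₀ (a : ℕ) : Exp := .arr a (.lit 0) (.lit 0)

/-- Sums. -/
abbrev add (e f : Exp) : Exp := .bin .add e f

/-- Differences. -/
abbrev sub (e f : Exp) : Exp := .bin .sub e f

/-- Products. -/
abbrev mul (e f : Exp) : Exp := .bin .mul e f

/-- The adjacency matrix of the input. -/
def adjE (e f : Exp) : Exp := .and (.lt f (.var 0)) (.inp (add (mul (.var 0) e) f))

/-- Vertices of the cover. -/
def innE (e : Exp) : Exp := .or (.eq (arr₁ 14 e) (.lit 1)) (.eq (arr₁ 14 e) (.lit 2))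

/-- A neighbour of given colour. -/
def touchE (b : ℕ) (e : Exp) (q : ℕ) : Exp :=
  .ex 5 (.var 0) (.and (.arr 2 e (.var 5)) (.eq (arr₁ b (.var 5)) (.lit q)))

/-- The number of components of given colour. -/
def compsE (q : ℕ) : Exp := .sum 5 (.var 0)
  (.bool (.and (.eq (arr₁ 14 (.var 5)) (.lit q)) (.eq (.arr 16 (.var 0) (.var 5)) (.var 5))))

/-- A new value of an accumulated sum. -/
def accE (b q : ℕ) : Exp :=
  add (arr₀ b) (.ite (.and (arr₀ 15) (.eq (.mod (arr₀ 19) (.lit 2)) (.lit q))) (arr₀ 23) (.lit 0))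

/-- The expressions for the arrays. -/
def prog : ℕ → Exp
  | 0 => .first (.var 0) (.and (.not (.ex 7 (.var 2) (.eq (arr₁ 0 (.var 7)) (.var 6))))
      (.ite (.var 2)
        (.or (adjE (arr₁ 0 (sub (.var 2) (.lit 1))) (.var 6))
          (.and (.not (.ex 7 (.var 0) (.and (adjE (arr₁ 0 (sub (.var 2) (.lit 1))) (.var 7))
              (.not (.ex 8 (.var 2) (.eq (arr₁ 0 (.var 8)) (.var 7)))))))
            (.ex 7 (.var 2) (adjE (arr₁ 0 (.var 7)) (.var 6)))))
        (.ex 7 (.var 0) (adjE (.var 6) (.var 7)))))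
  | 1 => .first (.var 0) (.eq (arr₁ 0 (.var 6)) (.var 0))
  | 2 => .bool (.and (.lt (.var 2) (arr₀ 1)) (.and (.lt (.var 3) (arr₀ 1))
      (adjE (arr₁ 0 (.var 2)) (arr₁ 0 (.var 3)))))
  | 3 => .not (.ex 5 (.var 0) (.ex 6 (.var 0) (adjE (.var 5) (.var 6))))
  | 4 => .not (.ex 5 (.var 0) (.ex 6 (.var 0) (.and (adjE (.var 5) (.var 6))
      (.not (.ex 7 (arr₀ 1) (.eq (arr₁ 0 (.var 7)) (.var 5)))))))
  | 5 => .not (.ex 5 (.var 0) (.and (.lt (.var 2) (.var 5)) (.arr 2 (.var 2) (.var 5))))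
  | 6 => .first (.var 0) (.arr 2 (.var 2) (.var 6))
  | 7 => .not (.lt (mul (.lit 4) (.sum 5 (.var 0)
      (.bool (.and (.lt (.var 5) (arr₀ 1)) (arr₁ 5 (.var 5)))))) (arr₀ 1))
  | 8 => .ite (.var 2)
      (.ite (arr₀ 7)
        (.ite (arr₁ 5 (sub (arr₀ 1) (.var 2))) (arr₁ 8 (sub (.var 2) (.lit 1)))
          (.ite (sub (arr₀ 1) (.var 2)) (mul (.lit 2) (arr₁ 8 (sub (.var 2) (.lit 1))))
            (mul (.lit 3) (arr₁ 8 (sub (.var 2) (.lit 1))))))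
        (.ite (arr₁ 5 (sub (arr₀ 1) (.var 2))) (mul (.lit 2) (arr₁ 8 (sub (.var 2) (.lit 1))))
          (add (arr₁ 8 (sub (.var 2) (.lit 1)))
            (arr₁ 8 (sub (sub (.var 2) (.lit 1)) (.lit 1))))))
      (.lit 1)
  | 11 => .ite (.var 2)
      (.mod (arr₁ 11 (sub (.var 2) (.lit 1))) (arr₁ 8 (sub (arr₀ 1) (.var 2)))) (.var 4)
  | 12 => .bin .div (arr₁ 11 (.var 2)) (arr₁ 8 (sub (arr₀ 1) (add (.var 2) (.lit 1))))
  | 13 => .ite (arr₀ 7)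
      (.ite (arr₁ 5 (.var 2)) (.lit 3) (.ite (.var 2)
        (.ite (.lt (arr₁ 6 (.var 2)) (.var 2))
          (.ite (arr₁ 13 (arr₁ 6 (.var 2)))
            (mul (arr₁ 12 (.var 2)) (arr₁ 13 (arr₁ 6 (.var 2))))
            (add (.lit 1) (arr₁ 12 (.var 2))))
          (.lit 0))
        (arr₁ 12 (.lit 0))))
      (sub (.lit 1) (arr₁ 12 (.var 2)))
  | 14 => .ite (.lt (.var 2) (arr₀ 1))
      (.ite (.not (.eq (arr₁ 13 (.var 2)) (.lit 3))) (arr₁ 13 (.var 2))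
        (.ite (.not (touchE 13 (.var 2) 0)) (.lit 3)
          (.ite (touchE 13 (.var 2) 1) (.lit 1)
            (.ite (touchE 13 (.var 2) 2) (.lit 2) (.lit 0)))))
      (.lit 4)
  | 15 => .not (.ex 5 (.var 0) (.ex 6 (.var 0) (.and (.arr 2 (.var 5) (.var 6))
      (.or (.and (.eq (arr₁ 14 (.var 5)) (.lit 0)) (.eq (arr₁ 14 (.var 6)) (.lit 0)))
        (.and (.eq (arr₁ 14 (.var 5)) (.lit 1)) (.eq (arr₁ 14 (.var 6)) (.lit 2)))))))
  | 16 => .ite (.var 2)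
      (.ite (.and (innE (sub (.var 2) (.lit 1))) (.or (.eq (.var 3) (sub (.var 2) (.lit 1)))
          (.ex 5 (sub (.var 2) (.lit 1)) (.and (innE (.var 5))
            (.and (.arr 2 (sub (.var 2) (.lit 1)) (.var 5))
              (.eq (.arr 16 (sub (.var 2) (.lit 1)) (.var 5))
                (.arr 16 (sub (.var 2) (.lit 1)) (.var 3))))))))
        (sub (.var 2) (.lit 1)) (.arr 16 (sub (.var 2) (.lit 1)) (.var 3)))
      (.var 3)
  | 17 => .sum 5 (.var 0) (.bool (innE (.var 5)))
  | 18 => compsE 1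
  | 19 => compsE 2
  | 20 => .bool (.ex 5 (.var 0) (.ex 6 (.var 0) (.and (.arr 2 (.var 2) (.var 5))
      (.and (.arr 2 (.var 3) (.var 6)) (.and (innE (.var 5)) (.and (innE (.var 6))
        (.eq (.arr 16 (.var 0) (.var 5)) (.arr 16 (.var 0) (.var 6)))))))))
  | 21 => .bool (.and (.eq (arr₁ 14 (.var 2)) (.lit 3)) (.not (touchE 14 (.var 2) 2)))
  | 22 => .ite (.eq (.var 2) (.lit 0)) (.lit 0) (.ite (.not (arr₁ 21 (.var 3))) (.lit 0)
      (.ite (.eq (.var 2) (.lit 1)) (.lit 1) (.sum 5 (sub (.var 2) (.lit 1))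
        (mul (.arr 22 (add (.var 5) (.lit 1)) (.var 3))
          (.sum 6 (.var 0) (.ite (.arr 20 (.var 3) (.var 6))
            (.arr 22 (sub (sub (.var 2) (.lit 1)) (.var 5)) (.var 6)) (.lit 0)))))))
  | 23 => add (.bool (.and (.not (.lt (.var 1) (arr₀ 17)))
        (.and (.eq (arr₀ 18) (.lit 1)) (.eq (arr₀ 19) (.lit 0)))))
      (.sum 5 (sub (.var 1) (arr₀ 17)) (.sum 6 (.var 0)
        (.arr 22 (add (.var 5) (.lit 1)) (.var 6))))
  | 24 => accE 9 0
  | 25 => accE 10 1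
  | _ => .lit 0

/-- The first part of the program. -/
def preS : Stmt := fills prog 0 8

/-- The body of the main loop. -/
def bodyS : Stmt := .seq (fills prog 11 14)
  (.seq (fill 9 (.arr 24 (.var 2) (.var 3))) (fill 10 (.arr 25 (.var 2) (.var 3))))

/-- The number of rounds of the main loop. -/
def roundsE : Exp := arr₁ 8 (arr₀ 1)

/-- The answer. -/
def answerE : Exp := .ite (arr₀ 3) (.lit 1) (.ite (arr₀ 4) (.not (.eq (arr₀ 9) (arr₀ 10))) (.lit 0))

theorem preS_wf : preS.wf 0 = true := by decide

theorem bodyS_wf : bodyS.wf 2 = true := by decide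

theorem roundsE_wf : roundsE.wf 0 = true := by decide

theorem answerE_wf : answerE.wf 0 = true := by decide

end ConnectedCover

namespace ConnectedCover

open ArrayLang ArrayLang.Exp RAM

/-! ### The arrays before the main loop -/

/-- The parameters of an evaluation for the graph with adjacency relation `a`. -/
structure Setting (Γ : Ctx) (k : ℕ) (a : ℕ → ℕ → Prop) (x : ℕ) (ρ : ℕ → ℕ) : Prop where
  W_eq : Γ.W = Γ.n + 2
  cap_eq : Γ.cap = (Γ.n + 2) ^ (8 * (Γ.n + 2))
  inp_zero : ∀ m, Γ.n * Γ.n ≤ m → Γ.inp m = 0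
  inp_iff : ∀ u w, w < Γ.n → (Γ.inp (Γ.n * u + w) ≠ 0 ↔ a u w)
  symm : ∀ u w, a u w → a w u
  irrefl : ∀ u, ¬ a u u
  lt : ∀ u w, a u w → u < Γ.n
  k_le : k ≤ Γ.n
  v0 : ρ 0 = Γ.n
  v1 : ρ 1 = k
  v4 : ρ 4 = x

variable {Γ : Ctx} {k x : ℕ} {a : ℕ → ℕ → Prop} {ρ : ℕ → ℕ} {T : ℕ → ℕ → ℕ → ℕ} {e f : Exp}

theorem ite_zero_one {p q : Prop} [Decidable p] [Decidable q] (h : q ↔ ¬ p) :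
    (if p then 0 else 1) = if q then 1 else 0 := by
  by_cases hp : p <;> simp [h, hp]

namespace Setting

variable (hS : Setting Γ k a x ρ)
include hS

theorem cap16 : (Γ.n + 2) ^ 16 ≤ Γ.cap := by
  rw [hS.cap_eq]
  exact Nat.pow_le_pow_right (by omega) (by omega)

theorem le_cap {u v w : ℕ} (hu : u ≤ Γ.n + 2) (hv : v ≤ Γ.n + 2) (hw : w ≤ Γ.n + 2) :
    u * v + w ≤ Γ.cap := by
  calc u * v + w ≤ (Γ.n + 2) * (Γ.n + 2) + (Γ.n + 2) := by gcongr
    _ ≤ (Γ.n + 2) ^ 3 := by nlinarith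
    _ ≤ (Γ.n + 2) ^ 16 := Nat.pow_le_pow_right (by omega) (by omega)
    _ ≤ Γ.cap := hS.cap16

theorem n_le_cap : 4 * (Γ.n + 2) ≤ Γ.cap := by
  calc 4 * (Γ.n + 2) ≤ (Γ.n + 2) ^ 3 := by nlinarith [Nat.zero_le (Γ.n ^ 3), Nat.zero_le (Γ.n ^ 2)]
    _ ≤ (Γ.n + 2) ^ 16 := Nat.pow_le_pow_right (by omega) (by omega)
    _ ≤ Γ.cap := hS.cap16

/-- Only the column index is tested: it makes `n * u + w` unambiguous, and too large a row index is
handled by `inp_iff`, which holds for all `u`. -/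
theorem tr_adjE {ρ' : ℕ → ℕ} (h0 : ρ' 0 = Γ.n) :
    (adjE e f).Tr T Γ.inp ρ' ↔ a (e.val T Γ.inp ρ') (f.val T Γ.inp ρ') := by
  rw [adjE, tr_and, tr_lt, tr_inp]
  simp only [val, h0, Op.eval]
  constructor
  · rintro ⟨h1, h2⟩
    exact (hS.inp_iff _ _ h1).mp h2
  · intro h
    have h1 := hS.lt _ _ (hS.symm _ _ h)
    exact ⟨h1, (hS.inp_iff _ _ h1).mpr h⟩

theorem good_adjE {lim : ℕ → ℕ} {ρ' : ℕ → ℕ} (h0 : ρ' 0 = Γ.n) :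
    (adjE e f).Good T Γ.inp Γ.n Γ.cap lim ρ' ↔ f.Good T Γ.inp Γ.n Γ.cap lim ρ' ∧
      (f.val T Γ.inp ρ' < Γ.n → e.Good T Γ.inp Γ.n Γ.cap lim ρ' ∧
        Γ.n * e.val T Γ.inp ρ' + f.val T Γ.inp ρ' ≤ Γ.cap) := by
  have := hS.n_le_cap
  simp only [adjE, good_and, good_lt, tr_lt, Good, val, h0, Op.eval]
  constructor
  · rintro ⟨⟨-, h1, -⟩, h2⟩
    exact ⟨h1, fun h => ⟨(h2 h).1.2.1, (h2 h).2.2⟩⟩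
  · rintro ⟨h1, h2⟩
    exact ⟨⟨trivial, h1, by omega⟩, fun h => ⟨⟨trivial, (h2 h).1, by have := (h2 h).2; omega⟩, h1, (h2 h).2⟩⟩

/-- The factor 3 leaves room for the products and sums in the recursion for `cnt`. -/
theorem cnt_le_cap {D : Ord} : ∀ i < Γ.n + 2, 3 * D.cnt i ≤ Γ.cap := by
  intro i hi
  calc 3 * D.cnt i ≤ 3 * 3 ^ i := by gcongr; exact Ord.cnt_le_pow i
    _ = 3 ^ (i + 1) := by ring
    _ ≤ 4 ^ (Γ.n + 2) := (Nat.pow_le_pow_right (by omega) (by omega)).trans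
      (Nat.pow_le_pow_left (by omega) _)
    _ ≤ ((Γ.n + 2) ^ 2) ^ (Γ.n + 2) := Nat.pow_le_pow_left (by nlinarith) _
    _ = (Γ.n + 2) ^ (2 * (Γ.n + 2)) := by rw [← pow_mul]
    _ ≤ (Γ.n + 2) ^ (8 * (Γ.n + 2)) := Nat.pow_le_pow_right (by omega) (by omega)
    _ = Γ.cap := hS.cap_eq.symm

end Setting

section Computes

attribute [local simp] good_not good_and good_or good_ite good_eq good_lt good_bool good_mod
  good_lit good_var good_arr good_bin good_sum tr_bin val_lit val_var val_arr val_bin val_sum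
  tr_var tr_arr tr_not tr_and tr_or tr_ite tr_eq tr_lt tr_ex val_not val_bool val_mod val_ite
  upd Op.eval lim tab prog

set_option linter.unusedSimpArgs false
set_option linter.unusedTactic false
set_option linter.unreachableTactic false

variable (hS : Setting Γ k a x ρ)
include hS

/-- Here and for the other arrays, the first goal bounds indices and intermediate values, so that
clamping is void, and the second identifies the value of the expression with the mathematical
recursion. -/
theorem Setting.computes_ord : Computes Γ (tab Γ.n k a x) ρ 0 (prog 0) := by
  have hc := hS.n_le_cap
  have hc2 : Γ.n + 2 ≤ Γ.cap := by omega
  have h0 := hS.v0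
  have hord : ∀ i, ord Γ.n a i ≤ Γ.n := fun i => by rw [ord_eq]; exact firstIdx_le
  have hmul : ∀ u w, u ≤ Γ.n → w ≤ Γ.n → Γ.n * u + w ≤ Γ.cap :=
    fun u w hu hw => hS.le_cap (by omega) (by omega) (by omega)
  intro i hi j hj
  constructor
  · simp [good_first hc2, good_ex hc2, h0, hS.good_adjE]
    repeat' first | intro _ | refine ⟨?_, ?_⟩ | omega | exact hmul _ _ (by omega) (by omega) | grind
  · rw [prog, val_first (p := Step Γ.n a (ord Γ.n a) i)]
    · simp [h0, ord_eq Γ.n a i]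
    · intro u w
      simp [h0, hS.tr_adjE, Step]
      grind

theorem Setting.computes_ordLen : Computes Γ (tab Γ.n k a x) ρ 1 (prog 1) := by
  have hc := hS.n_le_cap
  have hc2 : Γ.n + 2 ≤ Γ.cap := by omega
  have h0 := hS.v0
  have hord : ∀ i, ord Γ.n a i ≤ Γ.n := fun i => by rw [ord_eq]; exact firstIdx_le
  intro i hi j hj
  constructor
  · simp [good_first hc2, h0]
    repeat' first | intro _ | refine ⟨?_, ?_⟩ | omega | grind
  · rw [prog, val_first (p := fun i => ord Γ.n a i = Γ.n)]
    · simp [h0, ordLen]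
    · intro u w
      simp [h0]

theorem Setting.computes_adj : Computes Γ (tab Γ.n k a x) ρ 2 (prog 2) := by
  classical
  have hc := hS.n_le_cap
  have h0 := hS.v0
  have hN : ordLen Γ.n a ≤ Γ.n := firstIdx_le
  have hord : ∀ i, ord Γ.n a i ≤ Γ.n := fun i => by rw [ord_eq]; exact firstIdx_le
  have hmul : ∀ u w, u ≤ Γ.n → w ≤ Γ.n → Γ.n * u + w ≤ Γ.cap :=
    fun u w hu hw => hS.le_cap (by omega) (by omega) (by omega)
  intro i hi j hj
  constructor
  · simp [h0, hS.good_adjE]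
    repeat' first | intro _ | refine ⟨?_, ?_⟩ | omega | exact hmul _ _ (by omega) (by omega) | grind
  · simp [h0, hS.tr_adjE]

theorem Setting.computes_noEdges : Computes Γ (tab Γ.n k a x) ρ 3 (prog 3) := by
  classical
  have hc := hS.n_le_cap
  have hc2 : Γ.n + 2 ≤ Γ.cap := by omega
  have h0 := hS.v0
  have hmul : ∀ u w, u ≤ Γ.n → w ≤ Γ.n → Γ.n * u + w ≤ Γ.cap :=
    fun u w hu hw => hS.le_cap (by omega) (by omega) (by omega)
  intro i hi j hj
  constructor
  · simp [good_ex hc2, h0, hS.good_adjE]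
    repeat' first | intro _ | refine ⟨?_, ?_⟩ | omega | exact hmul _ _ (by omega) (by omega) | grind
  · simp [h0, hS.tr_adjE]
    refine if_congr ?_ rfl rfl
    constructor
    · rintro ⟨u, -, w, -, h⟩
      exact ⟨u, w, h⟩
    · rintro ⟨u, w, h⟩
      exact ⟨u, hS.lt _ _ h, w, hS.lt _ _ (hS.symm _ _ h), h⟩

theorem Setting.computes_found : Computes Γ (tab Γ.n k a x) ρ 4 (prog 4) := by
  classical
  have hc := hS.n_le_cap
  have hc2 : Γ.n + 2 ≤ Γ.cap := by omega
  have h0 := hS.v0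
  have hN : ordLen Γ.n a ≤ Γ.n := firstIdx_le
  have hord : ∀ i, ord Γ.n a i ≤ Γ.n := fun i => by rw [ord_eq]; exact firstIdx_le
  have hmul : ∀ u w, u ≤ Γ.n → w ≤ Γ.n → Γ.n * u + w ≤ Γ.cap :=
    fun u w hu hw => hS.le_cap (by omega) (by omega) (by omega)
  intro i hi j hj
  constructor
  · simp [good_ex hc2, h0, hS.good_adjE]
    repeat' first | intro _ | refine ⟨?_, ?_⟩ | omega | exact hmul _ _ (by omega) (by omega) | grind
  · have : (∀ u w, a u w → Found Γ.n a u) ↔ ¬ ∃ u < Γ.n, ∃ w < Γ.n, a u w ∧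
        ¬ ∃ i < ordLen Γ.n a, ord Γ.n a i = u := by
      constructor
      · rintro h ⟨u, -, w, -, ha, h'⟩
        exact h' (h u w ha)
      · intro h u w ha
        by_contra h'
        exact h ⟨u, hS.lt _ _ ha, w, hS.lt _ _ (hS.symm _ _ ha), ha, h'⟩
    simp only [tab, this]
    simp [h0, hS.tr_adjE]
    exact ite_zero_one (by push Not; exact Iff.rfl)

theorem Setting.computes_leaf : Computes Γ (tab Γ.n k a x) ρ 5 (prog 5) := by
  classical
  have hc := hS.n_le_cap
  have hc2 : Γ.n + 2 ≤ Γ.cap := by omega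
  have h0 := hS.v0
  intro i hi j hj
  constructor
  · simp [good_ex hc2, h0]
    repeat' first | intro _ | refine ⟨?_, ?_⟩ | omega | grind
  · simp [h0, Ord.leaf]
    exact ite_zero_one (by push Not; exact Iff.rfl)

theorem Setting.computes_par : Computes Γ (tab Γ.n k a x) ρ 6 (prog 6) := by
  classical
  have hc := hS.n_le_cap
  have hc2 : Γ.n + 2 ≤ Γ.cap := by omega
  have h0 := hS.v0
  intro i hi j hj
  constructor
  · simp [good_first hc2, h0]
    repeat' first | intro _ | refine ⟨?_, ?_⟩ | omega | grind
  · rw [prog, val_first (p := (ordGraph Γ.n a).r i)]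
    · simp [h0, Ord.par]
    · intro u w
      simp [h0]

theorem Setting.computes_many : Computes Γ (tab Γ.n k a x) ρ 7 (prog 7) := by
  classical
  have hc := hS.n_le_cap
  have hc2 : Γ.n + 2 ≤ Γ.cap := by omega
  have h0 := hS.v0
  have hN : ordLen Γ.n a ≤ Γ.n := firstIdx_le
  have hl : (ordGraph Γ.n a).leaves ≤ Γ.n := by
    have := Finset.sum_le_card_nsmul (Finset.range Γ.n)
      (fun i => if i < ordLen Γ.n a ∧ (ordGraph Γ.n a).leaf i then 1 else 0) 1
      (fun i _ => by split_ifs <;> omega)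
    rwa [smul_eq_mul, mul_one, Finset.card_range] at this
  have hl' : (ordGraph Γ.n a).leaves = ∑ i ∈ Finset.range Γ.n,
      if i < ordLen Γ.n a ∧ (ordGraph Γ.n a).leaf i then 1 else 0 := rfl
  intro i hi j hj
  constructor
  · simp [h0, ← hl']
    repeat' first | intro _ | refine ⟨?_, ?_⟩ | omega | grind
  · simp [h0, Ord.Many, ← hl']
    grind

theorem Setting.computes_cnt : Computes Γ (tab Γ.n k a x) ρ 8 (prog 8) := by
  classical
  have hc := hS.n_le_cap
  have hc2 : Γ.n + 2 ≤ Γ.cap := by omega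
  have h0 := hS.v0
  have hN : ordLen Γ.n a ≤ Γ.n := firstIdx_le
  have hb := hS.cnt_le_cap (D := ordGraph Γ.n a)
  intro i hi j hj
  constructor
  · simp [h0]
    repeat' first | intro _ | refine ⟨?_, ?_⟩ | omega | grind
  · cases i with
    | zero => simp [Ord.cnt]
    | succ i =>
      simp [h0]
      rw [Ord.cnt]
      simp

end Computes

end ConnectedCover

namespace ConnectedCover

open ArrayLang ArrayLang.Exp RAM

/-! ### The arrays of the main loop -/

theorem lab_le_max {r : ℕ → ℕ → Prop} {inn : ℕ → Prop} : ∀ {t i : ℕ}, lab r inn t i ≤ max t i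
  | 0, i => by rw [lab]; omega
  | t + 1, i => by
    have := lab_le_max (r := r) (inn := inn) (t := t) (i := i)
    rw [lab]
    split_ifs <;> omega

theorem sum_ite_le (n : ℕ) (p : ℕ → Prop) [DecidablePred p] :
    ∑ i ∈ Finset.range n, (if p i then 1 else 0) ≤ n := by
  have := Finset.sum_le_card_nsmul (Finset.range n) (fun i => if p i then 1 else 0) 1
    (fun i _ => by split_ifs <;> omega)
  rwa [smul_eq_mul, mul_one, Finset.card_range] at this

namespace Ord

variable {D : Ord}

theorem rem_le (y i : ℕ) : D.rem y i ≤ y := by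
  induction i with
  | zero => exact le_rfl
  | succ i ih =>
    rw [rem]
    exact (Nat.mod_le _ _).trans ih

theorem dig_le (y i : ℕ) : D.dig y i ≤ y := (Nat.div_le_self _ _).trans (rem_le y i)

theorem size_le (c : ℕ → ℕ) : D.size c ≤ D.n := by
  classical exact sum_ite_le _ _

theorem comps_le (c : ℕ → ℕ) (q : ℕ) : D.comps c q ≤ D.n := by
  classical exact sum_ite_le _ _

theorem fin_le {c : ℕ → ℕ} {i : ℕ} (h : c i ≤ 3) : D.fin c i ≤ 4 := by
  rw [fin]
  split_ifs <;> omega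

/-- This is `bw_le` with `A = (n + 2) ^ 2`, which is at least `j * n`. -/
theorem bw_le_pow {H : ℕ → ℕ → Prop} {O : ℕ → Prop} {n j a : ℕ} (hj : j < n + 2) :
    bw H n O j a ≤ (n + 2) ^ (4 * j - 2) := by
  rcases Nat.eq_zero_or_pos j with rfl | h0
  · rw [bw]; simp
  · refine (bw_le (A := (n + 2) ^ 2) O (by nlinarith) (Nat.one_le_pow _ _ (by omega))).trans ?_
    rw [← pow_mul, Nat.pow_div (by omega) (by omega)]
    exact Nat.pow_le_pow_right (by omega) (by omega)

theorem wt_le {k : ℕ} (hk : k ≤ D.n) (c : ℕ → ℕ) : D.wt k c ≤ (D.n + 2) ^ (4 * D.n + 1) := by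
  have hb : ∀ j ∈ Finset.range (k - D.size c), ∑ b ∈ Finset.range D.n,
      bw (D.link c) D.n (D.opt c) (j + 1) b ≤ D.n * (D.n + 2) ^ (4 * D.n - 2) := by
    intro j hj
    have hj := Finset.mem_range.mp hj
    have := Finset.sum_le_card_nsmul (Finset.range D.n) (fun b => bw (D.link c) D.n (D.opt c) (j + 1) b)
      ((D.n + 2) ^ (4 * D.n - 2)) fun b _ => (bw_le_pow (by omega)).trans
        (Nat.pow_le_pow_right (by omega) (by omega))
    rwa [smul_eq_mul, Finset.card_range] at this
  have := Finset.sum_le_card_nsmul _ _ _ hb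
  rw [smul_eq_mul, Finset.card_range] at this
  have h1 : D.wt k c ≤ 1 + D.n * (D.n * (D.n + 2) ^ (4 * D.n - 2)) := by
    rw [wt]
    refine add_le_add (by split_ifs <;> omega) (this.trans ?_)
    exact Nat.mul_le_mul_right _ (by omega)
  refine h1.trans ?_
  rcases Nat.eq_zero_or_pos D.n with h0 | h0
  · rw [h0]; simp
  · obtain ⟨m, hm⟩ : ∃ m, 4 * D.n - 2 = m := ⟨_, rfl⟩
    rw [hm, show 4 * D.n + 1 = m + 3 by omega, pow_add]
    have h2 : 1 ≤ (D.n + 2) ^ m := Nat.one_le_pow _ _ (by omega)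
    have h3 : (D.n + 2) ^ 3 ≥ 1 + D.n * D.n := by nlinarith [Nat.zero_le (D.n ^ 3)]
    calc 1 + D.n * (D.n * (D.n + 2) ^ m) ≤ (D.n + 2) ^ m * (1 + D.n * D.n) := by nlinarith
      _ ≤ (D.n + 2) ^ m * (D.n + 2) ^ 3 := Nat.mul_le_mul_left _ h3

end Ord

variable {Γ : Ctx} {k x : ℕ} {a : ℕ → ℕ → Prop} {ρ : ℕ → ℕ}

namespace Setting

variable (hS : Setting Γ k a x ρ)
include hS

/-- A vertex that is not a leaf provides an edge, hence `ordGraph_ok` applies. Indices beyond the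
graph count as leaves, so all `i` are covered. -/
theorem col_le_three (hx : x < (ordGraph Γ.n a).cnt (ordLen Γ.n a)) (i : ℕ) :
    (ordGraph Γ.n a).col x i ≤ 3 := by
  by_cases hM : (ordGraph Γ.n a).Many
  · by_cases hl : (ordGraph Γ.n a).leaf i
    · rw [Ord.col_leaf hM hl]
    · obtain ⟨j, hj, -, h⟩ := not_not.mp hl
      have hD := ordGraph_ok hS.symm hS.lt hS.irrefl ⟨_, _, h.2.2⟩
      exact (hD.col_le hM hx h.1 hl).trans (by omega)
  · rw [Ord.col_few hM]
    omega

theorem dig_mul_col_le (hx : x < (ordGraph Γ.n a).cnt (ordLen Γ.n a)) {i : ℕ}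
    (hM : (ordGraph Γ.n a).Many) (hl : ¬ (ordGraph Γ.n a).leaf i) :
    (ordGraph Γ.n a).dig x i * (ordGraph Γ.n a).col x ((ordGraph Γ.n a).par i) ≤ 6 := by
  obtain ⟨j, hj, -, h⟩ := not_not.mp hl
  have h1 := Ord.dig_lt hM hx h.1 hl
  have h2 : (ordGraph Γ.n a).dig x i ≤ 2 := by split_ifs at h1 <;> omega
  calc _ ≤ 2 * 3 := Nat.mul_le_mul h2 (hS.col_le_three hx _)

theorem pow_le_cap {e : ℕ} (he : e ≤ 8 * (Γ.n + 2)) : (Γ.n + 2) ^ e ≤ Γ.cap := by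
  rw [hS.cap_eq]
  exact Nat.pow_le_pow_right (by omega) he

end Setting

section Computes

attribute [local simp] good_not good_and good_or good_ite good_eq good_lt good_bool good_mod
  good_lit good_var good_arr good_bin good_sum tr_bin val_lit val_var val_arr val_bin val_sum
  tr_var tr_arr tr_not tr_and tr_or tr_ite tr_eq tr_lt tr_ex val_not val_bool val_mod val_ite
  upd Op.eval lim tab prog

attribute [-simp] ordGraph_r

set_option linter.unusedSimpArgs false
set_option linter.unusedTactic false
set_option linter.unreachableTactic false

variable (hS : Setting Γ k a x ρ) (hx : x < (ordGraph Γ.n a).cnt (ordLen Γ.n a))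
include hS hx

theorem Setting.computes_rem : Computes Γ (tab Γ.n k a x) ρ 11 (prog 11) := by
  classical
  have hc := hS.n_le_cap
  have h4 := hS.v4
  have hN : ordLen Γ.n a ≤ Γ.n := firstIdx_le
  have hb := hS.cnt_le_cap (D := ordGraph Γ.n a) (ordLen Γ.n a) (by omega)
  have hr := fun i => (ordGraph Γ.n a).rem_le x i
  intro i hi j hj
  constructor
  · simp [h4]
    have h1 := hr (i - 1)
    refine fun h0 => ⟨by omega, by omega, ?_, ?_, ?_⟩
    · exact (Nat.div_le_self _ _).trans (by omega)
    · exact (Nat.div_mul_le_self _ _).trans (by omega)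
    · exact (Nat.mod_le _ _).trans (by omega)
  · cases i with
    | zero => simp [h4, Ord.rem]
    | succ i => simp [Ord.rem]

theorem Setting.computes_dig : Computes Γ (tab Γ.n k a x) ρ 12 (prog 12) := by
  classical
  have hc := hS.n_le_cap
  have hN : ordLen Γ.n a ≤ Γ.n := firstIdx_le
  have hb := hS.cnt_le_cap (D := ordGraph Γ.n a) (ordLen Γ.n a) (by omega)
  have hd := fun i => (ordGraph Γ.n a).dig_le x i
  intro i hi j hj
  constructor
  · simp
    have := hd i
    simp only [Ord.dig, ordGraph_N] at this
    omega
  · simp [Ord.dig]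

theorem Setting.computes_col : Computes Γ (tab Γ.n k a x) ρ 13 (prog 13) := by
  classical
  have hc := hS.n_le_cap
  have hN : ordLen Γ.n a ≤ Γ.n := firstIdx_le
  have hb := hS.cnt_le_cap (D := ordGraph Γ.n a) (ordLen Γ.n a) (by omega)
  have hd := fun i => (ordGraph Γ.n a).dig_le x i
  have hm := fun i => hS.dig_mul_col_le hx (i := i)
  intro i hi j hj
  constructor
  · simp
    repeat' first | intro _ | refine ⟨?_, ?_⟩ | omega | grind
  · simp
    conv_rhs => rw [Ord.col]
    simp

theorem Setting.computes_fin : Computes Γ (tab Γ.n k a x) ρ 14 (prog 14) := by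
  classical
  have hc := hS.n_le_cap
  have hc2 : Γ.n + 2 ≤ Γ.cap := by omega
  have h0 := hS.v0
  have hN : ordLen Γ.n a ≤ Γ.n := firstIdx_le
  have h3 := hS.col_le_three hx
  intro i hi j hj
  constructor
  · simp [touchE, good_ex hc2, h0]
    repeat' first | intro _ | refine ⟨?_, ?_⟩ | omega | grind
  · simp [touchE, h0, Ord.fin, Ord.touch]

theorem Setting.computes_valid : Computes Γ (tab Γ.n k a x) ρ 15 (prog 15) := by
  classical
  have hc := hS.n_le_cap
  have hc2 : Γ.n + 2 ≤ Γ.cap := by omega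
  have h0 := hS.v0
  have h3 := fun i => Ord.fin_le (D := ordGraph Γ.n a) (hS.col_le_three hx i)
  intro i hi j hj
  constructor
  · simp [good_ex hc2, h0]
    repeat' first | intro _ | refine ⟨?_, ?_⟩ | omega | grind
  · simp [h0, Ord.Valid]
    exact ite_zero_one (by push Not; grind)

theorem Setting.computes_lab : Computes Γ (tab Γ.n k a x) ρ 16 (prog 16) := by
  classical
  have hc := hS.n_le_cap
  have hc2 : Γ.n + 2 ≤ Γ.cap := by omega
  have h0 := hS.v0
  have h3 := fun i => Ord.fin_le (D := ordGraph Γ.n a) (hS.col_le_three hx i)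
  have hl := fun t i => lab_le_max (r := (ordGraph Γ.n a).r)
    (inn := (ordGraph Γ.n a).inn ((ordGraph Γ.n a).col x)) (t := t) (i := i)
  intro i hi j hj
  constructor
  · simp [innE, good_ex hc2, h0]
    repeat' first | intro _ | refine ⟨?_, ?_⟩ | omega | grind
  · cases i with
    | zero => simp [lab]
    | succ i =>
      simp [innE, lab, Ord.inn]
      congr

theorem Setting.computes_size : Computes Γ (tab Γ.n k a x) ρ 17 (prog 17) := by
  classical
  have hc := hS.n_le_cap
  have h0 := hS.v0
  have h3 := fun i => Ord.fin_le (D := ordGraph Γ.n a) (hS.col_le_three hx i)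
  have hs := (ordGraph Γ.n a).size_le ((ordGraph Γ.n a).col x)
  intro i hi j hj
  constructor
  · simp [innE, h0]
    simp only [Ord.size, Ord.inn, ordGraph_n] at hs
    repeat' first | intro _ | refine ⟨?_, ?_⟩ | omega | grind
  · simp [innE, h0, Ord.size, Ord.inn, -Finset.sum_boole]
    exact Finset.sum_congr rfl fun i _ => by
      split_ifs with h
      exacts [(if_pos h).symm, (if_neg h).symm]

theorem Setting.computes_comps₁ : Computes Γ (tab Γ.n k a x) ρ 18 (prog 18) := by
  classical
  have hc := hS.n_le_cap
  have h0 := hS.v0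
  have h3 := fun i => Ord.fin_le (D := ordGraph Γ.n a) (hS.col_le_three hx i)
  have hs := (ordGraph Γ.n a).comps_le ((ordGraph Γ.n a).col x) 1
  have hl := fun t i => lab_le_max (r := (ordGraph Γ.n a).r)
    (inn := (ordGraph Γ.n a).inn ((ordGraph Γ.n a).col x)) (t := t) (i := i)
  intro i hi j hj
  constructor
  · simp [compsE, h0]
    simp only [Ord.comps, Ord.L, ordGraph_n] at hs
    repeat' first | intro _ | refine ⟨?_, ?_⟩ | omega | grind
  · simp [compsE, h0, Ord.comps, Ord.L]

theorem Setting.computes_comps₂ : Computes Γ (tab Γ.n k a x) ρ 19 (prog 19) := by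
  classical
  have hc := hS.n_le_cap
  have h0 := hS.v0
  have h3 := fun i => Ord.fin_le (D := ordGraph Γ.n a) (hS.col_le_three hx i)
  have hs := (ordGraph Γ.n a).comps_le ((ordGraph Γ.n a).col x) 2
  have hl := fun t i => lab_le_max (r := (ordGraph Γ.n a).r)
    (inn := (ordGraph Γ.n a).inn ((ordGraph Γ.n a).col x)) (t := t) (i := i)
  intro i hi j hj
  constructor
  · simp [compsE, h0]
    simp only [Ord.comps, Ord.L, ordGraph_n] at hs
    repeat' first | intro _ | refine ⟨?_, ?_⟩ | omega | grind
  · simp [compsE, h0, Ord.comps, Ord.L]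

theorem Setting.computes_link : Computes Γ (tab Γ.n k a x) ρ 20 (prog 20) := by
  classical
  have hc := hS.n_le_cap
  have hc2 : Γ.n + 2 ≤ Γ.cap := by omega
  have h0 := hS.v0
  have h3 := fun i => Ord.fin_le (D := ordGraph Γ.n a) (hS.col_le_three hx i)
  have hl := fun t i => lab_le_max (r := (ordGraph Γ.n a).r)
    (inn := (ordGraph Γ.n a).inn ((ordGraph Γ.n a).col x)) (t := t) (i := i)
  intro i hi j hj
  constructor
  · simp [innE, h0, good_ex hc2]
    repeat' first | intro _ | refine ⟨?_, ?_⟩ | omega | grind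
  · simp [innE, h0, Ord.link, Ord.L, Ord.inn]

theorem Setting.computes_opt : Computes Γ (tab Γ.n k a x) ρ 21 (prog 21) := by
  classical
  have hc := hS.n_le_cap
  have hc2 : Γ.n + 2 ≤ Γ.cap := by omega
  have h0 := hS.v0
  have h3 := fun i => Ord.fin_le (D := ordGraph Γ.n a) (hS.col_le_three hx i)
  intro i hi j hj
  constructor
  · simp [touchE, h0, good_ex hc2]
    repeat' first | intro _ | refine ⟨?_, ?_⟩ | omega | grind
  · simp [touchE, h0, Ord.opt, Ord.touch]

end Computes

end ConnectedCover

namespace ConnectedCover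

open ArrayLang ArrayLang.Exp RAM

/-! ### The weights -/

section Computes

variable {Γ : Ctx} {k x : ℕ} {a : ℕ → ℕ → Prop} {ρ : ℕ → ℕ}

attribute [local simp] good_not good_and good_or good_ite good_eq good_lt good_bool good_mod
  good_lit good_var good_arr good_bin good_sum tr_bin val_lit val_var val_arr val_bin val_sum
  tr_var tr_arr tr_not tr_and tr_or tr_ite tr_eq tr_lt tr_ex val_not val_bool val_mod val_ite
  upd Op.eval lim tab prog

attribute [-simp] ordGraph_r Finset.sum_boole

set_option linter.unusedSimpArgs false
set_option linter.unusedTactic false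
set_option linter.unreachableTactic false

variable (hS : Setting Γ k a x ρ)
include hS

theorem Setting.computes_bw : Computes Γ (tab Γ.n k a x) ρ 22 (prog 22) := by
  classical
  have hc := hS.n_le_cap
  have h0 := hS.v0
  intro i hi j hj
  obtain ⟨H, hH⟩ : ∃ H, (ordGraph Γ.n a).link ((ordGraph Γ.n a).col x) = H := ⟨_, rfl⟩
  obtain ⟨O, hO⟩ : ∃ O, (ordGraph Γ.n a).opt ((ordGraph Γ.n a).col x) = O := ⟨_, rfl⟩
  have hval : ¬ i = 0 → O j → ¬ i = 1 → bw H Γ.n O i j = ∑ u ∈ Finset.range (i - 1),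
      bw H Γ.n O (u + 1) j * ∑ w ∈ Finset.range Γ.n,
        if H j w then bw H Γ.n O (i - 1 - u) w else 0 := by
    intro h1 h2 h3
    rw [bw, if_neg h1, if_neg (not_not.mpr h2), if_neg h3, Finset.sum_range]
  have hbw : ∀ u w, u < Γ.n + 2 → bw H Γ.n O u w ≤ (Γ.n + 2) ^ (4 * u - 2) :=
    fun u w hu => Ord.bw_le_pow hu
  constructor
  · simp [h0, hH, hO]
    refine ⟨by omega, fun h1 => ⟨hj, fun h2 => ⟨by omega, fun h3 => ?_⟩⟩⟩
    have hle : ∑ u ∈ Finset.range (i - 1), bw H Γ.n O (u + 1) j * ∑ w ∈ Finset.range Γ.n,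
        (if H j w then bw H Γ.n O (i - 1 - u) w else 0) ≤ Γ.cap := by
      rw [← hval h1 h2 h3]
      exact (hbw i j hi).trans (hS.pow_le_cap (by omega))
    refine ⟨by omega, by omega, fun u hu => ⟨⟨by omega, by omega⟩, ⟨fun w hw => ?_, ?_⟩, ?_⟩, hle⟩
    · repeat' first | intro _ | refine ⟨?_, ?_⟩ | omega
    · have : ∀ w ∈ Finset.range Γ.n, (if H j w then bw H Γ.n O (i - 1 - u) w else 0) ≤
          (Γ.n + 2) ^ (4 * Γ.n + 4) := by
        intro w _
        split_ifs
        · exact (hbw _ w (by omega)).trans (Nat.pow_le_pow_right (by omega) (by omega))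
        · exact Nat.zero_le _
      have := Finset.sum_le_card_nsmul _ _ _ this
      rw [smul_eq_mul, Finset.card_range] at this
      refine this.trans ((Nat.mul_le_mul_right _ (show Γ.n ≤ Γ.n + 2 by omega)).trans ?_)
      rw [← pow_succ']
      exact hS.pow_le_cap (by omega)
    · exact (Finset.single_le_sum (f := fun u => bw H Γ.n O (u + 1) j * ∑ w ∈ Finset.range Γ.n,
        (if H j w then bw H Γ.n O (i - 1 - u) w else 0)) (fun _ _ => Nat.zero_le _)
        (Finset.mem_range.mpr hu)).trans hle
  · simp [h0, hH, hO]
    by_cases h1 : i = 0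
    · rw [if_pos h1, h1, bw, if_pos rfl]
    · by_cases h2 : O j
      · by_cases h3 : i = 1
        · rw [if_neg h1, if_pos h2, if_pos h3, bw, if_neg h1, if_neg (not_not.mpr h2), if_pos h3]
        · rw [if_neg h1, if_pos h2, if_neg h3, hval h1 h2 h3]
      · rw [if_neg h1, if_neg h2, bw, if_neg h1, if_pos h2]

theorem Setting.computes_wt : Computes Γ (tab Γ.n k a x) ρ 23 (prog 23) := by
  classical
  have hc := hS.n_le_cap
  have h0 := hS.v0
  have h1 := hS.v1
  have hk := hS.k_le
  have hs := (ordGraph Γ.n a).size_le ((ordGraph Γ.n a).col x)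
  have hc1 := (ordGraph Γ.n a).comps_le ((ordGraph Γ.n a).col x) 1
  have hc2 := (ordGraph Γ.n a).comps_le ((ordGraph Γ.n a).col x) 2
  have hw := (Ord.wt_le (D := ordGraph Γ.n a) hk ((ordGraph Γ.n a).col x)).trans
    (hS.pow_le_cap (by simp; omega))
  rw [Ord.wt] at hw
  simp only [ordGraph_n] at hs hc1 hc2 hw
  intro i hi j hj
  constructor
  · have hsum := (Nat.le_add_left _ _).trans hw
    simp [h0, h1]
    refine ⟨by omega, ⟨by omega, by omega, fun u hu => ⟨fun w hw => by omega, ?_⟩, hsum⟩, ?_⟩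
    · exact (Finset.single_le_sum (f := fun u => ∑ w ∈ Finset.range Γ.n,
        bw ((ordGraph Γ.n a).link ((ordGraph Γ.n a).col x)) Γ.n
          ((ordGraph Γ.n a).opt ((ordGraph Γ.n a).col x)) (u + 1) w) (fun _ _ => Nat.zero_le _)
        (Finset.mem_range.mpr hu)).trans hsum
    · convert hw
  · simp [h0, h1, Ord.wt]

/-- There are at most `3 ^ n ≤ (n + 2) ^ (2 * n)` rounds of weight at most `(n + 2) ^ (4 * n + 1)`
each; the exponent of `cap` is chosen large enough for the product. -/
theorem Setting.sum_signed_le (hx : x < (ordGraph Γ.n a).cnt (ordLen Γ.n a)) (q : ℕ) :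
    ∑ y ∈ Finset.range (x + 1), (ordGraph Γ.n a).signed k q ((ordGraph Γ.n a).col y) ≤ Γ.cap := by
  have h : ∀ y ∈ Finset.range (x + 1), (ordGraph Γ.n a).signed k q ((ordGraph Γ.n a).col y) ≤
      (Γ.n + 2) ^ (4 * Γ.n + 1) := by
    intro y _
    rw [Ord.signed]
    split_ifs
    · exact Ord.wt_le (D := ordGraph Γ.n a) hS.k_le _
    · exact Nat.zero_le _
  have h' := Finset.sum_le_card_nsmul _ _ _ h
  rw [smul_eq_mul, Finset.card_range] at h'
  have hN : ordLen Γ.n a ≤ Γ.n := firstIdx_le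
  have hx' : x + 1 ≤ (Γ.n + 2) ^ (2 * Γ.n) := by
    calc x + 1 ≤ (ordGraph Γ.n a).cnt (ordLen Γ.n a) := hx
      _ ≤ 3 ^ ordLen Γ.n a := Ord.cnt_le_pow _
      _ ≤ 3 ^ Γ.n := Nat.pow_le_pow_right (by omega) hN
      _ ≤ ((Γ.n + 2) ^ 2) ^ Γ.n := Nat.pow_le_pow_left (by nlinarith) _
      _ = (Γ.n + 2) ^ (2 * Γ.n) := by rw [← pow_mul]
  calc _ ≤ _ := h'
    _ ≤ (Γ.n + 2) ^ (2 * Γ.n) * (Γ.n + 2) ^ (4 * Γ.n + 1) := Nat.mul_le_mul_right _ hx'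
    _ = (Γ.n + 2) ^ (2 * Γ.n + (4 * Γ.n + 1)) := (pow_add _ _ _).symm
    _ ≤ Γ.cap := hS.pow_le_cap (by omega)

theorem Setting.computes_acc₀ (hx : x < (ordGraph Γ.n a).cnt (ordLen Γ.n a)) :
    Computes Γ (tab Γ.n k a x) ρ 24 (prog 24) := by
  classical
  have hc := hS.n_le_cap
  have hc2 := (ordGraph Γ.n a).comps_le ((ordGraph Γ.n a).col x) 2
  simp only [ordGraph_n] at hc2
  have hs := hS.sum_signed_le hx 0
  rw [Finset.sum_range_succ, Ord.signed] at hs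
  intro i hi j hj
  constructor
  · simp [accE]
    exact ⟨fun _ => by omega, by convert hs⟩
  · simp [accE, Finset.sum_range_succ, Ord.signed]

theorem Setting.computes_acc₁ (hx : x < (ordGraph Γ.n a).cnt (ordLen Γ.n a)) :
    Computes Γ (tab Γ.n k a x) ρ 25 (prog 25) := by
  classical
  have hc := hS.n_le_cap
  have hc2 := (ordGraph Γ.n a).comps_le ((ordGraph Γ.n a).col x) 2
  simp only [ordGraph_n] at hc2
  have hs := hS.sum_signed_le hx 1
  rw [Finset.sum_range_succ, Ord.signed] at hs
  intro i hi j hj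
  constructor
  · simp [accE]
    exact ⟨fun _ => by omega, by convert hs⟩
  · simp [accE, Finset.sum_range_succ, Ord.signed]

end Computes

end ConnectedCover

namespace ConnectedCover

open ArrayLang ArrayLang.Exp RAM

/-! ### The run of the program -/

variable {Γ : Ctx} {k x : ℕ} {a : ℕ → ℕ → Prop} {ρ : ℕ → ℕ}

theorem Setting.computes_pre (hS : Setting Γ k a x ρ) {b : ℕ} (hb : b ≤ 8) :
    Computes Γ (tab Γ.n k a x) ρ b (prog b) := by
  interval_cases b
  exacts [hS.computes_ord, hS.computes_ordLen, hS.computes_adj, hS.computes_noEdges,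
    hS.computes_found, hS.computes_leaf, hS.computes_par, hS.computes_many, hS.computes_cnt]

theorem Setting.computes_body (hS : Setting Γ k a x ρ)
    (hx : x < (ordGraph Γ.n a).cnt (ordLen Γ.n a)) {b : ℕ} (hb : 11 ≤ b) (hb' : b ≤ 25) :
    Computes Γ (tab Γ.n k a x) ρ b (prog b) := by
  interval_cases b
  exacts [hS.computes_rem hx, hS.computes_dig hx, hS.computes_col hx, hS.computes_fin hx,
    hS.computes_valid hx, hS.computes_lab hx, hS.computes_size hx, hS.computes_comps₁ hx,
    hS.computes_comps₂ hx, hS.computes_link hx, hS.computes_opt hx, hS.computes_bw, hS.computes_wt,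
    hS.computes_acc₀ hx, hS.computes_acc₁ hx]

theorem Setting.congr (hS : Setting Γ k a x ρ) {y : ℕ} {ρ' : ℕ → ℕ} (h0 : ρ' 0 = ρ 0)
    (h1 : ρ' 1 = ρ 1) (h4 : ρ' 4 = y) : Setting Γ k a y ρ' :=
  { hS with v0 := h0.trans hS.v0, v1 := h1.trans hS.v1, v4 := h4 }

/-- An array may read only earlier rows of itself, so the new running sums are first formed in the
arrays 24 and 25 and then copied to 9 and 10. -/
theorem copy_known (hW : Γ.W = Γ.n + 2) (hcap : Γ.n + 2 ≤ Γ.cap) {σ : Env} {b c : ℕ} (hbc : c ≠ b)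
    (h0 : σ.v 0 = Γ.n) :
    let σ' := (fill b (.arr c (.var 2) (.var 3))).exec Γ σ
    (∀ x, x ≠ 2 → x ≠ 3 → σ'.v x = σ.v x) ∧ (∀ d ≠ b, σ'.A d = σ.A d) ∧
      ∀ i < Γ.n + 2, ∀ j < Γ.n + 2, σ'.A b i j = σ.A c i j := by
  refine fill_exec (g := σ.A c) hW hcap h0 fun i hi j hj τ hv hb _ => ?_
  have h2 : τ.v 2 = i := by rw [hv]; rfl
  have h3 : τ.v 3 = j := by rw [hv]; rfl
  rw [Exp.eval, Exp.eval, Exp.eval, h2, h3, min_eq_left (by omega), min_eq_left (by omega),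
    hb c hbc]

theorem tab_succ {n : ℕ} {b : ℕ} (hb : b < 9) : tab n k a (x + 1) b = tab n k a x b := by
  funext i j
  interval_cases b <;> simp only [tab]

/-- Between rounds only the arrays below 11 matter: the first nine do not depend on the round, and 9
and 10 hold the sums over the rounds done. All others are recomputed in place, which keeps the space
polynomial. -/
theorem Setting.loop_known {σ : Env} (hS : Setting Γ k a x σ.v)
    (hσ : Known Γ.n (tab Γ.n k a 0) 11 σ) : ∀ y ≤ (ordGraph Γ.n a).cnt (ordLen Γ.n a),
    let σ' := iter (bodyS.exec Γ) 4 σ y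
    σ'.v 0 = σ.v 0 ∧ σ'.v 1 = σ.v 1 ∧ Known Γ.n (tab Γ.n k a y) 11 σ' := by
  intro y
  have hcap : Γ.n + 2 ≤ Γ.cap := by have := hS.n_le_cap; omega
  have hW := hS.W_eq
  induction y with
  | zero => intro _; exact ⟨rfl, rfl, hσ⟩
  | succ y ih =>
    intro hy
    obtain ⟨i0, i1, i2⟩ := ih (by omega)
    rw [iter]
    generalize iter (bodyS.exec Γ) 4 σ y = σ₁ at i0 i1 i2 ⊢
    have hS₁ : Setting Γ k a y (σ₁.set 4 y).v := hS.congr i0 i1 rfl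
    rw [bodyS, Stmt.exec, Stmt.exec]
    obtain ⟨f1, -, f3⟩ := fills_known (T := tab Γ.n k a y) (E := prog) hW hcap hS.inp_zero hS₁.v0
      (show Known Γ.n (tab Γ.n k a y) 11 (σ₁.set 4 y) from i2) 14 fun ρ hρ b hb hb' =>
        (hS₁.congr (y := y) (hρ 0 (by omega) (by omega)) (hρ 1 (by omega) (by omega))
          ((hρ 4 (by omega) (by omega)).trans rfl)).computes_body (by omega) hb hb'
    generalize (fills prog 11 14).exec Γ (σ₁.set 4 y) = σ₂ at f1 f3 ⊢
    have e0 : σ₂.v 0 = Γ.n := (f1 0 (by omega) (by omega)).trans hS₁.v0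
    have e1 : σ₂.v 1 = k := (f1 1 (by omega) (by omega)).trans hS₁.v1
    obtain ⟨g1, g2, g3⟩ := copy_known (b := 9) (c := 24) hW hcap (by omega) e0
    generalize (fill 9 (.arr 24 (.var 2) (.var 3))).exec Γ σ₂ = σ₃ at g1 g2 g3 ⊢
    obtain ⟨k1, k2, k3⟩ := copy_known (b := 10) (c := 25) hW hcap (by omega)
      ((g1 0 (by omega) (by omega)).trans e0)
    generalize (fill 10 (.arr 25 (.var 2) (.var 3))).exec Γ σ₃ = σ₄ at k1 k2 k3 ⊢
    refine ⟨?_, ?_, fun b hb i hi j hj => ?_⟩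
    · rw [k1 0 (by omega) (by omega), g1 0 (by omega) (by omega), e0, hS.v0]
    · rw [k1 1 (by omega) (by omega), g1 1 (by omega) (by omega), e1, hS.v1]
    · by_cases h10 : b = 10
      · subst h10
        rw [k3 i hi j hj, g2 25 (by omega), f3 25 (by omega) i hi j hj]
        rfl
      · rw [k2 b h10]
        by_cases h9 : b = 9
        · subst h9
          rw [g3 i hi j hj, f3 24 (by omega) i hi j hj]
          rfl
        · rw [g2 b h9, f3 b (by omega) i hi j hj, tab_succ (by omega)]

theorem Setting.pre_known {σ : Env} (hS : Setting Γ k a x σ.v) (hσ : ∀ b i j, σ.A b i j = 0) :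
    let σ' := preS.exec Γ σ
    Setting Γ k a x σ'.v ∧ Known Γ.n (tab Γ.n k a 0) 11 σ' := by
  have hcap : Γ.n + 2 ≤ Γ.cap := by have := hS.n_le_cap; omega
  obtain ⟨f1, f2, f3⟩ := fills_known (T := tab Γ.n k a x) (E := prog) (b := 0) (σ := σ) hS.W_eq hcap
    hS.inp_zero hS.v0 (fun b hb => absurd hb (by omega)) 8 fun ρ hρ b _ hb =>
      (hS.congr (hρ 0 (by omega) (by omega)) (hρ 1 (by omega) (by omega))
        ((hρ 4 (by omega) (by omega)).trans hS.v4)).computes_pre (by omega)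
  refine ⟨hS.congr (f1 0 (by omega) (by omega)) (f1 1 (by omega) (by omega))
    ((f1 4 (by omega) (by omega)).trans hS.v4), fun b hb i hi j hj => ?_⟩
  by_cases h9 : b < 9
  · have hx : ∀ x, tab Γ.n k a x b = tab Γ.n k a 0 b := by
      intro x
      induction x with
      | zero => rfl
      | succ x ih => rw [tab_succ h9, ih]
    rw [preS, f3 b (by omega) i hi j hj, hx]
  · rw [preS, f2 b (by omega), hσ]
    -- The running sums start as empty sums, in agreement with memory being 0.
    have : b = 9 ∨ b = 10 := by omega
    rcases this with rfl | rfl <;> rfl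

theorem Setting.rounds_eval (hS : Setting Γ k a x ρ) {σ : Env}
    (hσ : Known Γ.n (tab Γ.n k a 0) 11 σ) :
    roundsE.eval Γ σ = (ordGraph Γ.n a).cnt (ordLen Γ.n a) := by
  have hN : ordLen Γ.n a ≤ Γ.n := firstIdx_le
  simp only [roundsE, Exp.eval, Nat.zero_min, hσ 1 (by omega) 0 (by omega) 0 (by omega), tab]
  rw [min_eq_left (by rw [hS.W_eq]; omega), hσ 8 (by omega) _ (by omega) 0 (by omega)]
  rfl

/-- Three cases: without edges the empty set is a cover for every bound; an edge outside the found
component excludes connected covers; otherwise the even and the odd sum differ exactly if there is a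
cover. -/
theorem Setting.answer_eval [Decidable (∃ U, (⟨Γ.n, Γ.n, a⟩ : Ord).IsCover U ∧ U.card ≤ x)]
    (hS : Setting Γ (min x Γ.n) a 0 ρ) {σ : Env}
    (hσ : Known Γ.n (tab Γ.n (min x Γ.n) a ((ordGraph Γ.n a).cnt (ordLen Γ.n a))) 11 σ) :
    answerE.eval Γ σ = if ∃ U, (⟨Γ.n, Γ.n, a⟩ : Ord).IsCover U ∧ U.card ≤ x then 1 else 0 := by
  classical
  have hcap := hS.n_le_cap
  have hA : ∀ b < 11, σ.A b 0 0 = tab Γ.n (min x Γ.n) a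
      ((ordGraph Γ.n a).cnt (ordLen Γ.n a)) b 0 0 := fun b hb => hσ b hb 0 (by omega) 0 (by omega)
  simp only [answerE, Exp.eval, Nat.zero_min, hA 3 (by omega), hA 4 (by omega), tab]
  by_cases he : ∃ u w, a u w
  · rw [if_pos he, if_neg (by simp)]
    by_cases hf : ∀ u w, a u w → Found Γ.n a u
    · rw [if_pos hf, if_pos (by simp)]
      have hD := ordGraph_ok hS.symm hS.lt hS.irrefl he
      have h1 := hD.sum_signed (min x Γ.n)
      rw [← cover_iff hS.symm hS.lt hS.irrefl he hf x] at h1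
      rw [← if_congr h1 rfl rfl]
      have h9 := hA 9 (by omega)
      have h10 := hA 10 (by omega)
      simp only [tab] at h9 h10
      rw [ordGraph_N, ← h9, ← h10]
      have hle : ∀ q, ∑ y ∈ Finset.range ((ordGraph Γ.n a).cnt (ordLen Γ.n a)),
          (ordGraph Γ.n a).signed (min x Γ.n) q ((ordGraph Γ.n a).col y) ≤ Γ.cap := by
        intro q
        -- The bound `sum_signed_le` concerns the sum up to and including a round, so it is applied
        -- to the last round `cnt - 1`.
        have hpos := Ord.cnt_pos (D := ordGraph Γ.n a) (ordLen Γ.n a)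
        have := (hS.congr (y := (ordGraph Γ.n a).cnt (ordLen Γ.n a) - 1) (ρ' := fun i => if i = 4 then
          (ordGraph Γ.n a).cnt (ordLen Γ.n a) - 1 else ρ i) rfl rfl rfl).sum_signed_le (by omega) q
        rwa [Nat.sub_add_cancel hpos] at this
      have h9' := h9.trans_le (hle 0)
      have h10' := h10.trans_le (hle 1)
      simp only [Exp.not, Exp.eq, Exp.eval, Nat.zero_min, Op.eval]
      rw [min_eq_left (by omega), min_eq_left (by omega)]
      split_ifs <;> omega
    · rw [if_neg hf, if_neg (by simp), if_neg]
      push Not at hf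
      obtain ⟨u, w, h, hu⟩ := hf
      rintro ⟨U, hU, -⟩
      exact not_cover hS.symm hS.lt hS.irrefl h hu hU
  · rw [if_neg he, if_pos (by simp), if_pos]
    refine ⟨∅, ⟨by simp, fun u w h => absurd ⟨u, w, h⟩ he, ?_⟩, by simp⟩
    rintro p ⟨b, hb, -⟩
    simp at hb

theorem Setting.cnt_pow_le (hS : Setting Γ k a x ρ) :
    ((ordGraph Γ.n a).cnt (ordLen Γ.n a) : ℝ) ^ 4 ≤ 16 * 8.475 ^ Γ.n := by
  have hone : (1 : ℝ) ≤ 8.475 ^ Γ.n := one_le_pow₀ (by norm_num)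
  by_cases he : ∃ u w, a u w
  · refine (ordGraph_ok hS.symm hS.lt hS.irrefl he).cnt_pow_le.trans ?_
    gcongr
    · norm_num
    · exact firstIdx_le
  -- Without edges no vertex is listed, and there is a single round.
  · rw [ordLen_eq_zero he, Ord.cnt]
    norm_num
    norm_num at hone
    linarith

section Graph

variable {n : ℕ} (G : SimpleGraph (Fin n)) (k : ℕ)

theorem ctx_setting : Setting (ctx G k) (min k n) (natAdj G) 0 (initEnv n k).v where
  W_eq := rfl
  cap_eq := rfl
  inp_zero _ h := graphInput_mem_of_le G k h
  inp_iff u w hw := by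
    classical
    change (graphInput G k).mem (n * u + w) ≠ 0 ↔ _
    by_cases hu : u < n
    · rw [graphInput_mem_adj G k ⟨u, hu⟩ ⟨w, hw⟩]
      simp [natAdj, hu, show w < n from hw]
    · rw [graphInput_mem_of_le G k ((Nat.mul_le_mul_left n (not_lt.mp hu)).trans
        (Nat.le_add_right _ _))]
      simp [natAdj, hu]
  symm := natAdj_symm G
  irrefl := natAdj_irrefl G
  lt := natAdj_lt G
  k_le := min_le_right _ _
  v0 := rfl
  v1 := rfl
  v4 := rfl

end Graph

end ConnectedCover

theorem corollary2p4 :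
    ∃ (P : RAM.Prog) (C : ℝ) (q : Polynomial ℕ),
      ∀ (n k : ℕ) (G : SimpleGraph (Fin n)),
        ∃ (t m : ℕ) (s : RAM.State),
          RAM.Runs P (RAM.graphInput G k) t m s ∧
          (HasConnectedVertexCover G k → s.reg 0 = 1) ∧
          (¬ HasConnectedVertexCover G k → s.reg 0 = 0) ∧
          (t : ℝ) ≤ C * ((1.7088 : ℝ) ^ n + (Nat.size k : ℝ)) ∧
          m ≤ q.eval (n + Nat.size k) := by
  classical
  obtain ⟨P, c, d, hP⟩ := ArrayLang.exists_prog ConnectedCover.preS ConnectedCover.bodyS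
    ConnectedCover.roundsE ConnectedCover.answerE 4 ConnectedCover.preS_wf
    ConnectedCover.roundsE_wf (by omega) ConnectedCover.bodyS_wf ConnectedCover.answerE_wf
  obtain ⟨C, hC, hT⟩ := ConnectedCover.exists_time_bound c d
  -- The summand 12 is the coefficient of `Nat.size k` in the time bound, and the polynomial is the
  -- space bound from `exists_prog`.
  refine ⟨P, C + 12, Polynomial.C c * (Polynomial.X + 1) ^ d, fun n k G => ?_⟩
  obtain ⟨t, m, s, hrun, hs, ht, hm⟩ := hP n k G
  have hS := ConnectedCover.ctx_setting G k
  obtain ⟨hS', hK⟩ := hS.pre_known fun _ _ _ => rfl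
  rw [hS.rounds_eval hK] at hs ht
  obtain ⟨-, -, hK'⟩ := hS'.loop_known hK _ le_rfl
  have hans := hS.answer_eval hK'
  rw [← hs] at hans
  refine ⟨t, m, s, hrun, fun h => ?_, fun h => ?_, ?_, ?_⟩
  · exact hans.trans (if_pos ((ConnectedCover.hasConnectedVertexCover_iff G k).mp h))
  · exact hans.trans (if_neg fun h' => h ((ConnectedCover.hasConnectedVertexCover_iff G k).mpr h'))
  · refine (Nat.cast_le.mpr ht).trans ?_
    have h1 := hT n _ hS.cnt_pow_le
    have h2 : (0 : ℝ) ≤ 1.7088 ^ n := by positivity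
    have h3 : (0 : ℝ) ≤ C * Nat.size k := by positivity
    push_cast
    linarith
  · simpa using hm
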